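/- **Setting.** Let $\langle x\rangle=\sqrt{1+x^2}$ and let derivatives be weak derivatives. For integers $m,s\ge 0$ put $$H^{m,s}(\mathbb R)=\{f\in L^2(\mathbb R):\ \langle\cdot\rangle^s\partial_x^jf\in L^2(\mathbb R),\ j=0,1,\dots,m\},\qquad \|f\|_{H^{m,s}}=\sum_{j=0}^m\|\langle\cdot\rangle^s\partial_x^jf\|_{L^2},$$ $H^m=H^{m,0}$, and $L^{2,1}(\mathbb R)=\{f\in L^2:\langle\cdot\rangle f\in L^2\}$ with $\|f\|_{L^{2,1}}=\|\langle\cdot\rangle f\|_{L^2}$; an intersection carries the sum of the norms. Elements of $H^2(\mathbb R)$ are identified with their continuous representatives. Fix $\sigma\in\{1,-1\}$. For $u\in H^2(\mathbb R)\cap H^{1,1}(\mathbb R)$, complex valued, let $v(x)=i\sigma\,\overline{u(-x)}$ and $$Q_1(u)=\frac1{2i}\begin{bmatrix}-uv&u\\2iv_x-uv^2&uv\end{bmatrix},\qquad Q_2(u)=\frac1{2i}\begin{bmatrix}-uv&-2iu_x-u^2v\\v&uv\end{bmatrix}.$$ For $z\in\mathbb R$ let $\mu_\pm(\cdot,z),\nu_\pm(\cdot,z)\in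 L^\infty(\mathbb R;\mathbb C^2)$ be the solutions of $$\mu_\pm(x,z)=e_1+\int_{\pm\infty}^x\begin{bmatrix}1&0\\0&e^{2iz(x-y)}\end{bmatrix}Q_1(u)(y)\,\mu_\pm(y,z)\,dy,$$ $$\nu_\pm(x,z)=e_2+\int_{\pm\infty}^x\begin{bmatrix}e^{-2iz(x-y)}&0\\0&1\end{bmatrix}Q_2(u)(y)\,\nu_\pm(y,z)\,dy .$$ For $k\in(\mathbb R\cup i\mathbb R)\setminus\{0\}$ and $z=k^2$ let $$\varphi_\pm(x,k)=\begin{bmatrix}1&0\\v(x)&2ik\end{bmatrix}^{-1}\mu_\pm(x,z),\qquad \psi_\pm(x,k)=\begin{bmatrix}2ik&-u(x)\\0&1\end{bmatrix}^{-1}\nu_\pm(x,z),$$ and $\varphi_\pm(x,0)=e_1$, $\psi_\pm(x,0)=e_2$. With $W(f,g)=\det[f,g]$, the scattering data are $$a=W(\varphi_-e^{-ik^2x},\psi_+e^{ik^2x}),\quad b=W(\varphi_+e^{-ik^2x},\varphi_-e^{-ik^2x}),\quad c=W(\psi_-e^{ik^2x},\psi_+e^{ik^2x}),\quad d=W(\varphi_+e^{-ik^2x},\psi_-e^{ik^2x}),$$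 evaluated at $x=0$. The reflection coefficients are $r_1(k)=b(k)/a(k)$, $r_2(k)=c(k)/d(k)$ and, with $k^2=z$, $$r_-(z)=2ik\,r_1(k)=\frac{2ik\,b(k)}{a(k)},\qquad r_+(z)=-\frac{r_2(k)}{2ik}=-\frac{c(k)}{2ik\,d(k)}\qquad(\text{for a.e. } z\in\mathbb R).$$ The small norm condition is $$\|Q_1(u)\|_{L^1}:=\sum_{i,j=1}^2\|Q_1(u)_{ij}\|_{L^1(\mathbb R)}\le 0.295.\tag{S}$$ **Proposition.** (i) Let $u\in H^2(\mathbb R)\cap H^{1,1}(\mathbb R)$ satisfy (S). Then the scattering objects are well defined: $\mu_\pm(\cdot,z)$ and $\nu_\pm(\cdot,z)$ exist and are unique for every $z\in\mathbb R$; for all $k\in\mathbb R\cup i\mathbb R$ and all $x\in\mathbb R$, $$\begin{bmatrix}\varphi_-e^{-ik^2x}&\psi_-e^{ik^2x}\end{bmatrix}=\begin{bmatrix}\varphi_+e^{-ik^2x}&\psi_+e^{ik^2x}\end{bmatrix}\begin{bmatrix}a(k)&c(k)\\b(k)&d(k)\end{bmatrix};$$ $a(k)\neq0$ and $d(k)\ne0$;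 and $r_\pm(z)$ do not depend on the choice of the root $k$ of $z$. Moreover $$r_\pm\in H^1_z(\mathbb R)\cap L^{2,1}_z(\mathbb R),\qquad k\,r_\pm(z)\in L^\infty_z(\mathbb R),\qquad 2ikz\,r_+(z)\in L_z^\infty(\mathbb R).$$ (ii) The map $u\mapsto[r_-,r_+]$, defined on the set of $u\in H^2\cap H^{1,1}$ satisfying (S), is Lipschitz continuous on bounded sets into $H^1\cap L^{2,1}$: for every $\gamma\ge0$ there is a constant $C=C(\gamma)$ such that for all $u,\tilde u\in H^2\cap H^{1,1}$ that satisfy (S) and have $H^2\cap H^{1,1}$ norm at most $\gamma$, with reflection coefficients $r_\pm,\tilde r_\pm$, $$\|r_--\tilde r_-\|_{H^1\cap L^{2,1}}+\|r_+-\tilde r_+\|_{H^1\cap L^{2,1}}\le C\,\|u-\tilde u\|_{H^2\cap H^{1,1}}.$$ -/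

import Mathlib

open MeasureTheory
open scoped ENNReal NNReal ContDiff

noncomputable section

namespace NDNLS

/-! ### Function spaces on the line -/

/-- The Japanese bracket `⟨x⟩ = √(1 + x²)`. -/
def bracket (x : ℝ) : ℝ := Real.sqrt (1 + x ^ 2)

/-- `g` is the `j`-th weak derivative of `f : ℝ → ℂ`
(both locally integrable, tested against real `C_c^∞` functions). -/
def HasWeakDeriv (j : ℕ) (f g : ℝ → ℂ) : Prop :=
  LocallyIntegrable f volume ∧ LocallyIntegrable g volume ∧
    ∀ φ : ℝ → ℝ, ContDiff ℝ ∞ φ → HasCompactSupport φ →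
      ∫ x, iteratedDeriv j φ x • f x = (-1 : ℂ) ^ j * ∫ x, φ x • g x

/-- The `j`-th weak derivative of `f`; it is unique up to null sets, and this is one of
its representatives whenever it exists. -/
def weakDeriv (j : ℕ) (f : ℝ → ℂ) : ℝ → ℂ :=
  Classical.epsilon (HasWeakDeriv j f)

/-- Membership in `H^{m,s}(ℝ)`: for `j = 0, …, m` the weak derivative `∂_x^j f` exists and
`⟨x⟩^s ∂_x^j f ∈ L²`. The unweighted space `H^m(ℝ)` is the case `s = 0`. -/
def MemSobolev (m s : ℕ) (f : ℝ → ℂ) : Prop :=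
  MemLp f 2 volume ∧
    ∀ j ≤ m, ∃ g, HasWeakDeriv j f g ∧ MemLp (fun x => bracket x ^ s • g x) 2 volume

/-- The norm `∑_{j ≤ m} ‖⟨x⟩^s ∂_x^j f‖_{L²}` of `H^{m,s}(ℝ)`, with values in `[0, ∞]`. -/
def sobolevNorm (m s : ℕ) (f : ℝ → ℂ) : ℝ≥0∞ :=
  ∑ j ∈ Finset.range (m + 1),
    eLpNorm (fun x => bracket x ^ s • weakDeriv j f x) 2 volume

/-- Membership in the weighted space `L^{p,s}(ℝ)`. -/
def MemWeightedLp (p : ℝ≥0∞) (s : ℕ) (f : ℝ → ℂ) : Prop :=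
  MemLp f p volume ∧ MemLp (fun x => bracket x ^ s • f x) p volume

/-- The norm `‖⟨x⟩^s f‖_{L^p}` of `L^{p,s}(ℝ)`, with values in `[0, ∞]`. -/
def weightedLpNorm (p : ℝ≥0∞) (s : ℕ) (f : ℝ → ℂ) : ℝ≥0∞ :=
  eLpNorm (fun x => bracket x ^ s • f x) p volume

/-- `u ∈ H²(ℝ) ∩ H^{1,1}(ℝ)`, where an element is identified with its continuous
representative (pointwise values of `u` enter the Jost functions). -/
structure IsPotential (u : ℝ → ℂ) : Prop where
  continuous : Continuous u
  memH2 : MemSobolev 2 0 u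
  memH11 : MemSobolev 1 1 u

/-- The norm of `H²(ℝ) ∩ H^{1,1}(ℝ)`. -/
def potentialNorm (u : ℝ → ℂ) : ℝ≥0∞ := sobolevNorm 2 0 u + sobolevNorm 1 1 u

/-- Membership in `H¹(ℝ) ∩ L^{2,1}(ℝ)`. -/
def MemData (r : ℝ → ℂ) : Prop := MemSobolev 1 0 r ∧ MemWeightedLp 2 1 r

/-- The norm of `H¹(ℝ) ∩ L^{2,1}(ℝ)`. -/
def dataNorm (r : ℝ → ℂ) : ℝ≥0∞ := sobolevNorm 1 0 r + weightedLpNorm 2 1 r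

/-! ### The spectral problem `Φ_x = -ik²σ₃Φ + kQ(u)Φ` and its two transformed versions -/

/-- The nonlocal reduction `v(x) = iσ · conj (u(-x))`. -/
def nonlocalConj (σ : ℝ) (u : ℝ → ℂ) (x : ℝ) : ℂ :=
  Complex.I * σ * starRingEnd ℂ (u (-x))

/-- `Q₁(u) = (1/2i) [[-uv, u], [2i v_x - u v², uv]]`. -/
def Q1 (σ : ℝ) (u : ℝ → ℂ) (x : ℝ) : Matrix (Fin 2) (Fin 2) ℂ :=
  (1 / (2 * Complex.I)) •
    !![-(u x * nonlocalConj σ u x), u x;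
       2 * Complex.I * weakDeriv 1 (nonlocalConj σ u) x - u x * nonlocalConj σ u x ^ 2,
         u x * nonlocalConj σ u x]

/-- `Q₂(u) = (1/2i) [[-uv, -2i u_x - u² v], [v, uv]]`. -/
def Q2 (σ : ℝ) (u : ℝ → ℂ) (x : ℝ) : Matrix (Fin 2) (Fin 2) ℂ :=
  (1 / (2 * Complex.I)) •
    !![-(u x * nonlocalConj σ u x),
         -(2 * Complex.I * weakDeriv 1 u x) - u x ^ 2 * nonlocalConj σ u x;
       nonlocalConj σ u x, u x * nonlocalConj σ u x]

/-- The matrix norm `‖Q‖_{L¹} = ∑_{i,j} ‖Q_{ij}‖_{L¹}`. -/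
def matrixL1Norm (Q : ℝ → Matrix (Fin 2) (Fin 2) ℂ) : ℝ≥0∞ :=
  ∑ i, ∑ j, eLpNorm (fun x => Q x i j) 1 volume

/-- The small norm restriction `‖Q₁(u)‖_{L¹} ≤ 0.295`. -/
def SmallNorm (σ : ℝ) (u : ℝ → ℂ) : Prop :=
  matrixL1Norm (Q1 σ u) ≤ ENNReal.ofReal 0.295

/-- The first unit column vector. -/
def e1 : Fin 2 → ℂ := ![1, 0]

/-- The second unit column vector. -/
def e2 : Fin 2 → ℂ := ![0, 1]

/-- The two ends `-∞`, `+∞` of the line at which Jost functions are normalized. -/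
inductive LineEnd
  | minus
  | plus

/-- The integral `∫_{±∞}^x f(y) dy`. -/
def integralFrom : LineEnd → ℝ → (ℝ → Fin 2 → ℂ) → Fin 2 → ℂ
  | .minus, x, f => ∫ y in Set.Iic x, f y
  | .plus, x, f => -∫ y in Set.Ioi x, f y

/-- `m = μ_±(·, z)` is an `L^∞` solution of the Volterra equation
`μ(x) = e₁ + ∫_{±∞}^x diag(1, e^{2iz(x-y)}) Q₁(y) μ(y) dy`. -/
def IsJostMu (σ : ℝ) (u : ℝ → ℂ) (s : LineEnd) (z : ℂ) (m : ℝ → Fin 2 → ℂ) : Prop :=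
  MemLp m ∞ volume ∧
    ∀ x : ℝ, m x = e1 + integralFrom s x (fun y =>
      (Matrix.diagonal ![1, Complex.exp (2 * Complex.I * z * (x - y))] * Q1 σ u y).mulVec (m y))

/-- `n = ν_±(·, z)` is an `L^∞` solution of the Volterra equation
`ν(x) = e₂ + ∫_{±∞}^x diag(e^{-2iz(x-y)}, 1) Q₂(y) ν(y) dy`. -/
def IsJostNu (σ : ℝ) (u : ℝ → ℂ) (s : LineEnd) (z : ℂ) (n : ℝ → Fin 2 → ℂ) : Prop :=
  MemLp n ∞ volume ∧
    ∀ x : ℝ, n x = e2 + integralFrom s x (fun y =>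
      (Matrix.diagonal ![Complex.exp (-(2 * Complex.I * z * (x - y))), 1] * Q2 σ u y).mulVec (n y))

/-- The normalized Jost function `μ_±(x, z)`. -/
def jostMu (σ : ℝ) (u : ℝ → ℂ) (s : LineEnd) (z : ℂ) : ℝ → Fin 2 → ℂ :=
  Classical.epsilon (IsJostMu σ u s z)

/-- The normalized Jost function `ν_±(x, z)`. -/
def jostNu (σ : ℝ) (u : ℝ → ℂ) (s : LineEnd) (z : ℂ) : ℝ → Fin 2 → ℂ :=
  Classical.epsilon (IsJostNu σ u s z)

/-- `T₁(x, k) = [[1, 0], [v(x), 2ik]]`. -/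
def T1 (σ : ℝ) (u : ℝ → ℂ) (x : ℝ) (k : ℂ) : Matrix (Fin 2) (Fin 2) ℂ :=
  !![1, 0; nonlocalConj σ u x, 2 * Complex.I * k]

/-- `T₂(x, k) = [[2ik, -u(x)], [0, 1]]`. -/
def T2 (u : ℝ → ℂ) (x : ℝ) (k : ℂ) : Matrix (Fin 2) (Fin 2) ℂ :=
  !![2 * Complex.I * k, -u x; 0, 1]

/-- The normalized Jost function `φ_±(x, k) = T₁(x, k)⁻¹ μ_±(x, k²)`, with `φ_±(x, 0) = e₁`. -/
def jostPhi (σ : ℝ) (u : ℝ → ℂ) (s : LineEnd) (x : ℝ) (k : ℂ) : Fin 2 → ℂ :=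
  if k = 0 then e1 else ((T1 σ u x k)⁻¹).mulVec (jostMu σ u s (k ^ 2) x)

/-- The normalized Jost function `ψ_±(x, k) = T₂(x, k)⁻¹ ν_±(x, k²)`, with `ψ_±(x, 0) = e₂`. -/
def jostPsi (σ : ℝ) (u : ℝ → ℂ) (s : LineEnd) (x : ℝ) (k : ℂ) : Fin 2 → ℂ :=
  if k = 0 then e2 else ((T2 u x k)⁻¹).mulVec (jostNu σ u s (k ^ 2) x)

/-! ### Scattering data and reflection coefficients -/

/-- The Wronskian `W(f, g) = det [f, g]`. -/
def wronskian (f g : Fin 2 → ℂ) : ℂ := f 0 * g 1 - f 1 * g 0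

/-- `a(k) = W(φ_- e^{-ik²x}, ψ_+ e^{ik²x})`. This Wronskian, like the three below, does not
depend on `x`; it is evaluated at `x = 0`, where the exponentials equal `1`. -/
def scatA (σ : ℝ) (u : ℝ → ℂ) (k : ℂ) : ℂ :=
  wronskian (jostPhi σ u .minus 0 k) (jostPsi σ u .plus 0 k)

/-- `b(k) = W(φ_+ e^{-ik²x}, φ_- e^{-ik²x})`. -/
def scatB (σ : ℝ) (u : ℝ → ℂ) (k : ℂ) : ℂ :=
  wronskian (jostPhi σ u .plus 0 k) (jostPhi σ u .minus 0 k)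

/-- `c(k) = W(ψ_- e^{ik²x}, ψ_+ e^{ik²x})`. -/
def scatC (σ : ℝ) (u : ℝ → ℂ) (k : ℂ) : ℂ :=
  wronskian (jostPsi σ u .minus 0 k) (jostPsi σ u .plus 0 k)

/-- `d(k) = W(φ_+ e^{-ik²x}, ψ_- e^{ik²x})`. -/
def scatD (σ : ℝ) (u : ℝ → ℂ) (k : ℂ) : ℂ :=
  wronskian (jostPhi σ u .plus 0 k) (jostPsi σ u .minus 0 k)

/-- `r₁(k) = b(k) / a(k)`. -/
def r1 (σ : ℝ) (u : ℝ → ℂ) (k : ℂ) : ℂ := scatB σ u k / scatA σ u k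

/-- `r₂(k) = c(k) / d(k)`. -/
def r2 (σ : ℝ) (u : ℝ → ℂ) (k : ℂ) : ℂ := scatC σ u k / scatD σ u k

/-- The square root `k ∈ ℝ ∪ iℝ` of `z ∈ ℝ` in the closed first quadrant. -/
def specRoot (z : ℝ) : ℂ := (z : ℂ) ^ (1 / 2 : ℂ)

/-- `r_-(z) = 2ik r₁(k)`, `z = k²`. -/
def rMinus (σ : ℝ) (u : ℝ → ℂ) (z : ℝ) : ℂ :=
  2 * Complex.I * specRoot z * r1 σ u (specRoot z)

/-- `r_+(z) = -r₂(k) / (2ik)`, `z = k²` (for `z ≠ 0`; one point does not matter). -/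
def rPlus (σ : ℝ) (u : ℝ → ℂ) (z : ℝ) : ℂ :=
  -r2 σ u (specRoot z) / (2 * Complex.I * specRoot z)

/-- The direct scattering objects are well defined: for real `z` the Jost functions exist and
are unique, `a, b, c, d` are the entries of the scattering matrix,
`[φ_- e^{-ik²x}, ψ_- e^{ik²x}] = [φ_+ e^{-ik²x}, ψ_+ e^{ik²x}] [[a, c], [b, d]]` for all `x`,
the denominators `a`, `d` have no zeros on `ℝ ∪ iℝ`, and `r_±(z)` does not depend on the
choice of the root `k` of `z`. -/
structure DirectScatteringWellDefined (σ : ℝ) (u : ℝ → ℂ) : Prop where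
  existsUnique_mu : ∀ (s : LineEnd) (z : ℝ), ∃! m, IsJostMu σ u s z m
  existsUnique_nu : ∀ (s : LineEnd) (z : ℝ), ∃! n, IsJostNu σ u s z n
  scattering_phi : ∀ (k : ℂ) (z : ℝ), k ^ 2 = z → ∀ x : ℝ,
    Complex.exp (-(Complex.I * k ^ 2 * x)) • jostPhi σ u .minus x k =
      scatA σ u k • Complex.exp (-(Complex.I * k ^ 2 * x)) • jostPhi σ u .plus x k +
      scatB σ u k • Complex.exp (Complex.I * k ^ 2 * x) • jostPsi σ u .plus x k
  scattering_psi : ∀ (k : ℂ) (z : ℝ), k ^ 2 = z → ∀ x : ℝ,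
    Complex.exp (Complex.I * k ^ 2 * x) • jostPsi σ u .minus x k =
      scatC σ u k • Complex.exp (-(Complex.I * k ^ 2 * x)) • jostPhi σ u .plus x k +
      scatD σ u k • Complex.exp (Complex.I * k ^ 2 * x) • jostPsi σ u .plus x k
  a_ne_zero : ∀ (k : ℂ) (z : ℝ), k ^ 2 = z → scatA σ u k ≠ 0
  d_ne_zero : ∀ (k : ℂ) (z : ℝ), k ^ 2 = z → scatD σ u k ≠ 0
  root_independent : ∀ (k : ℂ) (z : ℝ), k ^ 2 = z →
    rMinus σ u z = 2 * Complex.I * k * r1 σ u k ∧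
    rPlus σ u z = -r2 σ u k / (2 * Complex.I * k)

end NDNLS

end

/-!
The two transformed spectral problems are one problem: for a pair `(u, v)` of independent complex
functions, the solution `μ₋` of the first problem is called the Jost solution of the pair, and
`ν₋` is the Jost solution of the interchanged pair `(v, -u)` at the spectral parameter `-z`, while
reflection `x ↦ -x` turns the normalization at `+∞` into the one at `-∞` (`Pair.swap`,
`Pair.refl`). The relation `v(x) = iσ conj (u(-x))` enters only through the facts that `v` has the
norms of `u` and that the interchanged pair is as small as the original one.

After the factor `e^{2izx}` has been moved into the coefficients, the Jost solution solves a
Volterra system in the bounded continuous functions whose operator has norm at most `3/10` by the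
small norm condition. This gives existence and uniqueness (`SmallSystem.unique`), and it keeps the
limit `α` of the first component at `+∞` away from zero (`Good.half_le_norm_alpha`). In the
variables `(μ₁, μ₂ - v μ₁)` the system contains no derivative of `v`, so that Wronskians can be
differentiated; they are constant, and their limits at `+∞` give `a(k) = α(z)`, `d(k) = α'(-z)`,
where `α'` belongs to the interchanged pair, and `2ik b(k) = 2iz β(z)`, `2ik c(k) = -2iz β'(-z)`
with `β = ∫ e^{-2izx} v μ₁ dx`. Hence `r_-(z) = 2iz ρ(z)` and `r_+(z) = ρ'(-z) / 2i` with
`ρ = β / α`, and the scattering relation is Cramer's rule.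

All that remains is to bound `ρ`, `z ρ`, `z² ρ` and the difference quotients of `ρ` and `z ρ` in
`L²`, uniformly on bounded sets of pairs (`Pair.exists_dataBound`). The gauge factor
`exp ∫_{-∞}^x uv/2i` removes the diagonal coefficients; then `ρ` is a quotient of oscillating
integrals whose amplitudes have bounded variation in `x`. For such amplitudes Plancherel's theorem
holds up to a constant, because they are superpositions of indicators of half-lines
(`eLpNorm_osc_amplitude_le`). One factor `z` is gained from the equation for the second component,
the second one by an integration by parts (`GaugeSystem.eLpNorm_mul_oscPair_le`), and the
difference quotients of the Jost solution satisfy a system with the same small coefficients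
(`GaugeSystem.eLpNorm_sub_le`). A function in `L²` with bounded difference quotients is in `H¹`
(`exists_weakDeriv_of_translation_le`), and a function in `H¹ ∩ L^{2,1}` is `O(|z|^{-1/2})`
(`sqrt_abs_mul_norm_le`), which gives the claims in `L^∞`.

Lipschitz continuity needs no further estimates. Along a complex line of pairs `ρ(z)` is holomorphic
for each `z`, and the uniform bounds hold in a disc whose radius is inversely proportional to the
distance of the two pairs, because the Volterra operator still has norm at most `3/10 > 0.295`
there. Cauchy's formula turns boundedness into the Lipschitz bound (`Pair.exists_dataBound_sub`).
This is where it matters that pairs are arbitrary: the relation between `u` and `v` is not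
complex linear.
-/

noncomputable section

open Filter Topology
open scoped FourierTransform BoundedContinuousFunction

namespace NDNLS

/-! ### Fourier integrals in `L²` -/

/-- The oscillating factor `e^{2izx}`. -/
def osc (z x : ℝ) : ℂ := Complex.exp ((2 * z * x : ℝ) * Complex.I)

theorem norm_osc (z x : ℝ) : ‖osc z x‖ = 1 := Complex.norm_exp_ofReal_mul_I _

theorem continuous_osc : Continuous fun q : ℝ × ℝ => osc q.1 q.2 := by
  unfold osc; fun_prop

theorem continuous_osc_right (z : ℝ) : Continuous (osc z) := by
  unfold osc; fun_prop

theorem osc_mul_osc_neg (z x : ℝ) : osc z x * osc (-z) x = 1 := by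
  unfold osc
  rw [← Complex.exp_add]
  simp

theorem osc_add (z w x : ℝ) : osc (z + w) x = osc z x * osc w x := by
  unfold osc
  rw [← Complex.exp_add]
  congr 1
  push_cast
  ring

/-- The pointwise Fourier integral of `f ∈ L¹ ∩ L²` represents its `L²` Fourier transform. -/
theorem fourier_ae_eq_Lp {f : ℝ → ℂ} (hf : Integrable f) (hf2 : MemLp f 2) :
    𝓕 f =ᵐ[volume] (𝓕 (hf2.toLp f) : Lp ℂ 2 (volume : Measure ℝ)) := by
  have hcont : Continuous (𝓕 f) :=
    VectorFourier.fourierIntegral_continuous Real.continuous_fourierChar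
      (by exact (innerSL ℝ).continuous₂) hf
  refine ae_eq_of_integral_contDiff_smul_eq hcont.locallyIntegrable
    ((Lp.memLp _).locallyIntegrable (by norm_num)) fun g hg hgc => ?_
  have hgC : ContDiff ℝ ∞ fun x => (g x : ℂ) := Complex.ofRealCLM.contDiff.comp hg
  have hgc' : HasCompactSupport fun x => (g x : ℂ) := hgc.comp_left Complex.ofReal_zero
  set φ : SchwartzMap ℝ ℂ := hgc'.toSchwartzMap hgC
  have h1 : ∫ x, g x • (𝓕 (hf2.toLp f) : Lp ℂ 2 (volume : Measure ℝ)) x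
      = ∫ x, (𝓕 φ) x • f x := by
    have := congrArg (fun T => T φ) (Lp.fourier_toTemperedDistribution_eq (hf2.toLp f))
    simp only [TemperedDistribution.fourier_apply, Lp.toTemperedDistribution_apply] at this
    calc _ = ∫ x, φ x • (𝓕 (hf2.toLp f) : Lp ℂ 2 (volume : Measure ℝ)) x := by
            refine integral_congr_ae (Eventually.of_forall fun x => ?_)
            simp [φ]
      _ = _ := this.symm
      _ = _ := by
            refine integral_congr_ae ?_
            filter_upwards [hf2.coeFn_toLp] with x hx
            rw [hx]
  rw [h1]
  have h2 := VectorFourier.integral_fourierIntegral_smul_eq_flip (μ := (volume : Measure ℝ))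
    (ν := (volume : Measure ℝ)) (L := innerₗ ℝ) (f := fun x => φ x) (g := f)
    Real.continuous_fourierChar (by exact (innerSL ℝ).continuous₂) φ.integrable hf
  rw [flip_innerₗ] at h2
  calc _ = ∫ x, φ x • 𝓕 f x := by
            refine integral_congr_ae (Eventually.of_forall fun x => ?_)
            simp [φ]
    _ = _ := by
            rw [SchwartzMap.fourier_coe]
            exact h2.symm

/-- Plancherel's theorem for the pointwise Fourier integral. -/
theorem eLpNorm_fourier_eq {f : ℝ → ℂ} (hf : Integrable f) (hf2 : MemLp f 2) :
    eLpNorm (𝓕 f) 2 volume = eLpNorm f 2 volume := by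
  rw [eLpNorm_congr_ae (fourier_ae_eq_Lp hf hf2), ← Lp.enorm_def, ← eLpNorm_congr_ae hf2.coeFn_toLp,
    ← Lp.enorm_def, ← ofReal_norm, ← ofReal_norm, Lp.norm_fourier_eq]

/-- The Fourier integral `z ↦ ∫ e^{2izx} f(x) dx`. -/
def oscInt (f : ℝ → ℂ) (z : ℝ) : ℂ := ∫ x, osc z x * f x

theorem eLpNorm_comp_neg_div_pi (F : ℝ → ℂ) (hF : AEStronglyMeasurable F volume) :
    eLpNorm (fun z => F (-z / Real.pi)) 2 volume ≤ 2 * eLpNorm F 2 volume := by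
  have ha : (-(1 / Real.pi)) ≠ 0 := neg_ne_zero.mpr (by positivity)
  have h := Real.map_volume_mul_left ha
  have hF' : AEStronglyMeasurable F (Measure.map (fun x => -(1 / Real.pi) * x) volume) := by
    rw [h]; exact hF.smul_measure _
  have h1 : (fun z => F (-z / Real.pi)) = F ∘ fun x => -(1 / Real.pi) * x := by
    ext z; simp only [Function.comp]; congr 1; ring
  rw [h1, ← eLpNorm_map_measure hF' (by fun_prop), h, eLpNorm_smul_measure_of_ne_zero]
  · rw [smul_eq_mul]
    gcongr
    have : |(-(1 / Real.pi))⁻¹| = Real.pi := by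
      rw [abs_inv, abs_neg, abs_of_pos (by positivity)]; simp
    rw [this]
    calc ENNReal.ofReal Real.pi ^ (1 / (2 : ℝ≥0∞)).toReal
        ≤ (4 : ℝ≥0∞) ^ (1 / (2 : ℝ≥0∞)).toReal := by
          gcongr
          rw [show (4 : ℝ≥0∞) = ENNReal.ofReal 4 by simp]
          exact ENNReal.ofReal_le_ofReal Real.pi_le_four
      _ = 2 := by
          rw [show (4 : ℝ≥0∞) = 2 ^ (2 : ℝ) by norm_num, ← ENNReal.rpow_mul]
          norm_num
  · simp [Real.pi_ne_zero]

theorem oscInt_eq_fourier (f : ℝ → ℂ) (z : ℝ) : oscInt f z = 𝓕 f (-z / Real.pi) := by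
  rw [oscInt, Real.fourier_real_eq_integral_exp_smul]
  refine integral_congr_ae (Eventually.of_forall fun x => ?_)
  simp only [osc, smul_eq_mul]
  congr 3
  push_cast
  field_simp

theorem continuous_fourier {f : ℝ → ℂ} (hf : Integrable f) : Continuous (𝓕 f) :=
  VectorFourier.fourierIntegral_continuous Real.continuous_fourierChar
    (by exact (innerSL ℝ).continuous₂) hf

theorem continuous_oscInt {f : ℝ → ℂ} (hf : Integrable f) : Continuous (oscInt f) := by
  have : oscInt f = fun z => 𝓕 f (-z / Real.pi) := funext (oscInt_eq_fourier f)
  rw [this]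
  exact (continuous_fourier hf).comp (by fun_prop)

theorem eLpNorm_oscInt_le {f : ℝ → ℂ} (hf : Integrable f) (hf2 : MemLp f 2) :
    eLpNorm (oscInt f) 2 volume ≤ 2 * eLpNorm f 2 volume := by
  rw [← eLpNorm_fourier_eq hf hf2, funext (oscInt_eq_fourier f)]
  exact eLpNorm_comp_neg_div_pi _ (continuous_fourier hf).aestronglyMeasurable

/-! ### Minkowski's integral inequality and oscillating integrals with amplitudes -/

section
variable {α β : Type*} [MeasurableSpace α] [MeasurableSpace β]

/-- Minkowski's integral inequality for the exponent `2`. -/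
theorem lintegral_sq_lintegral_le {μ : Measure α} {ν : Measure β} [SFinite μ] [SFinite ν]
    {f : α → β → ℝ≥0∞} (hf : Measurable (Function.uncurry f)) :
    (∫⁻ z, (∫⁻ y, f y z ∂μ) ^ (2 : ℝ) ∂ν) ^ (1 / 2 : ℝ) ≤
      ∫⁻ y, (∫⁻ z, f y z ^ (2 : ℝ) ∂ν) ^ (1 / 2 : ℝ) ∂μ := by
  have hfy : ∀ y, Measurable (f y) := fun y => hf.comp measurable_prodMk_left
  have hfz : ∀ z, Measurable fun y => f y z := fun z => hf.comp measurable_prodMk_right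
  set g : α → ℝ≥0∞ := fun y => (∫⁻ z, f y z ^ (2 : ℝ) ∂ν) ^ (1 / 2 : ℝ)
  have hg : Measurable g := by
    refine Measurable.pow_const ?_ _
    exact Measurable.lintegral_prod_right' (f := fun q : α × β => f q.1 q.2 ^ (2 : ℝ))
      (hf.pow_const _)
  have key : ∫⁻ z, (∫⁻ y, f y z ∂μ) ^ (2 : ℝ) ∂ν ≤ (∫⁻ y, g y ∂μ) ^ (2 : ℝ) := by
    have e1 : ∀ z, (∫⁻ y, f y z ∂μ) ^ (2 : ℝ) = ∫⁻ y, ∫⁻ y', f y z * f y' z ∂μ ∂μ := by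
      intro z
      rw [ENNReal.rpow_two, sq, ← lintegral_mul_const _ (hfz z)]
      refine lintegral_congr fun y => ?_
      rw [lintegral_const_mul _ (hfz z)]
    calc ∫⁻ z, (∫⁻ y, f y z ∂μ) ^ (2 : ℝ) ∂ν
        = ∫⁻ z, ∫⁻ y, ∫⁻ y', f y z * f y' z ∂μ ∂μ ∂ν := lintegral_congr e1
      _ = ∫⁻ y, ∫⁻ z, ∫⁻ y', f y z * f y' z ∂μ ∂ν ∂μ := by
          refine lintegral_lintegral_swap (Measurable.aemeasurable ?_)
          refine Measurable.lintegral_prod_right'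
            (f := fun q : (β × α) × α => f q.1.2 q.1.1 * f q.2 q.1.1) ?_
          exact (hf.comp (f := fun q : (β × α) × α => (q.1.2, q.1.1)) (by fun_prop)).mul
            (hf.comp (f := fun q : (β × α) × α => (q.2, q.1.1)) (by fun_prop))
      _ = ∫⁻ y, ∫⁻ y', ∫⁻ z, f y z * f y' z ∂ν ∂μ ∂μ := by
          refine lintegral_congr fun y => lintegral_lintegral_swap (Measurable.aemeasurable ?_)
          exact ((hfy y).comp measurable_fst).mul
            (hf.comp (f := fun q : β × α => (q.2, q.1)) (by fun_prop))
      _ ≤ ∫⁻ y, ∫⁻ y', g y * g y' ∂μ ∂μ := by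
          refine lintegral_mono fun y => lintegral_mono fun y' => ?_
          exact ENNReal.lintegral_mul_le_Lp_mul_Lq ν Real.HolderConjugate.two_two
            (hfy y).aemeasurable (hfy y').aemeasurable
      _ = (∫⁻ y, g y ∂μ) ^ (2 : ℝ) := by
          rw [ENNReal.rpow_two, sq, ← lintegral_mul_const _ hg]
          refine lintegral_congr fun y => ?_
          rw [lintegral_const_mul _ hg]
  calc _ ≤ ((∫⁻ y, g y ∂μ) ^ (2 : ℝ)) ^ (1 / 2 : ℝ) := by gcongr
    _ = _ := by rw [← ENNReal.rpow_mul]; norm_num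

theorem eLpNorm_two_eq {E : Type*} [ENorm E] {ν : Measure β} (f : β → E) :
    eLpNorm f 2 ν = (∫⁻ z, ‖f z‖ₑ ^ (2 : ℝ) ∂ν) ^ (1 / 2 : ℝ) := by
  rw [eLpNorm_eq_lintegral_rpow_enorm_toReal (by norm_num) (by norm_num)]
  norm_num

/-- A function of `z` dominated by `∫ F(y, z) dy` has `L²` norm at most `∫ ‖F(y, ·)‖_{L²} dy`. -/
theorem eLpNorm_le_of_le_lintegral {E E' : Type*} [ENorm E] [NormedAddCommGroup E']
    {μ : Measure α} {ν : Measure β} [SFinite μ] [SFinite ν] {g : β → E} {c : α → ℝ≥0∞}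
    {F : α → β → E'} (hc : Measurable c) (hF : Measurable fun q : α × β => ‖F q.1 q.2‖ₑ)
    (h : ∀ z, ‖g z‖ₑ ≤ ∫⁻ y, c y * ‖F y z‖ₑ ∂μ) :
    eLpNorm g 2 ν ≤ ∫⁻ y, c y * eLpNorm (F y) 2 ν ∂μ := by
  rw [eLpNorm_two_eq]
  calc _ ≤ (∫⁻ z, (∫⁻ y, c y * ‖F y z‖ₑ ∂μ) ^ (2 : ℝ) ∂ν) ^ (1 / 2 : ℝ) := by
        gcongr with z; exact h z
    _ ≤ _ := lintegral_sq_lintegral_le ((hc.comp measurable_fst).mul hF)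
    _ = _ := by
        refine lintegral_congr fun y => ?_
        rw [eLpNorm_two_eq]
        have hFy : Measurable fun z => ‖F y z‖ₑ := hF.comp measurable_prodMk_left
        simp_rw [ENNReal.mul_rpow_of_nonneg _ _ (show (0 : ℝ) ≤ 2 by norm_num)]
        rw [lintegral_const_mul _ (hFy.pow_const _), ENNReal.mul_rpow_of_nonneg _ _ (by norm_num),
          ← ENNReal.rpow_mul]
        norm_num

end

theorem continuous_integral_Iic {E : Type*} [NormedAddCommGroup E] [NormedSpace ℝ E] {f : ℝ → E}
    (hf : Integrable f) : Continuous fun x => ∫ y in Set.Iic x, f y := by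
  have h : ∀ x, ∫ y in Set.Iic x, f y = (∫ y in Set.Iic 0, f y) + ∫ y in (0 : ℝ)..x, f y := by
    intro x
    rw [← intervalIntegral.integral_Iic_sub_Iic hf.integrableOn hf.integrableOn]
    abel
  rw [funext h]
  exact continuous_const.add
    (intervalIntegral.continuous_primitive (fun a b => hf.intervalIntegrable) 0)

theorem integrable_osc_mul {f : ℝ → ℂ} (hf : Integrable f) (z : ℝ) :
    Integrable fun x => osc z x * f x :=
  hf.bdd_mul (continuous_osc_right z).aestronglyMeasurable
    (Eventually.of_forall fun x => (norm_osc z x).le)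

/-- An oscillating integral whose amplitude `g(·, z)` has bounded variation, uniformly in `z`,
is bounded in `L²_z` by the `L²` norm of `f`: the amplitude is written as an integral of
indicators of half-lines, and on each half-line Plancherel's theorem applies. -/
theorem eLpNorm_osc_amplitude_le {f : ℝ → ℂ} (hf : Integrable f) (hf2 : MemLp f 2)
    {g G : ℝ → ℝ → ℂ} {g0 : ℝ → ℂ} {Γ : ℝ → ℝ} {c c' : ℝ≥0∞}
    (hg : ∀ x z, g x z = g0 z + ∫ y in Set.Iic x, G y z) (hg0 : ∀ z, ‖g0 z‖ₑ ≤ c)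
    (hG : ∀ z, Integrable fun y => G y z) (hGΓ : ∀ y z, ‖G y z‖ ≤ Γ y)
    (hΓ : Measurable Γ) (hΓc : ∫⁻ y, ‖Γ y‖ₑ ≤ c') :
    eLpNorm (fun z => ∫ x, osc z x * (f x * g x z)) 2 volume ≤
      2 * (c + c') * eLpNorm f 2 volume := by
  wlog hfm : StronglyMeasurable f generalizing f
  · have hae := hf.aestronglyMeasurable.ae_eq_mk
    have := this (hf.congr hae) (hf2.ae_eq hae) hf.aestronglyMeasurable.stronglyMeasurable_mk
    rw [← eLpNorm_congr_ae hae] at this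
    refine le_trans (le_of_eq ?_) this
    congr 1
    ext z
    refine integral_congr_ae ?_
    filter_upwards [hae] with x hx
    rw [← hx]
  set F : ℝ → ℝ → ℂ := fun y z => oscInt ((Set.Ici y).indicator f) z
  have hFm : Measurable fun q : ℝ × ℝ => ‖F q.1 q.2‖ₑ := by
    refine (StronglyMeasurable.measurable ?_).enorm
    refine StronglyMeasurable.integral_prod_right
      (f := fun (q : ℝ × ℝ) x => osc q.2 x * (Set.Ici q.1).indicator f x) ?_
    refine StronglyMeasurable.mul ?_ ?_
    · exact (continuous_osc.comp (f := fun q : (ℝ × ℝ) × ℝ => (q.1.2, q.2))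
        (by fun_prop)).stronglyMeasurable
    · have : (fun q : (ℝ × ℝ) × ℝ => (Set.Ici q.1.1).indicator f q.2)
          = Set.indicator {q : (ℝ × ℝ) × ℝ | q.1.1 ≤ q.2} fun q => f q.2 := by
        ext q
        simp [Set.indicator]
      rw [this]
      exact (hfm.comp_measurable measurable_snd).indicator
        (measurableSet_le (by fun_prop) (by fun_prop))
  -- by Fubini, the amplitude becomes a superposition of indicators of the half-lines `[y, ∞)`
  have hswap : ∀ z, ∫ x, osc z x * (f x * ∫ y in Set.Iic x, G y z) = ∫ y, G y z * F y z := by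
    intro z
    have hI : Integrable (fun q : ℝ × ℝ =>
        (osc z q.1 * f q.1) * ((Set.Iic q.1).indicator (fun y => G y z) q.2))
        (volume.prod volume) := by
      have h0 := (integrable_osc_mul hf z).mul_prod (hG z)
      have : (fun q : ℝ × ℝ =>
          (osc z q.1 * f q.1) * ((Set.Iic q.1).indicator (fun y => G y z) q.2))
          = Set.indicator {q : ℝ × ℝ | q.2 ≤ q.1} fun q => osc z q.1 * f q.1 * G q.2 z := by
        ext q
        by_cases h : q.2 ≤ q.1 <;> simp [Set.indicator, h]
      rw [this]
      exact h0.indicator (measurableSet_le (by fun_prop) (by fun_prop))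
    calc _ = ∫ x, ∫ y, (osc z x * f x) * ((Set.Iic x).indicator (fun y => G y z) y) := by
          refine integral_congr_ae (Eventually.of_forall fun x => ?_)
          simp only
          rw [integral_const_mul, integral_indicator measurableSet_Iic, mul_assoc]
      _ = ∫ y, ∫ x, (osc z x * f x) * ((Set.Iic x).indicator (fun y => G y z) y) :=
          integral_integral_swap hI
      _ = _ := by
          refine integral_congr_ae (Eventually.of_forall fun y => ?_)
          simp only [F, oscInt]
          rw [← integral_const_mul]
          refine integral_congr_ae (Eventually.of_forall fun x => ?_)
          by_cases h : y ≤ x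
          · simp [Set.indicator, h]; ring
          · simp [Set.indicator, h]
  have hpt : ∀ z, ‖∫ x, osc z x * (f x * g x z)‖ₑ ≤
      ‖c * ‖oscInt f z‖ₑ + ∫⁻ y, ‖Γ y‖ₑ * ‖F y z‖ₑ‖ₑ := by
    intro z
    have hb : ∀ x, ‖∫ y in Set.Iic x, G y z‖ ≤ ∫ y, ‖G y z‖ := fun x =>
      (norm_integral_le_integral_norm _).trans
        (setIntegral_le_integral (hG z).norm (Eventually.of_forall fun _ => norm_nonneg _))
    have hcont : StronglyMeasurable fun x => ∫ y in Set.Iic x, G y z :=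
      (continuous_integral_Iic (hG z)).stronglyMeasurable
    have h1 : Integrable fun x => osc z x * f x * ∫ y in Set.Iic x, G y z :=
      (integrable_osc_mul hf z).mul_bdd hcont.aestronglyMeasurable (Eventually.of_forall hb)
    have e : ∫ x, osc z x * (f x * g x z) = g0 z * oscInt f z + ∫ y, G y z * F y z := by
      rw [← hswap, oscInt, ← integral_const_mul, ← integral_add]
      · refine integral_congr_ae (Eventually.of_forall fun x => ?_)
        simp only [hg]
        ring
      · exact (integrable_osc_mul hf z).const_mul _
      · simpa only [mul_assoc] using h1
    rw [e, enorm_eq_self]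
    refine (enorm_add_le _ _).trans ?_
    gcongr
    · rw [enorm_mul]; gcongr; exact hg0 z
    · refine (enorm_integral_le_lintegral_enorm _).trans (lintegral_mono fun y => ?_)
      rw [enorm_mul]
      gcongr
      exact enorm_le_iff_norm_le.2 ((hGΓ y z).trans (le_abs_self _))
  have hF2 : ∀ y, eLpNorm (F y) 2 volume ≤ 2 * eLpNorm f 2 volume := fun y =>
    (eLpNorm_oscInt_le (hf.indicator measurableSet_Ici) (hf2.indicator measurableSet_Ici)).trans
      (by gcongr; exact eLpNorm_indicator_le _)
  have hm1 : Measurable fun z => c * ‖oscInt f z‖ₑ :=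
    (continuous_oscInt hf).measurable.enorm.const_mul c
  have hm2 : Measurable fun z => ∫⁻ y, ‖Γ y‖ₑ * ‖F y z‖ₑ :=
    Measurable.lintegral_prod_left' (f := fun q : ℝ × ℝ => ‖Γ q.1‖ₑ * ‖F q.1 q.2‖ₑ)
      ((hΓ.enorm.comp measurable_fst).mul hFm)
  calc _ ≤ eLpNorm (fun z => c * ‖oscInt f z‖ₑ + ∫⁻ y, ‖Γ y‖ₑ * ‖F y z‖ₑ) 2 volume :=
        eLpNorm_mono_enorm hpt
    _ ≤ eLpNorm (fun z => c * ‖oscInt f z‖ₑ) 2 volume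
        + eLpNorm (fun z => ∫⁻ y, ‖Γ y‖ₑ * ‖F y z‖ₑ) 2 volume :=
        eLpNorm_add_le hm1.aestronglyMeasurable hm2.aestronglyMeasurable (by norm_num)
    _ ≤ c * eLpNorm (oscInt f) 2 volume + ∫⁻ y, ‖Γ y‖ₑ * eLpNorm (F y) 2 volume := by
        gcongr
        · have := eLpNorm_le_of_le_lintegral (μ := Measure.dirac ()) (ν := volume)
            (g := fun z => c * ‖oscInt f z‖ₑ) (c := fun _ => c) (F := fun _ z => oscInt f z)
            measurable_const ((continuous_oscInt hf).measurable.enorm.comp measurable_snd)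
            (fun z => by simp)
          simpa using this
        · exact eLpNorm_le_of_le_lintegral hΓ.enorm hFm fun z => by simp
    _ ≤ c * (2 * eLpNorm f 2 volume) + ∫⁻ y, ‖Γ y‖ₑ * (2 * eLpNorm f 2 volume) := by
        gcongr with y
        · exact eLpNorm_oscInt_le hf hf2
        · exact hF2 y
    _ ≤ c * (2 * eLpNorm f 2 volume) + c' * (2 * eLpNorm f 2 volume) := by
        gcongr
        rw [lintegral_mul_const _ hΓ.enorm]
        gcongr
    _ = _ := by ring

/-! ### Weak derivatives and primitives -/

theorem weakDeriv_ae_eq {j : ℕ} {f g : ℝ → ℂ} (h : HasWeakDeriv j f g) :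
    weakDeriv j f =ᵐ[volume] g := by
  have h' : HasWeakDeriv j f (weakDeriv j f) := Classical.epsilon_spec ⟨g, h⟩
  refine ae_eq_of_integral_contDiff_smul_eq h'.2.1 h.2.1 fun φ hφ hc => ?_
  have h1 := h'.2.2 φ hφ hc
  rw [h.2.2 φ hφ hc] at h1
  exact (mul_left_cancel₀ (pow_ne_zero _ (by norm_num)) h1).symm

theorem _root_.ContDiff.iteratedDeriv_hasCompactSupport {φ : ℝ → ℝ} (hc : HasCompactSupport φ)
    (j : ℕ) : HasCompactSupport (iteratedDeriv j φ) := by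
  induction j with
  | zero => simpa
  | succ n ih => rw [iteratedDeriv_succ]; exact ih.deriv

theorem integrable_test_smul {f : ℝ → ℂ} (hf : LocallyIntegrable f volume) {φ : ℝ → ℝ}
    (hφ : Continuous φ) (hc : HasCompactSupport φ) : Integrable fun x => φ x • f x :=
  hf.integrable_smul_left_of_hasCompactSupport hφ hc

theorem HasWeakDeriv.sub {j : ℕ} {f g f' g' : ℝ → ℂ} (h : HasWeakDeriv j f g)
    (h' : HasWeakDeriv j f' g') : HasWeakDeriv j (f - f') (g - g') := by
  refine ⟨h.1.sub h'.1, h.2.1.sub h'.2.1, fun φ hφ hc => ?_⟩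
  have hd : Continuous (iteratedDeriv j φ) := hφ.continuous_iteratedDeriv j (by exact_mod_cast le_top)
  have hdc := ContDiff.iteratedDeriv_hasCompactSupport hc j
  simp only [Pi.sub_apply, smul_sub]
  rw [integral_sub (integrable_test_smul h.1 hd hdc) (integrable_test_smul h'.1 hd hdc),
    integral_sub (integrable_test_smul h.2.1 hφ.continuous hc)
      (integrable_test_smul h'.2.1 hφ.continuous hc), h.2.2 φ hφ hc, h'.2.2 φ hφ hc]
  ring

theorem HasWeakDeriv.zero {f : ℝ → ℂ} (hf : LocallyIntegrable f volume) : HasWeakDeriv 0 f f :=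
  ⟨hf, hf, fun φ _ _ => by simp⟩

theorem HasWeakDeriv.congr {j : ℕ} {f g f' g' : ℝ → ℂ} (h : HasWeakDeriv j f g)
    (hf : f =ᵐ[volume] f') (hg : g =ᵐ[volume] g') : HasWeakDeriv j f' g' := by
  refine ⟨(locallyIntegrable_congr hf).1 h.1, (locallyIntegrable_congr hg).1 h.2.1, fun φ hφ hc => ?_⟩
  have h1 := h.2.2 φ hφ hc
  calc _ = ∫ x, iteratedDeriv j φ x • f x := by
        refine integral_congr_ae ?_; filter_upwards [hf] with x hx; rw [hx]
    _ = _ := h1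
    _ = _ := by
        congr 1
        refine integral_congr_ae ?_; filter_upwards [hg] with x hx; rw [hx]

theorem HasWeakDeriv.of_second {f g g2 : ℝ → ℂ} (h1 : HasWeakDeriv 1 f g)
    (h2 : HasWeakDeriv 2 f g2) : HasWeakDeriv 1 g g2 := by
  refine ⟨h1.2.1, h2.2.1, fun φ hφ hc => ?_⟩
  have hd : ContDiff ℝ ∞ (deriv φ) := (contDiff_infty_iff_deriv.1 hφ).2
  have e1 := h1.2.2 (deriv φ) hd hc.deriv
  have e2 := h2.2.2 φ hφ hc
  rw [show iteratedDeriv 1 (deriv φ) = iteratedDeriv 2 φ by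
    rw [iteratedDeriv_succ' (n := 1)], e2] at e1
  rw [iteratedDeriv_one]
  have : (-1 : ℂ) ^ 2 * ∫ x, φ x • g2 x = - ∫ x, deriv φ x • g x := by rw [e1]; ring
  linear_combination this

/-- Integration by parts when one factor is merely a primitive of a locally integrable function. -/
theorem integral_primitive_mul_deriv {f f' g g' : ℝ → ℂ} {a b : ℝ} (hab : a ≤ b)
    (hf' : IntervalIntegrable f' volume a b) (hf : ∀ x, f x - f a = ∫ y in a..x, f' y)
    (hg : ∀ x, HasDerivAt g (g' x) x) (hg' : Continuous g') :
    ∫ x in a..b, f x * g' x = f b * g b - f a * g a - ∫ x in a..b, f' x * g x := by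
  have hFTC : ∀ x y, ∫ t in x..y, g' t = g y - g x := fun x y =>
    intervalIntegral.integral_eq_sub_of_hasDerivAt (fun t _ => hg t) (hg'.intervalIntegrable _ _)
  have hgc : Continuous g := continuous_iff_continuousAt.2 fun x => (hg x).continuousAt
  have hf'i : IntegrableOn f' (Set.Ioc a b) := (intervalIntegrable_iff_integrableOn_Ioc_of_le hab).1 hf'
  have hg'i : IntegrableOn g' (Set.Ioc a b) :=
    (intervalIntegrable_iff_integrableOn_Ioc_of_le hab).1 (hg'.intervalIntegrable _ _)
  have hI : Integrable (fun q : ℝ × ℝ => Set.indicator {q : ℝ × ℝ | q.2 ≤ q.1}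
      (fun q => g' q.1 * f' q.2) q)
      ((volume.restrict (Set.Ioc a b)).prod (volume.restrict (Set.Ioc a b))) :=
    (hg'i.mul_prod hf'i).indicator (measurableSet_le (by fun_prop) (by fun_prop))
  have hsw := integral_integral_swap (f := fun x y => Set.indicator {q : ℝ × ℝ | q.2 ≤ q.1}
      (fun q => g' q.1 * f' q.2) (x, y)) hI
  have e1 : ∫ x in Set.Ioc a b, ∫ y in Set.Ioc a b, Set.indicator {q : ℝ × ℝ | q.2 ≤ q.1}
      (fun q => g' q.1 * f' q.2) (x, y) = ∫ x in a..b, (f x - f a) * g' x := by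
    rw [intervalIntegral.integral_of_le hab]
    refine setIntegral_congr_fun measurableSet_Ioc fun x hx => ?_
    rw [hf, intervalIntegral.integral_of_le hx.1.le, mul_comm, ← integral_const_mul,
      ← integral_indicator measurableSet_Ioc, ← integral_indicator measurableSet_Ioc]
    congr 1
    ext y
    simp only [Set.indicator, Set.mem_Ioc, Set.mem_ofPred_eq]
    by_cases h1 : a < y <;> by_cases h2 : y ≤ x
    · simp [h1, h2, h2.trans hx.2]
    · simp [h1, h2]
    · simp [h1]
    · simp [h1]
  have e2 : ∫ y in Set.Ioc a b, ∫ x in Set.Ioc a b, Set.indicator {q : ℝ × ℝ | q.2 ≤ q.1}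
      (fun q => g' q.1 * f' q.2) (x, y) = ∫ y in a..b, f' y * (g b - g y) := by
    rw [intervalIntegral.integral_of_le hab]
    refine setIntegral_congr_fun measurableSet_Ioc fun y hy => ?_
    rw [← hFTC, intervalIntegral.integral_of_le hy.2, ← integral_const_mul,
      ← integral_Icc_eq_integral_Ioc, ← integral_Icc_eq_integral_Ioc,
      ← integral_indicator measurableSet_Icc, ← integral_indicator measurableSet_Icc]
    congr 1
    ext x
    simp only [Set.indicator, Set.mem_Icc, Set.mem_ofPred_eq]
    by_cases h1 : y ≤ x <;> by_cases h2 : x ≤ b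
    · simp [h1, h2, hy.1.le.trans h1, mul_comm]
    · simp [h2]
    · simp [h1]
    · simp [h1]
  rw [e1, e2] at hsw
  have hfc : ContinuousOn f (Set.uIcc a b) := by
    have : f = fun x => f a + ∫ y in a..x, f' y := by ext x; rw [← hf]; ring
    rw [this]
    refine continuousOn_const.add (intervalIntegral.continuousOn_primitive_interval ?_)
    rw [Set.uIcc_of_le hab]
    exact (intervalIntegrable_iff_integrableOn_Icc_of_le hab).1 hf'
  have i1 : IntervalIntegrable (fun x => f x * g' x) volume a b :=
    (hfc.mul hg'.continuousOn).intervalIntegrable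
  have i2 : IntervalIntegrable (fun x => f a * g' x) volume a b :=
    (continuous_const.mul hg').intervalIntegrable _ _
  have i3 : IntervalIntegrable (fun x => f' x * g x) volume a b := hf'.mul_continuousOn hgc.continuousOn
  simp only [sub_mul, mul_sub] at hsw
  rw [intervalIntegral.integral_sub i1 i2, intervalIntegral.integral_sub (hf'.mul_const _) i3,
    intervalIntegral.integral_const_mul, intervalIntegral.integral_mul_const, hFTC, ← hf b] at hsw
  linear_combination hsw

/-- A weakly differentiable function agrees almost everywhere with a primitive of its weak
derivative. -/
theorem exists_primitive_ae {f g : ℝ → ℂ} (h : HasWeakDeriv 1 f g) :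
    ∃ F : ℝ → ℂ, Continuous F ∧ f =ᵐ[volume] F ∧ ∀ a b, F b - F a = ∫ y in a..b, g y := by
  have hgi : ∀ a b, IntervalIntegrable g volume a b := fun a b =>
    (h.2.1.integrableOn_isCompact isCompact_uIcc).intervalIntegrable
  set G : ℝ → ℂ := fun x => ∫ y in (0 : ℝ)..x, g y
  have hG : Continuous G := intervalIntegral.continuous_primitive hgi 0
  have hGsub : ∀ a b, G b - G a = ∫ y in a..b, g y := fun a b =>
    intervalIntegral.integral_interval_sub_left (hgi 0 b) (hgi 0 a)
  have hk : LocallyIntegrable (f - G) volume := h.1.sub hG.locallyIntegrable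
  -- the difference has weak derivative zero, hence is almost everywhere constant
  have horth : ∀ φ : ℝ → ℝ, ContDiff ℝ ∞ φ → HasCompactSupport φ →
      ∫ x, deriv φ x • (f - G) x = 0 := by
    intro φ hφ hc
    have hd : ContDiff ℝ ∞ (deriv φ) := (contDiff_infty_iff_deriv.1 hφ).2
    obtain ⟨R, hR0, hR⟩ : ∃ R : ℝ, 0 < R ∧ tsupport φ ⊆ Set.Ioo (-R) R := by
      obtain ⟨R, hR0, hR⟩ := hc.isCompact.isBounded.subset_ball_lt 0 0
      exact ⟨R, hR0, by rwa [Real.ball_eq_Ioo, zero_sub, zero_add] at hR⟩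
    have hout : ∀ x, x ∉ Set.Ioo (-R) R → φ x = 0 := fun x hx =>
      image_eq_zero_of_notMem_tsupport fun hh => hx (hR hh)
    have hout' : ∀ x, x ∉ Set.Ioo (-R) R → deriv φ x = 0 := fun x hx =>
      image_eq_zero_of_notMem_tsupport fun hh => hx (hR (tsupport_deriv_subset hh))
    have e1 := h.2.2 φ hφ hc
    have e2 := integral_primitive_mul_deriv (f := G) (f' := g) (g := fun x => (φ x : ℂ))
      (g' := fun x => ((deriv φ x : ℝ) : ℂ)) (a := -R) (b := R) (by linarith) (hgi _ _)
      (fun x => hGsub _ _)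
      (fun x => (hφ.differentiable (by simp) x).hasDerivAt.ofReal_comp)
      (Complex.continuous_ofReal.comp hd.continuous)
    have hint : ∀ (ψ : ℝ → ℝ) (k : ℝ → ℂ), (∀ x, x ∉ Set.Ioo (-R) R → ψ x = 0) →
        ∫ x in (-R)..R, k x * (ψ x : ℂ) = ∫ x, ψ x • k x := by
      intro ψ k hψ
      rw [intervalIntegral.integral_of_le (by linarith), setIntegral_eq_integral_of_forall_compl_eq_zero]
      · refine integral_congr_ae (Eventually.of_forall fun x => ?_)
        simp [mul_comm]
      · intro x hx
        rw [hψ x fun hh => hx (Set.Ioo_subset_Ioc_self hh)]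
        simp
    rw [hint _ _ hout', hint _ _ hout, hout R (by simp), hout (-R) (by simp)] at e2
    simp only [Pi.sub_apply, smul_sub]
    rw [integral_sub (integrable_test_smul h.1 hd.continuous hc.deriv)
      (integrable_test_smul hG.locallyIntegrable hd.continuous hc.deriv), e2, ← iteratedDeriv_one, e1]
    simp
  obtain ⟨c, hc⟩ : ∃ c : ℂ, ∀ᵐ x, (f - G) x = c := by
    set b : ContDiffBump (0 : ℝ) := default
    set η : ℝ → ℝ := b.normed volume
    have hη : ContDiff ℝ ∞ η := b.contDiff_normed
    have hηc : HasCompactSupport η := b.hasCompactSupport_normed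
    refine ⟨∫ x, η x • (f - G) x, ?_⟩
    refine ae_eq_of_integral_contDiff_smul_eq hk (continuous_const.locallyIntegrable)
      fun ψ hψ hψc => ?_
    set I := ∫ x, ψ x
    set ψ0 : ℝ → ℝ := fun x => ψ x - I * η x
    have hψ0 : ContDiff ℝ ∞ ψ0 := hψ.sub (contDiff_const.mul hη)
    have hψ0c : HasCompactSupport ψ0 := hψc.sub (hηc.mul_left)
    have hψ0I : ∫ x, ψ0 x = 0 := by
      rw [integral_sub (hψ.continuous.integrable_of_hasCompactSupport hψc)
        ((hη.continuous.integrable_of_hasCompactSupport hηc).const_mul _), integral_const_mul,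
        b.integral_normed]
      simp [I]
    obtain ⟨R, hR0, hR⟩ : ∃ R : ℝ, 0 < R ∧ tsupport ψ0 ⊆ Set.Ioo (-R) R := by
      obtain ⟨R, hR0, hR⟩ := hψ0c.isCompact.isBounded.subset_ball_lt 0 0
      exact ⟨R, hR0, by rwa [Real.ball_eq_Ioo, zero_sub, zero_add] at hR⟩
    have hout : ∀ x, x ∉ Set.Ioo (-R) R → ψ0 x = 0 := fun x hx =>
      image_eq_zero_of_notMem_tsupport fun hh => hx (hR hh)
    set Φ : ℝ → ℝ := fun x => ∫ y in (-R)..x, ψ0 y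
    have hΦd : ∀ x, HasDerivAt Φ (ψ0 x) x := fun x =>
      intervalIntegral.integral_hasDerivAt_right (hψ0.continuous.intervalIntegrable _ _)
        (hψ0.continuous.stronglyMeasurableAtFilter _ _) hψ0.continuous.continuousAt
    have hΦ' : deriv Φ = ψ0 := funext fun x => (hΦd x).deriv
    have hΦ : ContDiff ℝ ∞ Φ :=
      contDiff_infty_iff_deriv.2 ⟨fun x => (hΦd x).differentiableAt, hΦ' ▸ hψ0⟩
    have hΦc : HasCompactSupport Φ := by
      refine HasCompactSupport.intro (K := Set.Icc (-R) R) isCompact_Icc fun x hx => ?_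
      by_cases hxR : x < -R
      · simp only [Φ]
        rw [intervalIntegral.integral_symm, intervalIntegral.integral_of_le hxR.le,
          setIntegral_eq_zero_of_forall_eq_zero, neg_zero]
        exact fun y hy => hout y fun hh => absurd hy.2 (not_le.2 hh.1)
      · have hxR' : R < x := by
          by_contra hcon
          exact hx ⟨not_lt.1 hxR, not_lt.1 hcon⟩
        simp only [Φ]
        rw [intervalIntegral.integral_of_le (by linarith),
          setIntegral_eq_integral_of_forall_compl_eq_zero, hψ0I]
        exact fun y hy => hout y fun hh => hy ⟨hh.1, hh.2.le.trans hxR'.le⟩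
    have h0 := horth Φ hΦ hΦc
    rw [hΦ'] at h0
    simp only [ψ0, sub_smul, mul_smul] at h0
    rw [integral_sub (integrable_test_smul hk hψ.continuous hψc)
      (f := fun x => ψ x • (f - G) x) (g := fun x => I • η x • (f - G) x)
      ((integrable_test_smul hk hη.continuous hηc).smul I), integral_smul, sub_eq_zero] at h0
    rw [h0, integral_smul_const]
  refine ⟨fun x => c + G x, continuous_const.add hG, ?_, fun a b => ?_⟩
  · filter_upwards [hc] with x hx
    rw [← hx]; simp
  · rw [← hGsub]; ring

theorem HasWeakDeriv.sub_eq_integral {f g : ℝ → ℂ} (h : HasWeakDeriv 1 f g) (hf : Continuous f)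
    (a b : ℝ) : f b - f a = ∫ y in a..b, g y := by
  obtain ⟨F, hF, hae, hsub⟩ := exists_primitive_ae h
  rw [(Continuous.ae_eq_iff_eq volume hf hF).1 hae]
  exact hsub a b

theorem eLpNorm_one_le_sqrt_measure {f : ℝ → ℂ} {s : Set ℝ}
    (hf : AEStronglyMeasurable f volume) :
    eLpNorm f 1 (volume.restrict s) ≤
      eLpNorm f 2 (volume.restrict s) * volume s ^ (1 / 2 : ℝ) := by
  have := eLpNorm_le_eLpNorm_mul_rpow_measure_univ (p := 1) (q := 2) (μ := volume.restrict s)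
    (by norm_num) hf.restrict
  refine this.trans (le_of_eq ?_)
  rw [Measure.restrict_apply_univ]
  norm_num

/-- The quantitative decay of functions in `H¹ ∩ L^{2,1}`: averaging over an interval of length
`1/|x|` next to `x`, on the side away from the origin. -/
theorem sqrt_abs_mul_norm_le_of_pos {f g : ℝ → ℂ} {C : ℝ≥0} (hfc : Continuous f)
    (hg : AEStronglyMeasurable g volume)
    (hfg : ∀ a b, f b - f a = ∫ y in a..b, g y)
    (hxf : eLpNorm (fun x : ℝ => (x : ℂ) * f x) 2 volume ≤ C) (hg2 : eLpNorm g 2 volume ≤ C)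
    {x : ℝ} (hx : 0 < x) : √x * ‖f x‖ ≤ 2 * C := by
  set s := √x
  have hs : 0 < s := Real.sqrt_pos.2 hx
  have hsx : s ^ 2 = x := Real.sq_sqrt hx.le
  set I := Set.Ioc x (x + 1 / x)
  have hvol : volume I = ENNReal.ofReal (1 / x) := by simp [I]
  have hvol2 : volume I ^ (1 / 2 : ℝ) = ENNReal.ofReal (1 / s) := by
    rw [hvol, ENNReal.ofReal_rpow_of_nonneg (by positivity) (by norm_num), ← Real.sqrt_eq_rpow,
      Real.sqrt_div zero_le_one, Real.sqrt_one]
  have hpt : ∀ y ∈ I, ‖f x‖ₑ ≤ ‖f y‖ₑ + ∫⁻ t in I, ‖g t‖ₑ := by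
    intro y hy
    have : f x = f y - ∫ t in x..y, g t := by rw [← hfg]; ring
    rw [this]
    refine (enorm_sub_le).trans ?_
    gcongr
    rw [intervalIntegral.integral_of_le hy.1.le]
    exact (enorm_integral_le_lintegral_enorm _).trans
      (lintegral_mono_set (Set.Ioc_subset_Ioc_right hy.2))
  have h1 : ‖f x‖ₑ * volume I ≤ eLpNorm f 1 (volume.restrict I)
      + eLpNorm g 1 (volume.restrict I) * volume I := by
    rw [← setLIntegral_const, eLpNorm_one_eq_lintegral_enorm, eLpNorm_one_eq_lintegral_enorm,
      ← setLIntegral_const, ← lintegral_add_right _ measurable_const]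
    exact setLIntegral_mono (by fun_prop) hpt
  have h2 : ENNReal.ofReal x * eLpNorm f 2 (volume.restrict I) ≤ C := by
    calc _ = ‖(x : ℂ)‖ₑ * eLpNorm f 2 (volume.restrict I) := by
          rw [← ofReal_norm]; simp [abs_of_pos hx]
      _ = eLpNorm (fun y => (x : ℂ) * f y) 2 (volume.restrict I) :=
          (eLpNorm_const_smul (x : ℂ) f 2 _).symm
      _ ≤ eLpNorm (fun y : ℝ => (y : ℂ) * f y) 2 (volume.restrict I) := by
          refine eLpNorm_mono_ae ((ae_restrict_iff' measurableSet_Ioc).2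
            (Eventually.of_forall fun y hy => ?_))
          rw [norm_mul, norm_mul, Complex.norm_real, Complex.norm_real, Real.norm_of_nonneg hx.le,
            Real.norm_of_nonneg (hx.le.trans hy.1.le)]
          gcongr
          exact hy.1.le
      _ ≤ _ := (eLpNorm_mono_measure _ Measure.restrict_le_self).trans hxf
  have h3 := h1.trans (add_le_add (eLpNorm_one_le_sqrt_measure hfc.aestronglyMeasurable)
    (mul_le_mul_left (eLpNorm_one_le_sqrt_measure hg) (volume I)))
  have hg3 : eLpNorm g 2 (volume.restrict I) ≤ C :=
    (eLpNorm_mono_measure _ Measure.restrict_le_self).trans hg2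
  have hFfin : eLpNorm f 2 (volume.restrict I) ≠ ⊤ := by
    intro hh
    rw [hh, ENNReal.mul_top (ENNReal.ofReal_pos.2 hx).ne'] at h2
    exact absurd h2 (by simp)
  lift eLpNorm f 2 (volume.restrict I) to ℝ≥0 using hFfin with F
  have h4 : ‖f x‖ₑ * volume I ≤ F * volume I ^ (1 / 2 : ℝ)
      + C * volume I ^ (1 / 2 : ℝ) * volume I := h3.trans (by gcongr)
  rw [hvol2, hvol] at h4
  have h5 := ENNReal.toReal_mono (by finiteness) h4
  rw [ENNReal.toReal_add (by finiteness) (by finiteness)] at h5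
  simp only [ENNReal.toReal_mul, toReal_enorm, ENNReal.coe_toReal] at h5
  rw [ENNReal.toReal_ofReal (by positivity), ENNReal.toReal_ofReal (by positivity)] at h5
  have h6 : x * F ≤ C := by
    have := ENNReal.toReal_mono (by finiteness) h2
    rwa [ENNReal.toReal_mul, ENNReal.toReal_ofReal hx.le, ENNReal.coe_toReal,
      ENNReal.coe_toReal] at this
  rw [show 1 / x = 1 / s ^ 2 by rw [hsx]] at h5
  rw [← hsx] at h6
  have h7 : s * ‖f x‖ = (‖f x‖ * (1 / s ^ 2)) * s ^ 3 := by field_simp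
  rw [h7]
  calc _ ≤ (F * (1 / s) + C * (1 / s) * (1 / s ^ 2)) * s ^ 3 := by gcongr
    _ = s ^ 2 * F + C := by field_simp
    _ ≤ 2 * C := by linarith

theorem sqrt_abs_mul_norm_le {f g : ℝ → ℂ} {C : ℝ≥0} (hfc : Continuous f)
    (hg : AEStronglyMeasurable g volume)
    (hfg : ∀ a b, f b - f a = ∫ y in a..b, g y)
    (hxf : eLpNorm (fun x : ℝ => (x : ℂ) * f x) 2 volume ≤ C) (hg2 : eLpNorm g 2 volume ≤ C)
    (x : ℝ) : √|x| * ‖f x‖ ≤ 2 * C := by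
  rcases lt_trichotomy x 0 with hx | hx | hx
  · have mp := Measure.measurePreserving_neg (volume : Measure ℝ)
    have := sqrt_abs_mul_norm_le_of_pos (f := fun x => f (-x)) (g := fun x => -g (-x)) (C := C)
      (hfc.comp continuous_neg) (hg.comp_measurePreserving mp).neg
      (fun a b => by
        rw [hfg, intervalIntegral.integral_neg, intervalIntegral.integral_comp_neg,
          intervalIntegral.integral_symm])
      (by
        refine le_trans (le_of_eq ?_) hxf
        rw [← eLpNorm_comp_measurePreserving
          (show AEStronglyMeasurable (fun x : ℝ => (x : ℂ) * f x) volume by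
            exact (Continuous.aestronglyMeasurable (by fun_prop))) mp]
        rw [← eLpNorm_neg]
        congr 1
        ext y
        simp)
      (by
        refine le_trans (le_of_eq ?_) hg2
        rw [← eLpNorm_comp_measurePreserving hg mp, ← eLpNorm_neg]
        congr 1
        ext y
        simp) (neg_pos.2 hx)
    rw [abs_of_neg hx]
    simpa using this
  · simp [hx]
  · rw [abs_of_pos hx]
    exact sqrt_abs_mul_norm_le_of_pos hfc hg hfg hxf hg2 hx

/-! ### Weak differentiability from difference quotients -/

/-- A function in `L²` whose translates differ from it by `O(h)` in `L²` has a weak derivative in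
`L²`: a weak limit point of the difference quotients. -/
theorem exists_weakDeriv_of_translation_le {f : ℝ → ℂ} (hf : MemLp f 2) {C : ℝ≥0}
    (h : ∀ t : ℝ, eLpNorm (fun x => f (x + t) - f x) 2 volume ≤ C * ‖t‖ₑ) :
    ∃ g, HasWeakDeriv 1 f g ∧ MemLp g 2 ∧ eLpNorm g 2 volume ≤ C := by
  have hfl : LocallyIntegrable f volume := hf.locallyIntegrable (by norm_num)
  set t : ℕ → ℝ := fun n => 1 / ((n : ℝ) + 1)
  have ht0 : ∀ n, 0 < t n := fun n => Nat.one_div_pos_of_nat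
  have htlim : Tendsto t atTop (𝓝 0) := tendsto_one_div_add_atTop_nhds_zero_nat
  have hft : ∀ s : ℝ, MemLp (fun x => f (x + s)) 2 := fun s =>
    hf.comp_measurePreserving (measurePreserving_add_right volume s)
  have hmem : ∀ n, MemLp (fun x => ((t n)⁻¹ : ℂ) * (f (x + t n) - f x)) 2 := fun n =>
    ((hft _).sub hf).const_mul _
  set G : ℕ → Lp ℂ 2 (volume : Measure ℝ) := fun n => (hmem n).toLp _
  have hGn : ∀ n, ‖G n‖ ≤ C := by
    intro n
    rw [Lp.norm_toLp]
    refine ENNReal.toReal_le_of_le_ofReal C.2 ?_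
    calc _ = ‖((t n)⁻¹ : ℂ)‖ₑ * eLpNorm (fun x => f (x + t n) - f x) 2 volume :=
          eLpNorm_const_smul ((t n)⁻¹ : ℂ) _ 2 _
      _ ≤ ‖((t n)⁻¹ : ℂ)‖ₑ * (C * ‖t n‖ₑ) := by gcongr; exact h _
      _ = C * (‖((t n)⁻¹ : ℂ)‖ₑ * ‖(t n : ℂ)‖ₑ) := by
          rw [show ‖t n‖ₑ = ‖(t n : ℂ)‖ₑ by rw [← ofReal_norm, ← ofReal_norm, Complex.norm_real]]
          ring
      _ = ENNReal.ofReal C := by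
          rw [← enorm_mul, inv_mul_cancel₀ (by exact_mod_cast (ht0 n).ne')]
          simp
  -- the difference quotients, as functionals, lie in a weak-* compact ball
  set T : ℕ → WeakDual ℂ (Lp ℂ 2 (volume : Measure ℝ)) := fun n =>
    StrongDual.toWeakDual (InnerProductSpace.toDual ℂ _ (G n))
  have hcomp := WeakDual.isCompact_closedBall (0 : StrongDual ℂ (Lp ℂ 2 (volume : Measure ℝ))) C
  have hT : ∀ n, T n ∈ WeakDual.toStrongDual ⁻¹' Metric.closedBall
      (0 : StrongDual ℂ (Lp ℂ 2 (volume : Measure ℝ))) C := by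
    intro n
    simp only [Set.mem_preimage, mem_closedBall_zero_iff]
    exact ((InnerProductSpace.toDual ℂ _).norm_map (G n)).le.trans (hGn n)
  obtain ⟨L, hL, hlim⟩ := hcomp.ultrafilter_le_nhds ((hyperfilter ℕ).map T)
    (by
      rw [le_principal_iff]
      exact (Eventually.of_forall hT : ∀ᶠ n in (hyperfilter ℕ : Filter ℕ), _))
  set g : Lp ℂ 2 (volume : Measure ℝ) :=
    (InnerProductSpace.toDual ℂ _).symm (WeakDual.toStrongDual L)
  have hgn : ‖g‖ ≤ C := by
    rw [LinearIsometryEquiv.norm_map]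
    simpa using hL
  refine ⟨g, ⟨hfl, (Lp.memLp g).locallyIntegrable (by norm_num), fun φ hφ hc => ?_⟩,
    Lp.memLp g, ?_⟩
  swap
  · rw [← Lp.enorm_def, ← ofReal_norm]
    exact (ENNReal.ofReal_le_ofReal hgn).trans (by simp)
  set Φ : ℝ → ℂ := fun x => (φ x : ℂ)
  have hΦc : Continuous Φ := Complex.continuous_ofReal.comp hφ.continuous
  have hΦm : MemLp Φ 2 := hΦc.memLp_of_hasCompactSupport (hc.comp_left Complex.ofReal_zero)
  have hinner : ∀ w : Lp ℂ 2 (volume : Measure ℝ),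
      inner ℂ (hΦm.toLp Φ) w = ∫ x, φ x • w x := by
    intro w
    rw [L2.inner_def]
    refine integral_congr_ae ?_
    filter_upwards [hΦm.coeFn_toLp] with x hx
    rw [hx]
    simp [Φ, mul_comm]
  have hconv : Tendsto (fun n => ∫ x, φ x • G n x) (hyperfilter ℕ) (𝓝 (∫ x, φ x • g x)) := by
    have h1 : Tendsto (fun n => T n (hΦm.toLp Φ)) (hyperfilter ℕ) (𝓝 (L (hΦm.toLp Φ))) :=
      ((WeakDual.eval_continuous _).tendsto L).comp hlim
    have h2 := (Complex.continuous_conj.tendsto _).comp h1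
    have e1 : ∀ n, starRingEnd ℂ (T n (hΦm.toLp Φ)) = ∫ x, φ x • G n x := by
      intro n
      rw [← hinner, ← inner_conj_symm]
      rfl
    have e2 : starRingEnd ℂ (L (hΦm.toLp Φ)) = ∫ x, φ x • g x := by
      rw [← hinner, ← inner_conj_symm]
      congr 1
      exact (InnerProductSpace.toDual_symm_apply (𝕜 := ℂ) (y := WeakDual.toStrongDual L)).symm
    rw [e2] at h2
    exact h2.congr e1
  -- the difference quotient is moved onto the test function, where it converges to `-φ'`
  have hconv2 : Tendsto (fun n => ∫ x, φ x • G n x) atTop (𝓝 (- ∫ x, deriv φ x • f x)) := by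
    have e : ∀ n, ∫ x, φ x • G n x = ∫ x, ((t n)⁻¹ * (φ (x + -t n) - φ x)) • f x := by
      intro n
      have i1 : Integrable fun x => φ x • f (x + t n) :=
        integrable_test_smul ((hft _).locallyIntegrable (by norm_num)) hφ.continuous hc
      have i2 : Integrable fun x => φ x • f x := integrable_test_smul hfl hφ.continuous hc
      have i3 : Integrable fun x => φ (x + -t n) • f x := by
        have := i1.comp_add_right (-t n)
        simpa using this
      calc _ = ∫ x, ((t n)⁻¹ : ℂ) * (φ x • f (x + t n) - φ x • f x) := by
            refine integral_congr_ae ?_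
            filter_upwards [(hmem n).coeFn_toLp] with x hx
            simp only [G]
            rw [hx]
            simp only [Complex.real_smul]
            ring
        _ = ((t n)⁻¹ : ℂ) * ((∫ x, φ (x + -t n) • f x) - ∫ x, φ x • f x) := by
            rw [integral_const_mul, integral_sub i1 i2]
            congr 2
            rw [← integral_add_right_eq_self _ (-t n)]
            simp
        _ = _ := by
            rw [← integral_sub i3 i2, ← integral_const_mul]
            refine integral_congr_ae (Eventually.of_forall fun x => ?_)
            simp only [Complex.real_smul]
            push_cast
            ring
    rw [funext e, ← integral_neg]
    obtain ⟨K, hK⟩ := hφ.lipschitzWith_of_hasCompactSupport hc (by simp)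
    set S : Set ℝ := Metric.cthickening 1 (tsupport φ)
    have hS : IsCompact S := hc.isCompact.cthickening
    refine tendsto_integral_of_dominated_convergence (fun x => S.indicator (fun x => K * ‖f x‖) x)
      (fun n => ?_) ?_ (fun n => Eventually.of_forall fun x => ?_) (Eventually.of_forall fun x => ?_)
    · have hcm : Continuous fun x => (t n)⁻¹ * (φ (x + -t n) - φ x) :=
        continuous_const.mul ((hφ.continuous.comp (by fun_prop)).sub hφ.continuous)
      exact hcm.aestronglyMeasurable.smul hf.1
    · rw [integrable_indicator_iff hS.measurableSet]
      exact ((hfl.integrableOn_isCompact hS).norm).const_mul _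
    · by_cases hx : x ∈ S
      · rw [Set.indicator_of_mem hx, norm_smul, norm_mul, norm_inv, Real.norm_of_nonneg (ht0 n).le]
        gcongr
        have h1 := hK.dist_le_mul (x + -t n) x
        rw [Real.dist_eq, Real.dist_eq, show x + -t n - x = -t n by ring, abs_neg,
          abs_of_pos (ht0 n)] at h1
        rw [Real.norm_eq_abs, inv_mul_le_iff₀ (ht0 n)]
        linarith
      · have hx1 : φ x = 0 := image_eq_zero_of_notMem_tsupport fun hh =>
          hx (Metric.self_subset_cthickening _ hh)
        have hx2 : φ (x + -t n) = 0 := image_eq_zero_of_notMem_tsupport fun hh =>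
          hx (Metric.mem_cthickening_of_dist_le x _ 1 _ hh (by
            rw [Real.dist_eq, show x - (x + -t n) = t n by ring, abs_of_pos (ht0 n)]
            have : (0 : ℝ) ≤ n := Nat.cast_nonneg n
            rw [div_le_one (by linarith)]; linarith))
        rw [Set.indicator_of_notMem hx, hx1, hx2]
        simp
    · have hd : HasDerivAt φ (deriv φ x) x := (hφ.differentiable (by simp) x).hasDerivAt
      have h1 := hd.tendsto_slope_zero.comp (f := fun n => -t n) (x := atTop)
        (tendsto_nhdsWithin_iff.2 ⟨by simpa using htlim.neg,
          Eventually.of_forall fun n => by simpa using (ht0 n).ne'⟩)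
      rw [← neg_smul]
      refine Tendsto.smul_const ?_ _
      refine (h1.neg).congr fun n => ?_
      simp only [Function.comp, smul_eq_mul, inv_neg]
      ring
  have hconv3 := hconv2.mono_left Nat.hyperfilter_le_atTop
  have := tendsto_nhds_unique hconv hconv3
  rw [this, iteratedDeriv_one]
  simp

/-! ### Differences of holomorphic families -/

/-- A family `f_λ` that depends holomorphically on `λ` in the disc of radius `ρ` and is bounded
there in `L²` satisfies `‖f₁ - f₀‖ = O(1/ρ)` in `L²`, by Cauchy's formula. -/
theorem eLpNorm_sub_le_of_holomorphic {ν : Measure ℝ} [SFinite ν] {f : ℂ → ℝ → ℂ} {ρ : ℝ}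
    {C : ℝ≥0∞} (hρ : 4 ≤ ρ)
    (hd : ∀ z, DifferentiableOn ℂ (fun l => f l z) (Metric.ball 0 ρ))
    (hm : ∀ l, ‖l‖ < ρ → Measurable (f l))
    (hC : ∀ l, ‖l‖ < ρ → eLpNorm (f l) 2 ν ≤ C) :
    eLpNorm (fun z => f 1 z - f 0 z) 2 ν ≤ ENNReal.ofReal (4 / ρ) * C := by
  set r := ρ / 2
  have hr : 2 ≤ r := by simp only [r]; linarith
  have hrr : |r| = r := abs_of_nonneg (by linarith)
  have hmem : ∀ θ, circleMap 0 r θ ∈ Metric.ball (0 : ℂ) ρ := fun θ => by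
    rw [mem_ball_zero_iff, norm_circleMap_zero, hrr]; simp only [r]; linarith
  -- Cauchy's formula at `1` and at `0`, with `1 / (l - 1) - 1 / l = 1 / (l (l - 1))`
  have hrep : ∀ z, f 1 z - f 0 z = (2 * Real.pi * Complex.I)⁻¹ •
      ∮ l in C(0, r), ((l * (l - 1))⁻¹ * f l z) := by
    intro z
    have hsub : Metric.closedBall (0 : ℂ) r ⊆ Metric.ball 0 ρ :=
      Metric.closedBall_subset_ball (by simp only [r]; linarith)
    have hcl : DiffContOnCl ℂ (fun l => f l z) (Metric.ball 0 r) :=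
      ((hd z).mono hsub).diffContOnCl_ball subset_rfl
    have c1 := hcl.two_pi_i_inv_smul_circleIntegral_sub_inv_smul
      (show (1 : ℂ) ∈ Metric.ball 0 r by simp; linarith)
    have c0 := hcl.two_pi_i_inv_smul_circleIntegral_sub_inv_smul
      (show (0 : ℂ) ∈ Metric.ball 0 r by simp; linarith)
    rw [← c1, ← c0, ← smul_sub]
    congr 1
    have hne : ∀ l ∈ Metric.sphere (0 : ℂ) r, l - 1 ≠ 0 ∧ l - 0 ≠ 0 := by
      intro l hl
      rw [mem_sphere_zero_iff_norm] at hl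
      constructor
      · intro hh
        rw [sub_eq_zero] at hh
        rw [hh, norm_one] at hl
        linarith
      · intro hh
        rw [sub_zero] at hh
        rw [hh, norm_zero] at hl
        linarith
    have hcont : ContinuousOn (fun l => f l z) (Metric.sphere 0 r) :=
      ((hd z).continuousOn).mono (Metric.sphere_subset_closedBall.trans hsub)
    rw [← circleIntegral.integral_sub]
    · refine circleIntegral.integral_congr (by linarith) fun l hl => ?_
      obtain ⟨h1, h0⟩ := hne l hl
      rw [sub_zero] at h0
      simp only [smul_eq_mul, sub_zero]
      field_simp
      ring
    · refine ContinuousOn.circleIntegrable (by linarith) (ContinuousOn.fun_smul ?_ hcont)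
      exact ContinuousOn.inv₀ (by fun_prop) fun l hl => (hne l hl).1
    · refine ContinuousOn.circleIntegrable (by linarith) (ContinuousOn.fun_smul ?_ hcont)
      exact ContinuousOn.inv₀ (by fun_prop) fun l hl => (hne l hl).2
  have hFm : Measurable (Function.uncurry fun (θ : ℝ) z => f (circleMap 0 r θ) z) := by
    refine measurable_uncurry_of_continuous_of_measurable (fun z => ?_) fun θ => ?_
    · exact (hd z).continuousOn.comp_continuous (continuous_circleMap 0 r) hmem
    · exact hm _ (by simpa using hmem θ)
  have hbound : ∀ z, ‖f 1 z - f 0 z‖ₑ ≤ ∫⁻ θ in Set.Ioc 0 (2 * Real.pi),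
      ENNReal.ofReal (2 / ρ / Real.pi) * ‖f (circleMap 0 r θ) z‖ₑ := by
    intro z
    rw [hrep, circleIntegral, intervalIntegral.integral_of_le (by positivity), ← integral_smul]
    refine (enorm_integral_le_lintegral_enorm _).trans (lintegral_mono fun θ => ?_)
    rw [smul_eq_mul, smul_eq_mul, ← mul_assoc, ← mul_assoc, enorm_mul]
    gcongr
    rw [← ofReal_norm]
    refine ENNReal.ofReal_le_ofReal ?_
    rw [deriv_circleMap]
    have h1 : r - 1 ≤ ‖circleMap 0 r θ - 1‖ := by
      have := norm_sub_norm_le (circleMap 0 r θ) 1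
      rwa [norm_circleMap_zero, hrr, norm_one] at this
    have h2 : r / 2 ≤ ‖circleMap 0 r θ - 1‖ := by linarith
    have hpi := Real.pi_pos
    simp only [norm_mul, norm_inv, Complex.norm_I, Complex.norm_real, Complex.norm_ofNat, mul_one,
      Real.norm_of_nonneg hpi.le, norm_circleMap_zero, hrr]
    have hr0 : 0 < r := by linarith
    calc (2 * Real.pi)⁻¹ * r * (r * ‖circleMap 0 r θ - 1‖)⁻¹
        ≤ (2 * Real.pi)⁻¹ * r * (r * (r / 2))⁻¹ := by gcongr
      _ = 2 / ρ / Real.pi := by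
          rw [show r = ρ / 2 from rfl]
          field_simp
  calc _ ≤ ∫⁻ θ in Set.Ioc 0 (2 * Real.pi),
      ENNReal.ofReal (2 / ρ / Real.pi) * eLpNorm (f (circleMap 0 r θ)) 2 ν :=
        eLpNorm_le_of_le_lintegral measurable_const hFm.enorm hbound
    _ ≤ ∫⁻ θ in Set.Ioc 0 (2 * Real.pi), ENNReal.ofReal (2 / ρ / Real.pi) * C := by
        gcongr with θ
        exact hC _ (by simpa using hmem θ)
    _ = _ := by
        rw [setLIntegral_const, Real.volume_Ioc, mul_right_comm, ← ENNReal.ofReal_mul (by positivity)]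
        congr 2
        field_simp
        ring

/-! ### Volterra operators on bounded continuous functions -/

theorem integrable_mul_bcf {q : ℝ → ℂ} (hq : Integrable q) (f : ℝ →ᵇ ℂ) :
    Integrable fun y => q y * f y :=
  hq.mul_bdd f.continuous.aestronglyMeasurable (Eventually.of_forall f.norm_coe_le_norm)

theorem norm_setIntegral_mul_bcf_le {q : ℝ → ℂ} (hq : Integrable q) (f : ℝ →ᵇ ℂ) (s : Set ℝ) :
    ‖∫ y in s, q y * f y‖ ≤ (∫ y, ‖q y‖) * ‖f‖ := by
  calc _ ≤ ∫ y in s, ‖q y * f y‖ := norm_integral_le_integral_norm _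
    _ ≤ ∫ y, ‖q y * f y‖ := setIntegral_le_integral (integrable_mul_bcf hq f).norm
        (Eventually.of_forall fun _ => norm_nonneg _)
    _ ≤ ∫ y, ‖q y‖ * ‖f‖ := by
        refine integral_mono (integrable_mul_bcf hq f).norm (hq.norm.mul_const _) fun y => ?_
        simp only [norm_mul]
        gcongr
        exact f.norm_coe_le_norm y
    _ = _ := integral_mul_const _ _

open Classical in
/-- The Volterra operator `f ↦ ∫_{-∞}^x q f`, for integrable `q` (and zero otherwise). -/
def volterra (q : ℝ → ℂ) : (ℝ →ᵇ ℂ) →L[ℂ] (ℝ →ᵇ ℂ) :=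
  if hq : Integrable q then
    LinearMap.mkContinuous
      { toFun := fun f => BoundedContinuousFunction.ofNormedAddCommGroup
          (fun x => ∫ y in Set.Iic x, q y * f y) (continuous_integral_Iic (integrable_mul_bcf hq f))
          ((∫ y, ‖q y‖) * ‖f‖) fun x => norm_setIntegral_mul_bcf_le hq f _
        map_add' := fun f g => by
          ext x
          simp only [BoundedContinuousFunction.coe_add, BoundedContinuousFunction.coe_ofNormedAddCommGroup,
            Pi.add_apply, mul_add]
          exact integral_add (integrable_mul_bcf hq f).integrableOn
            (integrable_mul_bcf hq g).integrableOn
        map_smul' := fun c f => by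
          ext x
          simp only [BoundedContinuousFunction.coe_smul, BoundedContinuousFunction.coe_ofNormedAddCommGroup,
            smul_eq_mul, RingHom.id_apply]
          rw [← integral_const_mul]
          congr 1
          ext y
          ring } (∫ y, ‖q y‖)
      fun f => (BoundedContinuousFunction.norm_le (by positivity)).2 fun x =>
        norm_setIntegral_mul_bcf_le hq f _
  else 0

theorem volterra_apply {q : ℝ → ℂ} (hq : Integrable q) (f : ℝ →ᵇ ℂ) (x : ℝ) :
    volterra q f x = ∫ y in Set.Iic x, q y * f y := by
  rw [volterra, dif_pos hq]
  rfl

theorem norm_volterra_le {q : ℝ → ℂ} (hq : Integrable q) : ‖volterra q‖ ≤ ∫ y, ‖q y‖ := by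
  rw [volterra, dif_pos hq]
  exact LinearMap.mkContinuous_norm_le _ (by positivity) _

theorem volterra_add {q q' : ℝ → ℂ} (hq : Integrable q) (hq' : Integrable q') :
    volterra (q + q') = volterra q + volterra q' := by
  ext f x
  simp only [_root_.add_apply, BoundedContinuousFunction.coe_add, Pi.add_apply,
    volterra_apply (hq.add hq'), volterra_apply hq, volterra_apply hq', add_mul]
  exact integral_add (integrable_mul_bcf hq f).integrableOn (integrable_mul_bcf hq' f).integrableOn

theorem volterra_smul {q : ℝ → ℂ} (hq : Integrable q) (c : ℂ) :
    volterra (c • q) = c • volterra q := by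
  ext f x
  simp only [_root_.smul_apply, BoundedContinuousFunction.coe_smul,
    volterra_apply (hq.smul c), volterra_apply hq, Pi.smul_apply, smul_eq_mul]
  rw [← integral_const_mul]
  congr 1
  ext y
  ring

open Classical in
/-- The functional `f ↦ ∫ q f`, for integrable `q` (and zero otherwise). -/
def totalInt (q : ℝ → ℂ) : (ℝ →ᵇ ℂ) →L[ℂ] ℂ :=
  if hq : Integrable q then
    LinearMap.mkContinuous
      { toFun := fun f => ∫ y, q y * f y
        map_add' := fun f g => by
          simp only [BoundedContinuousFunction.coe_add, Pi.add_apply, mul_add]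
          exact integral_add (integrable_mul_bcf hq f) (integrable_mul_bcf hq g)
        map_smul' := fun c f => by
          simp only [BoundedContinuousFunction.coe_smul, smul_eq_mul, RingHom.id_apply]
          rw [← integral_const_mul]
          congr 1
          ext y
          ring } (∫ y, ‖q y‖)
      fun f => by simpa using norm_setIntegral_mul_bcf_le hq f Set.univ
  else 0

theorem totalInt_apply {q : ℝ → ℂ} (hq : Integrable q) (f : ℝ →ᵇ ℂ) :
    totalInt q f = ∫ y, q y * f y := by
  rw [totalInt, dif_pos hq]
  rfl

theorem norm_totalInt_le {q : ℝ → ℂ} (hq : Integrable q) : ‖totalInt q‖ ≤ ∫ y, ‖q y‖ := by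
  rw [totalInt, dif_pos hq]
  exact LinearMap.mkContinuous_norm_le _ (by positivity) _

theorem totalInt_add {q q' : ℝ → ℂ} (hq : Integrable q) (hq' : Integrable q') :
    totalInt (q + q') = totalInt q + totalInt q' := by
  ext f
  simp only [_root_.add_apply, Pi.add_apply,
    totalInt_apply (hq.add hq'), totalInt_apply hq, totalInt_apply hq', add_mul]
  exact integral_add (integrable_mul_bcf hq f) (integrable_mul_bcf hq' f)

theorem totalInt_smul {q : ℝ → ℂ} (hq : Integrable q) (c : ℂ) :
    totalInt (c • q) = c • totalInt q := by
  ext f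
  simp only [_root_.smul_apply, totalInt_apply (hq.smul c), totalInt_apply hq,
    Pi.smul_apply, smul_eq_mul]
  rw [← integral_const_mul]
  congr 1
  ext y
  ring

theorem tendsto_integral_Iic_atTop {f : ℝ → ℂ} (hf : Integrable f) :
    Tendsto (fun x => ∫ y in Set.Iic x, f y) atTop (𝓝 (∫ y, f y)) :=
  (aecover_Iic tendsto_id).integral_tendsto_of_countably_generated hf

theorem tendsto_integral_Iic_atBot {f : ℝ → ℂ} :
    Tendsto (fun x => ∫ y in Set.Iic x, f y) atBot (𝓝 0) :=
  tendsto_integral_Iic_zero tendsto_id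

theorem tendsto_integral_norm_osc_sub {q : ℝ → ℂ} (hq : Integrable q) (z₀ : ℝ) :
    Tendsto (fun z => ∫ y, ‖osc z y * q y - osc z₀ y * q y‖) (𝓝 z₀) (𝓝 0) := by
  have h : Tendsto (fun z => ∫ y, ‖osc z y * q y - osc z₀ y * q y‖) (𝓝 z₀)
      (𝓝 (∫ y, ‖osc z₀ y * q y - osc z₀ y * q y‖)) := by
    refine tendsto_integral_filter_of_dominated_convergence (fun y => 2 * ‖q y‖)
      (Eventually.of_forall fun z =>
        ((integrable_osc_mul hq z).sub (integrable_osc_mul hq z₀)).norm.aestronglyMeasurable)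
      (Eventually.of_forall fun z => Eventually.of_forall fun y => ?_) (hq.norm.const_mul _)
      (Eventually.of_forall fun y => ?_)
    · rw [norm_norm]
      refine (norm_sub_le _ _).trans (le_of_eq ?_)
      rw [norm_mul, norm_mul, norm_osc, norm_osc]
      ring
    · have hc : Continuous fun z => osc z y := by unfold osc; fun_prop
      exact (((hc.mul continuous_const).sub continuous_const).norm).tendsto z₀
  simpa using h

theorem continuous_volterra_osc {q : ℝ → ℂ} (hq : Integrable q) :
    Continuous fun z => volterra fun y => osc z y * q y := by
  refine continuous_iff_continuousAt.2 fun z₀ => tendsto_iff_norm_sub_tendsto_zero.2 ?_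
  refine squeeze_zero (fun _ => norm_nonneg _) (fun z => ?_) (tendsto_integral_norm_osc_sub hq z₀)
  have h : (volterra fun y => osc z y * q y) - (volterra fun y => osc z₀ y * q y)
      = volterra ((fun y => osc z y * q y) - fun y => osc z₀ y * q y) := by
    rw [sub_eq_iff_eq_add, ← volterra_add ((integrable_osc_mul hq z).sub (integrable_osc_mul hq z₀))
      (integrable_osc_mul hq z₀)]
    simp
  rw [h]
  exact norm_volterra_le ((integrable_osc_mul hq z).sub (integrable_osc_mul hq z₀))

theorem continuous_totalInt_osc {q : ℝ → ℂ} (hq : Integrable q) :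
    Continuous fun z => totalInt fun y => osc z y * q y := by
  refine continuous_iff_continuousAt.2 fun z₀ => tendsto_iff_norm_sub_tendsto_zero.2 ?_
  refine squeeze_zero (fun _ => norm_nonneg _) (fun z => ?_) (tendsto_integral_norm_osc_sub hq z₀)
  have h : (totalInt fun y => osc z y * q y) - (totalInt fun y => osc z₀ y * q y)
      = totalInt ((fun y => osc z y * q y) - fun y => osc z₀ y * q y) := by
    rw [sub_eq_iff_eq_add, ← totalInt_add ((integrable_osc_mul hq z).sub (integrable_osc_mul hq z₀))
      (integrable_osc_mul hq z₀)]
    simp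
  rw [h]
  exact norm_totalInt_le ((integrable_osc_mul hq z).sub (integrable_osc_mul hq z₀))

/-! ### Small triangular-phase systems -/

/-- The Volterra operator of the system `f' = -D f + U g`, `g' = V f + D g`. -/
def sysOp (D U V : ℝ → ℂ) : ((ℝ →ᵇ ℂ) × (ℝ →ᵇ ℂ)) →L[ℂ] ((ℝ →ᵇ ℂ) × (ℝ →ᵇ ℂ)) :=
  (-(volterra D ∘L ContinuousLinearMap.fst ℂ (ℝ →ᵇ ℂ) (ℝ →ᵇ ℂ)) + volterra U ∘L ContinuousLinearMap.snd ℂ (ℝ →ᵇ ℂ) (ℝ →ᵇ ℂ)).prod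
    (volterra V ∘L ContinuousLinearMap.fst ℂ (ℝ →ᵇ ℂ) (ℝ →ᵇ ℂ) + volterra D ∘L ContinuousLinearMap.snd ℂ (ℝ →ᵇ ℂ) (ℝ →ᵇ ℂ))

/-- The coefficients are integrable, and small enough for the Volterra operator to be a
contraction on bounded functions. -/
structure SmallSystem (D U V : ℝ → ℂ) : Prop where
  intD : Integrable D
  intU : Integrable U
  intV : Integrable V
  small : 2 * (∫ y, ‖D y‖) + (∫ y, ‖U y‖) + (∫ y, ‖V y‖) ≤ 3 / 10

section
variable {D U V : ℝ → ℂ}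

theorem SmallSystem.norm_sysOp_le (h : SmallSystem D U V) : ‖sysOp D U V‖ ≤ 3 / 10 := by
  refine ContinuousLinearMap.opNorm_le_bound _ (by norm_num) fun p => ?_
  have hD := norm_volterra_le h.intD
  have hU := norm_volterra_le h.intU
  have hV := norm_volterra_le h.intV
  have h1 := _root_.norm_fst_le p
  have h2 := _root_.norm_snd_le p
  have nD : 0 ≤ ∫ y, ‖D y‖ := by positivity
  have nU : 0 ≤ ∫ y, ‖U y‖ := by positivity
  have nV : 0 ≤ ∫ y, ‖V y‖ := by positivity
  have b : ∀ (q : ℝ → ℂ) (f : ℝ →ᵇ ℂ), ‖volterra q‖ ≤ ∫ y, ‖q y‖ → ‖f‖ ≤ ‖p‖ →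
      ‖volterra q f‖ ≤ (∫ y, ‖q y‖) * ‖p‖ := fun q f hq hf =>
    ((volterra q).le_opNorm f).trans (by gcongr)
  have np := norm_nonneg p
  have hs := mul_le_mul_of_nonneg_right h.small np
  refine max_le ?_ ?_
  · calc _ ≤ ‖volterra D p.1‖ + ‖volterra U p.2‖ := by
          simp only [sysOp, ContinuousLinearMap.prod_apply, _root_.add_apply,
            _root_.neg_apply, ContinuousLinearMap.comp_apply,
            ContinuousLinearMap.coe_fst', ContinuousLinearMap.coe_snd']
          exact (norm_add_le _ _).trans (by rw [norm_neg])
      _ ≤ _ := by nlinarith [b D p.1 hD h1, b U p.2 hU h2, mul_nonneg nD np, mul_nonneg nV np]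
  · calc _ ≤ ‖volterra V p.1‖ + ‖volterra D p.2‖ := norm_add_le _ _
      _ ≤ _ := by nlinarith [b V p.1 hV h1, b D p.2 hD h2, mul_nonneg nD np, mul_nonneg nU np]

/-- The bounded solution of the system that tends to `(1, 0)` at `-∞`. -/
def sysSol (D U V : ℝ → ℂ) : (ℝ →ᵇ ℂ) × (ℝ →ᵇ ℂ) :=
  Ring.inverse (1 - sysOp D U V) (BoundedContinuousFunction.const ℝ 1, 0)

theorem SmallSystem.isUnit (h : SmallSystem D U V) : IsUnit (1 - sysOp D U V) :=
  isUnit_one_sub_of_norm_lt_one (R := (ℝ →ᵇ ℂ) × (ℝ →ᵇ ℂ) →L[ℂ] (ℝ →ᵇ ℂ) × (ℝ →ᵇ ℂ)) (h.norm_sysOp_le.trans_lt (by norm_num))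

theorem SmallSystem.sysSol_eq (h : SmallSystem D U V) :
    sysSol D U V = (BoundedContinuousFunction.const ℝ 1, 0) + sysOp D U V (sysSol D U V) := by
  have h1 : (1 - sysOp D U V) (sysSol D U V) = (BoundedContinuousFunction.const ℝ 1, 0) := by
    rw [sysSol, ← mul_apply_eq_comp, Ring.mul_inverse_cancel _ h.isUnit]
    rfl
  rw [← h1]
  simp

/-- Uniqueness of the bounded continuous solution. -/
theorem SmallSystem.eq_sysSol (h : SmallSystem D U V) {p : (ℝ →ᵇ ℂ) × (ℝ →ᵇ ℂ)}
    (hp : p = (BoundedContinuousFunction.const ℝ 1, 0) + sysOp D U V p) : p = sysSol D U V := by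
  have h1 : (1 - sysOp D U V) p = (BoundedContinuousFunction.const ℝ 1, 0) := by
    rw [_root_.sub_apply, one_apply_eq_self]
    exact sub_eq_iff_eq_add.2 hp
  rw [sysSol, ← h1, ← mul_apply_eq_comp, Ring.inverse_mul_cancel _ h.isUnit]
  rfl

theorem SmallSystem.norm_sysSol_le (h : SmallSystem D U V) : ‖sysSol D U V‖ ≤ 3 / 2 := by
  have h1 : ‖sysSol D U V‖ ≤ 1 + 3 / 10 * ‖sysSol D U V‖ := by
    conv_lhs => rw [h.sysSol_eq]
    refine (norm_add_le _ _).trans ?_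
    gcongr
    · refine max_le ?_ (by simp)
      exact (BoundedContinuousFunction.norm_const_le _).trans (by simp)
    · exact ((sysOp D U V).le_opNorm _).trans (by gcongr; exact h.norm_sysOp_le)
  linarith

theorem SmallSystem.norm_sysSol_fst_le (h : SmallSystem D U V) (x : ℝ) :
    ‖(sysSol D U V).1 x‖ ≤ 3 / 2 :=
  ((sysSol D U V).1.norm_coe_le_norm x).trans ((norm_fst_le _).trans h.norm_sysSol_le)

theorem SmallSystem.norm_sysSol_snd_le (h : SmallSystem D U V) (x : ℝ) :
    ‖(sysSol D U V).2 x‖ ≤ 3 / 2 :=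
  ((sysSol D U V).2.norm_coe_le_norm x).trans ((norm_snd_le _).trans h.norm_sysSol_le)

theorem SmallSystem.fst_apply (h : SmallSystem D U V) (x : ℝ) :
    (sysSol D U V).1 x = 1 + ∫ y in Set.Iic x,
      (-(D y * (sysSol D U V).1 y) + U y * (sysSol D U V).2 y) := by
  have h1 := congrArg (fun p : (ℝ →ᵇ ℂ) × (ℝ →ᵇ ℂ) => p.1 x) h.sysSol_eq
  simp only [sysOp, Prod.fst_add, ContinuousLinearMap.prod_apply, _root_.add_apply,
    _root_.neg_apply, ContinuousLinearMap.comp_apply, ContinuousLinearMap.coe_fst',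
    ContinuousLinearMap.coe_snd', BoundedContinuousFunction.coe_add, Pi.add_apply,
    BoundedContinuousFunction.coe_neg, Pi.neg_apply, volterra_apply h.intD, volterra_apply h.intU,
    BoundedContinuousFunction.const_apply] at h1
  rw [h1, ← integral_neg, ← integral_add]
  · exact (integrable_mul_bcf h.intD _).neg.integrableOn
  · exact (integrable_mul_bcf h.intU _).integrableOn

theorem SmallSystem.snd_apply (h : SmallSystem D U V) (x : ℝ) :
    (sysSol D U V).2 x = ∫ y in Set.Iic x,
      (V y * (sysSol D U V).1 y + D y * (sysSol D U V).2 y) := by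
  have h1 := congrArg (fun p : (ℝ →ᵇ ℂ) × (ℝ →ᵇ ℂ) => p.2 x) h.sysSol_eq
  simp only [sysOp, Prod.snd_add, ContinuousLinearMap.prod_apply, _root_.add_apply,
    ContinuousLinearMap.comp_apply, ContinuousLinearMap.coe_fst',
    ContinuousLinearMap.coe_snd', BoundedContinuousFunction.coe_add, Pi.add_apply,
    volterra_apply h.intD, volterra_apply h.intV, zero_add] at h1
  rw [h1, integral_add (integrable_mul_bcf h.intV _).integrableOn
    (integrable_mul_bcf h.intD _).integrableOn]

/-- Uniqueness of the essentially bounded solution of the integral equations. -/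
theorem SmallSystem.unique (h : SmallSystem D U V) {f g : ℝ → ℂ}
    (hf : MemLp f ∞ volume) (hg : MemLp g ∞ volume)
    (hfe : ∀ x, f x = 1 + ∫ y in Set.Iic x, (-(D y * f y) + U y * g y))
    (hge : ∀ x, g x = ∫ y in Set.Iic x, (V y * f y + D y * g y)) :
    f = (sysSol D U V).1 ∧ g = (sysSol D U V).2 := by
  have hint : ∀ {q w : ℝ → ℂ}, Integrable q → MemLp w ∞ volume → Integrable fun y => q y * w y := by
    intro q w hq hw
    exact (memLp_one_iff_integrable.1 (hw.mul (memLp_one_iff_integrable.2 hq)))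
  have i1 : Integrable fun y => -(D y * f y) + U y * g y :=
    (hint h.intD hf).neg.add (hint h.intU hg)
  have i2 : Integrable fun y => V y * f y + D y * g y := (hint h.intV hf).add (hint h.intD hg)
  have hb : ∀ {w : ℝ → ℂ} (hw : Integrable w) (x : ℝ), ‖∫ y in Set.Iic x, w y‖ ≤ ∫ y, ‖w y‖ :=
    fun hw x => (norm_integral_le_integral_norm _).trans
      (setIntegral_le_integral hw.norm (Eventually.of_forall fun _ => norm_nonneg _))
  have cf : Continuous f := by
    rw [funext hfe]; exact continuous_const.add (continuous_integral_Iic i1)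
  have cg : Continuous g := by
    rw [funext hge]; exact continuous_integral_Iic i2
  -- an essentially bounded solution is continuous and bounded, by the equations themselves
  set F : ℝ →ᵇ ℂ := BoundedContinuousFunction.ofNormedAddCommGroup f cf _ fun x => by
    rw [hfe]; exact norm_add_le_of_le le_rfl (hb i1 x)
  set G : ℝ →ᵇ ℂ := BoundedContinuousFunction.ofNormedAddCommGroup g cg _ fun x => by
    rw [hge]; exact hb i2 x
  have key : (F, G) = sysSol D U V := by
    refine h.eq_sysSol (Prod.ext ?_ ?_)
    · ext x
      simp only [sysOp, Prod.fst_add, ContinuousLinearMap.prod_apply, _root_.add_apply,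
        _root_.neg_apply, ContinuousLinearMap.comp_apply, ContinuousLinearMap.coe_fst',
        ContinuousLinearMap.coe_snd', BoundedContinuousFunction.coe_add, Pi.add_apply,
        BoundedContinuousFunction.coe_neg, Pi.neg_apply, volterra_apply h.intD,
        volterra_apply h.intU, BoundedContinuousFunction.const_apply]
      rw [← integral_neg, ← integral_add]
      · exact hfe x
      · exact (integrable_mul_bcf h.intD _).neg.integrableOn
      · exact (integrable_mul_bcf h.intU _).integrableOn
    · ext x
      simp only [sysOp, Prod.snd_add, ContinuousLinearMap.prod_apply, _root_.add_apply,
        ContinuousLinearMap.comp_apply, ContinuousLinearMap.coe_fst',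
        ContinuousLinearMap.coe_snd', BoundedContinuousFunction.coe_add, Pi.add_apply,
        volterra_apply h.intD, volterra_apply h.intV, zero_add]
      rw [← integral_add (integrable_mul_bcf h.intV _).integrableOn
        (integrable_mul_bcf h.intD _).integrableOn]
      exact hge x
  rw [← key]
  exact ⟨rfl, rfl⟩

theorem sysOp_eq : sysOp D U V =
    ContinuousLinearMap.inl ℂ (ℝ →ᵇ ℂ) (ℝ →ᵇ ℂ) ∘L
      (-(volterra D ∘L ContinuousLinearMap.fst ℂ (ℝ →ᵇ ℂ) (ℝ →ᵇ ℂ)) +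
        volterra U ∘L ContinuousLinearMap.snd ℂ (ℝ →ᵇ ℂ) (ℝ →ᵇ ℂ)) +
    ContinuousLinearMap.inr ℂ (ℝ →ᵇ ℂ) (ℝ →ᵇ ℂ) ∘L
      (volterra V ∘L ContinuousLinearMap.fst ℂ (ℝ →ᵇ ℂ) (ℝ →ᵇ ℂ) +
        volterra D ∘L ContinuousLinearMap.snd ℂ (ℝ →ᵇ ℂ) (ℝ →ᵇ ℂ)) := by
  refine ContinuousLinearMap.ext fun p => Prod.ext ?_ ?_ <;> simp [sysOp]

theorem SmallSystem.differentiableAt_inverse (h : SmallSystem D U V) :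
    DifferentiableAt ℂ Ring.inverse (1 - sysOp D U V) :=
  _root_.differentiableAt_inverse (𝕜 := ℂ)
    (R := (ℝ →ᵇ ℂ) × (ℝ →ᵇ ℂ) →L[ℂ] (ℝ →ᵇ ℂ) × (ℝ →ᵇ ℂ)) h.isUnit

theorem continuous_sysSol {X : Type*} [TopologicalSpace X] {D U V : X → ℝ → ℂ}
    (h : ∀ x, SmallSystem (D x) (U x) (V x)) (hD : Continuous fun x => volterra (D x))
    (hU : Continuous fun x => volterra (U x)) (hV : Continuous fun x => volterra (V x)) :
    Continuous fun x => sysSol (D x) (U x) (V x) := by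
  have hop : Continuous fun x => sysOp (D x) (U x) (V x) := by
    simp only [sysOp_eq]
    exact (continuous_const.clm_comp
      ((hD.clm_comp continuous_const).neg.add (hU.clm_comp continuous_const))).add
      (continuous_const.clm_comp
        ((hV.clm_comp continuous_const).add (hD.clm_comp continuous_const)))
  have hinv : Continuous fun x => Ring.inverse (1 - sysOp (D x) (U x) (V x)) :=
    continuous_iff_continuousAt.2 fun x =>
      ContinuousAt.comp (g := Ring.inverse) (f := fun x => 1 - sysOp (D x) (U x) (V x))
        (h x).differentiableAt_inverse.continuousAt (continuous_const.sub hop).continuousAt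
  exact hinv.clm_apply continuous_const

theorem differentiableOn_sysSol {D U V : ℂ → ℝ → ℂ} {s : Set ℂ}
    (h : ∀ l ∈ s, SmallSystem (D l) (U l) (V l)) (hD : DifferentiableOn ℂ (fun l => volterra (D l)) s)
    (hU : DifferentiableOn ℂ (fun l => volterra (U l)) s)
    (hV : DifferentiableOn ℂ (fun l => volterra (V l)) s) :
    DifferentiableOn ℂ (fun l => sysSol (D l) (U l) (V l)) s := by
  have hop : DifferentiableOn ℂ (fun l => sysOp (D l) (U l) (V l)) s := by
    have hc : ∀ {A : ℂ → (ℝ →ᵇ ℂ) →L[ℂ] (ℝ →ᵇ ℂ)}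
        (P : ((ℝ →ᵇ ℂ) × (ℝ →ᵇ ℂ)) →L[ℂ] (ℝ →ᵇ ℂ)), DifferentiableOn ℂ A s →
        DifferentiableOn ℂ (fun l => A l ∘L P) s := fun P hA =>
      DifferentiableOn.clm_comp hA (differentiableOn_const P)
    have hc' : ∀ {A : ℂ → ((ℝ →ᵇ ℂ) × (ℝ →ᵇ ℂ)) →L[ℂ] (ℝ →ᵇ ℂ)}
        (J : (ℝ →ᵇ ℂ) →L[ℂ] ((ℝ →ᵇ ℂ) × (ℝ →ᵇ ℂ))), DifferentiableOn ℂ A s →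
        DifferentiableOn ℂ (fun l => J ∘L A l) s := fun J hA =>
      DifferentiableOn.clm_comp (differentiableOn_const J) hA
    simp only [sysOp_eq]
    have A1 := hc' (ContinuousLinearMap.inl ℂ (ℝ →ᵇ ℂ) (ℝ →ᵇ ℂ)) (DifferentiableOn.fun_add
      (F := ((ℝ →ᵇ ℂ) × (ℝ →ᵇ ℂ)) →L[ℂ] (ℝ →ᵇ ℂ)) (DifferentiableOn.fun_neg
      (F := ((ℝ →ᵇ ℂ) × (ℝ →ᵇ ℂ)) →L[ℂ] (ℝ →ᵇ ℂ)) (hc (.fst ℂ _ _) hD)) (hc (.snd ℂ _ _) hU))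
    have A2 := hc' (ContinuousLinearMap.inr ℂ (ℝ →ᵇ ℂ) (ℝ →ᵇ ℂ)) (DifferentiableOn.fun_add
      (F := ((ℝ →ᵇ ℂ) × (ℝ →ᵇ ℂ)) →L[ℂ] (ℝ →ᵇ ℂ)) (hc (.fst ℂ _ _) hV) (hc (.snd ℂ _ _) hD))
    exact DifferentiableOn.fun_add
      (F := ((ℝ →ᵇ ℂ) × (ℝ →ᵇ ℂ)) →L[ℂ] ((ℝ →ᵇ ℂ) × (ℝ →ᵇ ℂ))) A1 A2
  have hinv : DifferentiableOn ℂ (fun l => Ring.inverse (1 - sysOp (D l) (U l) (V l))) s :=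
    fun l hl => DifferentiableAt.comp_differentiableWithinAt (g := Ring.inverse)
      (f := fun x => 1 - sysOp (D x) (U x) (V x)) l (h l hl).differentiableAt_inverse
      (((differentiableOn_const _).sub hop) l hl)
  exact hinv.clm_apply (differentiableOn_const _)

end

/-! ### Functions in `H² ∩ H^{1,1}` -/

theorem bracket_pos (x : ℝ) : 0 < bracket x := Real.sqrt_pos.2 (by positivity)

theorem continuous_bracket : Continuous bracket := by unfold bracket; fun_prop

theorem one_le_bracket (x : ℝ) : 1 ≤ bracket x :=
  Real.one_le_sqrt.2 (by nlinarith [sq_nonneg x])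

theorem abs_le_bracket (x : ℝ) : |x| ≤ bracket x :=
  Real.abs_le_sqrt (by linarith)

theorem bracket_neg (x : ℝ) : bracket (-x) = bracket x := by simp [bracket]

theorem bracket_le (x : ℝ) : bracket x ≤ 1 + |x| :=
  Real.sqrt_le_iff.2 ⟨by positivity, by nlinarith [abs_nonneg x, sq_abs x]⟩

theorem eLpNorm_le_bracket (f : ℝ → ℂ) :
    eLpNorm f 2 volume ≤ eLpNorm (fun x => bracket x • f x) 2 volume :=
  eLpNorm_mono fun x => by
    rw [norm_smul, Real.norm_of_nonneg (bracket_pos x).le]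
    exact le_mul_of_one_le_left (norm_nonneg _) (one_le_bracket x)

theorem eLpNorm_mul_le_bracket (f : ℝ → ℂ) :
    eLpNorm (fun x : ℝ => (x : ℂ) * f x) 2 volume ≤ eLpNorm (fun x => bracket x • f x) 2 volume :=
  eLpNorm_mono fun x => by
    rw [norm_smul, norm_mul, Complex.norm_real, Real.norm_of_nonneg (bracket_pos x).le]
    gcongr
    exact abs_le_bracket x

theorem eLpNorm_bracket_inv_le : eLpNorm (fun x => ((bracket x)⁻¹ : ℝ)) 2 volume ≤ 2 := by
  rw [eLpNorm_two_eq]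
  have h : ∀ x : ℝ, ‖(bracket x)⁻¹‖ₑ ^ (2 : ℝ) = ENNReal.ofReal ((1 + x ^ 2)⁻¹) := by
    intro x
    rw [← ofReal_norm, ENNReal.ofReal_rpow_of_nonneg (norm_nonneg _) (by norm_num)]
    congr 1
    rw [norm_inv, Real.norm_of_nonneg (bracket_pos x).le, Real.rpow_two, inv_pow, bracket,
      Real.sq_sqrt (by positivity)]
  simp_rw [h]
  rw [← ofReal_integral_eq_lintegral_ofReal integrable_inv_one_add_sq
    (Eventually.of_forall fun x => by positivity), integral_univ_inv_one_add_sq]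
  calc ENNReal.ofReal Real.pi ^ (1 / 2 : ℝ) ≤ (4 : ℝ≥0∞) ^ (1 / 2 : ℝ) := by
        gcongr
        rw [show (4 : ℝ≥0∞) = ENNReal.ofReal 4 by simp]
        exact ENNReal.ofReal_le_ofReal Real.pi_le_four
    _ = 2 := by
        rw [show (4 : ℝ≥0∞) = 2 ^ (2 : ℝ) by norm_num, ← ENNReal.rpow_mul]
        norm_num

theorem lintegral_mul_le_eLpNorm {f g : ℝ → ℂ} (hf : AEStronglyMeasurable f volume)
    (hg : AEStronglyMeasurable g volume) :
    ∫⁻ x, ‖f x * g x‖ₑ ≤ eLpNorm f 2 volume * eLpNorm g 2 volume := by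
  rw [eLpNorm_two_eq, eLpNorm_two_eq]
  simp_rw [enorm_mul]
  exact ENNReal.lintegral_mul_le_Lp_mul_Lq volume Real.HolderConjugate.two_two hf.enorm hg.enorm

theorem lintegral_enorm_le_bracket {f : ℝ → ℂ} (hf : AEStronglyMeasurable f volume) :
    ∫⁻ x, ‖f x‖ₑ ≤ 2 * eLpNorm (fun x => bracket x • f x) 2 volume := by
  have hb : Continuous fun x => ((bracket x)⁻¹ : ℝ) :=
    continuous_bracket.inv₀ fun x => (bracket_pos x).ne'
  have h1 : ∀ x, f x = ((bracket x)⁻¹ : ℝ) * (bracket x • f x) := by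
    intro x
    rw [Complex.real_smul, ← mul_assoc, ← Complex.ofReal_mul, inv_mul_cancel₀ (bracket_pos x).ne']
    simp
  calc ∫⁻ x, ‖f x‖ₑ = ∫⁻ x, ‖(((bracket x)⁻¹ : ℝ) : ℂ) * (bracket x • f x)‖ₑ := by
        simp_rw [← h1]
    _ ≤ eLpNorm (fun x => (((bracket x)⁻¹ : ℝ) : ℂ)) 2 volume
        * eLpNorm (fun x => bracket x • f x) 2 volume :=
        lintegral_mul_le_eLpNorm (Complex.continuous_ofReal.comp hb).aestronglyMeasurable
          (continuous_bracket.aestronglyMeasurable.smul hf)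
    _ ≤ _ := by
        gcongr
        refine le_trans (le_of_eq ?_) eLpNorm_bracket_inv_le
        exact eLpNorm_congr_norm_ae (Eventually.of_forall fun x => Complex.norm_real _)

/-- `u` is the continuously differentiable representative of an element of `H² ∩ H^{1,1}`, with
first derivative `u1` and weak second derivative `u2`, and its norms are at most `M`. -/
structure NiceFun (M : ℝ≥0) (u u1 u2 : ℝ → ℂ) : Prop where
  hasDerivAt : ∀ x, HasDerivAt u (u1 x) x
  continuous_deriv : Continuous u1
  sub_eq : ∀ a b, u1 b - u1 a = ∫ y in a..b, u2 y
  aesm : AEStronglyMeasurable u2 volume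
  norm0 : eLpNorm (fun x => bracket x • u x) 2 volume ≤ M
  norm1 : eLpNorm (fun x => bracket x • u1 x) 2 volume ≤ M
  norm2 : eLpNorm u2 2 volume ≤ M

namespace NiceFun

variable {M M' : ℝ≥0} {u u1 u2 w w1 w2 : ℝ → ℂ}

theorem mono (h : NiceFun M u u1 u2) (hM : M ≤ M') : NiceFun M' u u1 u2 :=
  ⟨h.1, h.2, h.3, h.4, h.5.trans (by exact_mod_cast hM), h.6.trans (by exact_mod_cast hM),
    h.7.trans (by exact_mod_cast hM)⟩

theorem continuous (h : NiceFun M u u1 u2) : Continuous u :=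
  continuous_iff_continuousAt.2 fun x => (h.hasDerivAt x).continuousAt

theorem memLp (h : NiceFun M u u1 u2) : MemLp u 2 :=
  ⟨h.continuous.aestronglyMeasurable, ((eLpNorm_le_bracket u).trans h.norm0).trans_lt (by simp)⟩

theorem memLp_deriv (h : NiceFun M u u1 u2) : MemLp u1 2 :=
  ⟨h.continuous_deriv.aestronglyMeasurable,
    ((eLpNorm_le_bracket u1).trans h.norm1).trans_lt (by simp)⟩

theorem memLp_deriv2 (h : NiceFun M u u1 u2) : MemLp u2 2 := ⟨h.aesm, h.norm2.trans_lt (by simp)⟩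

theorem lintegral_le (h : NiceFun M u u1 u2) : ∫⁻ x, ‖u x‖ₑ ≤ 2 * M :=
  (lintegral_enorm_le_bracket h.continuous.aestronglyMeasurable).trans (by gcongr; exact h.norm0)

theorem lintegral_deriv_le (h : NiceFun M u u1 u2) : ∫⁻ x, ‖u1 x‖ₑ ≤ 2 * M :=
  (lintegral_enorm_le_bracket h.continuous_deriv.aestronglyMeasurable).trans
    (by gcongr; exact h.norm1)

theorem integrable (h : NiceFun M u u1 u2) : Integrable u :=
  ⟨h.continuous.aestronglyMeasurable, h.lintegral_le.trans_lt (by finiteness)⟩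

theorem integrable_deriv (h : NiceFun M u u1 u2) : Integrable u1 :=
  ⟨h.continuous_deriv.aestronglyMeasurable, h.lintegral_deriv_le.trans_lt (by finiteness)⟩

theorem tendsto_atBot (h : NiceFun M u u1 u2) : Tendsto u atBot (𝓝 0) :=
  tendsto_zero_of_hasDerivAt_of_integrableOn_Iic (a := 0) (fun x _ => h.hasDerivAt x)
    h.integrable_deriv.integrableOn h.integrable.integrableOn

theorem tendsto_atTop (h : NiceFun M u u1 u2) : Tendsto u atTop (𝓝 0) :=
  tendsto_zero_of_hasDerivAt_of_integrableOn_Ioi (a := 0) (fun x _ => h.hasDerivAt x)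
    h.integrable_deriv.integrableOn h.integrable.integrableOn

theorem enorm_le (h : NiceFun M u u1 u2) (x : ℝ) : ‖u x‖ₑ ≤ 2 * M := by
  have h1 := integral_Iic_of_hasDerivAt_of_tendsto (a := x) h.continuous.continuousWithinAt
    (fun y _ => h.hasDerivAt y) h.integrable_deriv.integrableOn h.tendsto_atBot
  rw [sub_zero] at h1
  rw [← h1]
  exact (enorm_integral_le_lintegral_enorm _).trans
    ((setLIntegral_le_lintegral _ _).trans h.lintegral_deriv_le)

theorem norm_le (h : NiceFun M u u1 u2) (x : ℝ) : ‖u x‖ ≤ 2 * M := by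
  have := ENNReal.toReal_mono (by finiteness) (h.enorm_le x)
  simpa using this

theorem sqrt_abs_mul_norm_deriv_le (h : NiceFun M u u1 u2) (x : ℝ) : √|x| * ‖u1 x‖ ≤ 2 * M :=
  sqrt_abs_mul_norm_le h.continuous_deriv h.aesm h.sub_eq
    ((eLpNorm_mul_le_bracket u1).trans h.norm1) h.norm2 x

theorem add_smul (h : NiceFun M u u1 u2) (h' : NiceFun M' w w1 w2) (c : ℂ) :
    NiceFun (M + ‖c‖₊ * M') (fun x => u x + c * w x) (fun x => u1 x + c * w1 x)
      (fun x => u2 x + c * w2 x) := by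
  have key : ∀ {f g : ℝ → ℂ}, AEStronglyMeasurable f volume → AEStronglyMeasurable g volume →
      eLpNorm f 2 volume ≤ M → eLpNorm g 2 volume ≤ M' →
      eLpNorm (fun x => f x + c * g x) 2 volume ≤ (M + ‖c‖₊ * M' : ℝ≥0) := by
    intro f g hf hg hfM hgM
    calc _ ≤ eLpNorm f 2 volume + eLpNorm (fun x => c * g x) 2 volume :=
          eLpNorm_add_le hf (hg.const_mul c) (by norm_num)
      _ = eLpNorm f 2 volume + ‖c‖ₑ * eLpNorm g 2 volume := by
          congr 1
          exact eLpNorm_const_smul c g 2 volume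
      _ ≤ M + ‖c‖ₑ * M' := by gcongr
      _ = _ := by push_cast; rfl
  have e : ∀ f g : ℝ → ℂ, (fun x => bracket x • (f x + c * g x))
      = fun x => bracket x • f x + c * (bracket x • g x) := by
    intro f g
    ext x
    simp only [Complex.real_smul]
    ring
  refine ⟨fun x => (h.hasDerivAt x).add ((h'.hasDerivAt x).const_mul c),
    h.continuous_deriv.add (continuous_const.mul h'.continuous_deriv), fun a b => ?_,
    h.aesm.add (h'.aesm.const_mul c), ?_, ?_, key h.aesm h'.aesm h.norm2 h'.norm2⟩
  · have hi : ∀ {f : ℝ → ℂ}, MemLp f 2 → IntervalIntegrable f volume a b := fun hf =>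
      ((hf.locallyIntegrable (by norm_num)).integrableOn_isCompact isCompact_uIcc).intervalIntegrable
    rw [intervalIntegral.integral_add (hi h.memLp_deriv2) ((hi h'.memLp_deriv2).const_mul c),
      intervalIntegral.integral_const_mul, ← h.sub_eq, ← h'.sub_eq]
    ring
  · rw [e]
    exact key (continuous_bracket.aestronglyMeasurable.smul h.continuous.aestronglyMeasurable)
      (continuous_bracket.aestronglyMeasurable.smul h'.continuous.aestronglyMeasurable)
      h.norm0 h'.norm0
  · rw [e]
    exact key (continuous_bracket.aestronglyMeasurable.smul h.continuous_deriv.aestronglyMeasurable)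
      (continuous_bracket.aestronglyMeasurable.smul h'.continuous_deriv.aestronglyMeasurable)
      h.norm1 h'.norm1

theorem const_mul (h : NiceFun M u u1 u2) {c : ℂ} (hc : ‖c‖ = 1) :
    NiceFun M (fun x => c * u x) (fun x => c * u1 x) (fun x => c * u2 x) := by
  have key : ∀ (f : ℝ → ℂ), eLpNorm (fun x => c * f x) 2 volume = eLpNorm f 2 volume := fun f =>
    eLpNorm_congr_norm_ae (Eventually.of_forall fun x => by rw [norm_mul, hc, one_mul])
  have e : ∀ (f : ℝ → ℂ), (fun x => bracket x • (c * f x)) = fun x => c * (bracket x • f x) := by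
    intro f
    ext x
    simp only [Complex.real_smul]
    ring
  refine ⟨fun x => (h.hasDerivAt x).const_mul c, continuous_const.mul h.continuous_deriv,
    fun a b => ?_, h.aesm.const_mul c, ?_, ?_, ?_⟩
  · rw [intervalIntegral.integral_const_mul, ← h.sub_eq]; ring
  · rw [e, key]; exact h.norm0
  · rw [e, key]; exact h.norm1
  · rw [key]; exact h.norm2

theorem _root_.NDNLS.eLpNorm_comp_neg (f : ℝ → ℂ) :
    eLpNorm (fun x => f (-x)) 2 volume = eLpNorm f 2 volume := by
  have h := (MeasurableEquiv.neg ℝ).measurableEmbedding.eLpNorm_map_measure (g := f) (p := 2)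
    (μ := volume)
  rw [show Measure.map (MeasurableEquiv.neg ℝ) volume = volume from
    (Measure.measurePreserving_neg (volume : Measure ℝ)).map_eq] at h
  exact h.symm

theorem comp_neg (h : NiceFun M u u1 u2) :
    NiceFun M (fun x => u (-x)) (fun x => -u1 (-x)) (fun x => u2 (-x)) := by
  have e : ∀ f : ℝ → ℂ, eLpNorm (fun x => bracket x • f (-x)) 2 volume
        = eLpNorm (fun x => bracket x • f x) 2 volume := by
    intro f
    rw [← eLpNorm_comp_neg fun x => bracket x • f x]
    simp only [bracket_neg]
  refine ⟨fun x => ?_, (h.continuous_deriv.comp continuous_neg).neg, fun a b => ?_,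
    h.aesm.comp_measurePreserving (Measure.measurePreserving_neg (volume : Measure ℝ)), ?_, ?_, ?_⟩
  · have := (h.hasDerivAt (-x)).scomp x (hasDerivAt_neg x)
    simpa [Function.comp_def] using this
  · rw [intervalIntegral.integral_comp_neg, ← h.sub_eq]; ring
  · rw [e]
    exact h.norm0
  · simp only [smul_neg]
    rw [show (fun x => -(bracket x • u1 (-x))) = -(fun x => bracket x • u1 (-x)) from rfl,
      eLpNorm_neg, e]
    exact h.norm1
  · rw [eLpNorm_comp_neg]
    exact h.norm2

theorem star (h : NiceFun M u u1 u2) : NiceFun M (fun x => starRingEnd ℂ (u x))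
    (fun x => starRingEnd ℂ (u1 x)) (fun x => starRingEnd ℂ (u2 x)) := by
  have key : ∀ (f : ℝ → ℂ), eLpNorm (fun x => starRingEnd ℂ (f x)) 2 volume = eLpNorm f 2 volume :=
    fun f => eLpNorm_congr_norm_ae (Eventually.of_forall fun x => RCLike.norm_conj _)
  have e : ∀ (f : ℝ → ℂ), (fun x => bracket x • starRingEnd ℂ (f x))
      = fun x => starRingEnd ℂ (bracket x • f x) := by
    intro f
    ext x
    simp
  refine ⟨fun x => (h.hasDerivAt x).star, Complex.continuous_conj.comp h.continuous_deriv,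
    fun a b => ?_, Complex.continuous_conj.comp_aestronglyMeasurable h.aesm, ?_, ?_, ?_⟩
  · rw [← map_sub, h.sub_eq, intervalIntegral.intervalIntegral_eq_integral_uIoc,
      intervalIntegral.intervalIntegral_eq_integral_uIoc, integral_conj, Complex.real_smul,
      Complex.real_smul, map_mul, Complex.conj_ofReal]
  · rw [e, key]; exact h.norm0
  · rw [e, key]; exact h.norm1
  · rw [key]; exact h.norm2

end NiceFun

/-! ### Pairs of potentials and their Jost solutions -/

/-- A pair of independent complex potentials `(u, v)`, together with their first two derivatives. -/
structure Pair where
  (u u1 u2 v v1 v2 : ℝ → ℂ)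

namespace Pair

/-- The diagonal coefficient `uv/2i` of the transformed spectral problem. -/
def D (P : Pair) (x : ℝ) : ℂ := P.u x * P.v x / (2 * Complex.I)

/-- The upper right coefficient `u/2i` of the transformed spectral problem. -/
def U (P : Pair) (x : ℝ) : ℂ := P.u x / (2 * Complex.I)

/-- The lower left coefficient `(2i v_x - u v²)/2i` of the transformed spectral problem. -/
def V (P : Pair) (x : ℝ) : ℂ :=
  (2 * Complex.I * P.v1 x - P.u x * P.v x ^ 2) / (2 * Complex.I)

/-- Both potentials lie in `H² ∩ H^{1,1}` with norms at most `M`, and the potential matrix is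
small in `L¹`. -/
structure Good (M : ℝ≥0) (P : Pair) : Prop where
  niceU : NiceFun M P.u P.u1 P.u2
  niceV : NiceFun M P.v P.v1 P.v2
  small : 2 * (∫ y, ‖P.D y‖) + (∫ y, ‖P.U y‖) + (∫ y, ‖P.V y‖) ≤ 3 / 10

theorem continuous_D {P : Pair} {M M' : ℝ≥0} (hu : NiceFun M P.u P.u1 P.u2)
    (hv : NiceFun M' P.v P.v1 P.v2) : Continuous P.D :=
  (hu.continuous.mul hv.continuous).div_const _

theorem continuous_U {P : Pair} {M : ℝ≥0} (hu : NiceFun M P.u P.u1 P.u2) : Continuous P.U :=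
  hu.continuous.div_const _

theorem continuous_V {P : Pair} {M M' : ℝ≥0} (hu : NiceFun M P.u P.u1 P.u2)
    (hv : NiceFun M' P.v P.v1 P.v2) : Continuous P.V :=
  ((continuous_const.mul hv.continuous_deriv).sub (hu.continuous.mul (hv.continuous.pow 2))).div_const _

theorem integrable_mul {M M' : ℝ≥0} {u u1 u2 w w1 w2 : ℝ → ℂ} (hu : NiceFun M u u1 u2)
    (hw : NiceFun M' w w1 w2) : Integrable fun x => u x * w x :=
  hu.integrable.mul_bdd hw.continuous.aestronglyMeasurable (Eventually.of_forall hw.norm_le)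

theorem integrable_mul_sq {M M' : ℝ≥0} {u u1 u2 w w1 w2 : ℝ → ℂ} (hu : NiceFun M u u1 u2)
    (hw : NiceFun M' w w1 w2) : Integrable fun x => u x * w x ^ 2 := by
  refine hu.integrable.mul_bdd (c := (2 * M' : ℝ) ^ 2) (hw.continuous.pow 2).aestronglyMeasurable
    (Eventually.of_forall fun x => ?_)
  rw [norm_pow]
  gcongr
  exact hw.norm_le x

theorem integrable_D {P : Pair} {M M' : ℝ≥0} (hu : NiceFun M P.u P.u1 P.u2)
    (hv : NiceFun M' P.v P.v1 P.v2) : Integrable P.D := (integrable_mul hu hv).div_const _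

theorem integrable_U {P : Pair} {M : ℝ≥0} (hu : NiceFun M P.u P.u1 P.u2) : Integrable P.U :=
  hu.integrable.div_const _

theorem integrable_V {P : Pair} {M M' : ℝ≥0} (hu : NiceFun M P.u P.u1 P.u2)
    (hv : NiceFun M' P.v P.v1 P.v2) : Integrable P.V :=
  ((hv.integrable_deriv.const_mul _).sub (integrable_mul_sq hu hv)).div_const _

variable {P : Pair} {M : ℝ≥0}

theorem Good.smallSystem (h : P.Good M) (z : ℝ) :
    SmallSystem P.D (fun y => osc z y * P.U y) (fun y => osc (-z) y * P.V y) where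
  intD := integrable_D h.niceU h.niceV
  intU := integrable_osc_mul (integrable_U h.niceU) z
  intV := integrable_osc_mul (integrable_V h.niceU h.niceV) (-z)
  small := by
    simp only [norm_mul, norm_osc, one_mul]
    exact h.small

/-- The first component of the Jost solution normalized at `-∞`. -/
def m (P : Pair) (z : ℝ) : ℝ →ᵇ ℂ :=
  (sysSol P.D (fun y => osc z y * P.U y) (fun y => osc (-z) y * P.V y)).1

/-- The second component of the Jost solution normalized at `-∞`, multiplied by `e^{-2izx}`. -/
def g (P : Pair) (z : ℝ) : ℝ →ᵇ ℂ :=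
  (sysSol P.D (fun y => osc z y * P.U y) (fun y => osc (-z) y * P.V y)).2

/-- The combination `μ₂ - v μ₁` of the components of the Jost solution. -/
def chi (P : Pair) (z x : ℝ) : ℂ := osc z x * P.g z x - P.v x * P.m z x

/-- The limit of the first component of the Jost solution at `+∞`. -/
def alpha (P : Pair) (z : ℝ) : ℂ :=
  1 - totalInt P.D (P.m z) + totalInt (fun y => osc z y * P.U y) (P.g z)

/-- The oscillating integral `∫ e^{-2izy} v μ₁ dy`. -/
def beta (P : Pair) (z : ℝ) : ℂ := totalInt (fun y => osc (-z) y * P.v y) (P.m z)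

/-- The quotient of `∫ e^{-2izy} v μ₁ dy` by the limit of `μ₁` at `+∞`; both reflection
coefficients are obtained from it by elementary operations. -/
def rho (P : Pair) (z : ℝ) : ℂ := P.beta z / P.alpha z

theorem Good.norm_m_le (h : P.Good M) (z x : ℝ) : ‖P.m z x‖ ≤ 3 / 2 :=
  (h.smallSystem z).norm_sysSol_fst_le x

theorem Good.norm_g_le (h : P.Good M) (z x : ℝ) : ‖P.g z x‖ ≤ 3 / 2 :=
  (h.smallSystem z).norm_sysSol_snd_le x

/-- The derivative of the first component. -/
def dm (P : Pair) (z x : ℝ) : ℂ := -(P.D x * P.m z x) + osc z x * P.U x * P.g z x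

/-- The derivative of the second component, multiplied by `e^{-2izx}`. -/
def dg (P : Pair) (z x : ℝ) : ℂ := osc (-z) x * P.V x * P.m z x + P.D x * P.g z x

theorem Good.m_eq (h : P.Good M) (z x : ℝ) : P.m z x = 1 + ∫ y in Set.Iic x, P.dm z y :=
  (h.smallSystem z).fst_apply x

theorem Good.g_eq (h : P.Good M) (z x : ℝ) : P.g z x = ∫ y in Set.Iic x, P.dg z y :=
  (h.smallSystem z).snd_apply x

theorem Good.integrable_dm (h : P.Good M) (z : ℝ) : Integrable (P.dm z) :=
  (integrable_mul_bcf (h.smallSystem z).intD _).neg.add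
    (integrable_mul_bcf (h.smallSystem z).intU _)

theorem Good.integrable_dg (h : P.Good M) (z : ℝ) : Integrable (P.dg z) :=
  (integrable_mul_bcf (h.smallSystem z).intV _).add
    (integrable_mul_bcf (h.smallSystem z).intD _)

theorem Good.continuous_dm (h : P.Good M) (z : ℝ) : Continuous (P.dm z) :=
  ((continuous_D h.niceU h.niceV).mul (P.m z).continuous).neg.add
    (((continuous_osc_right z).mul (continuous_U h.niceU)).mul (P.g z).continuous)

theorem Good.continuous_dg (h : P.Good M) (z : ℝ) : Continuous (P.dg z) :=
  (((continuous_osc_right (-z)).mul (continuous_V h.niceU h.niceV)).mul (P.m z).continuous).add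
    ((continuous_D h.niceU h.niceV).mul (P.g z).continuous)

theorem _root_.NDNLS.hasDerivAt_integral_Iic {f : ℝ → ℂ} (hf : Integrable f) (hc : Continuous f) (x : ℝ) :
    HasDerivAt (fun x => ∫ y in Set.Iic x, f y) (f x) x := by
  have h : ∀ x, ∫ y in Set.Iic x, f y = (∫ y in Set.Iic 0, f y) + ∫ y in (0 : ℝ)..x, f y := by
    intro x
    rw [← intervalIntegral.integral_Iic_sub_Iic hf.integrableOn hf.integrableOn]
    abel
  rw [funext h]
  exact (intervalIntegral.integral_hasDerivAt_right (hc.intervalIntegrable _ _)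
    (hc.stronglyMeasurableAtFilter _ _) hc.continuousAt).const_add _

theorem Good.hasDerivAt_m' (h : P.Good M) (z x : ℝ) : HasDerivAt (P.m z) (P.dm z x) x := by
  rw [show (P.m z : ℝ → ℂ) = fun x => 1 + ∫ y in Set.Iic x, P.dm z y from funext (h.m_eq z)]
  exact (hasDerivAt_integral_Iic (h.integrable_dm z) (h.continuous_dm z) x).const_add 1

theorem Good.hasDerivAt_g (h : P.Good M) (z x : ℝ) : HasDerivAt (P.g z) (P.dg z x) x := by
  rw [show (P.g z : ℝ → ℂ) = fun x => ∫ y in Set.Iic x, P.dg z y from funext (h.g_eq z)]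
  exact hasDerivAt_integral_Iic (h.integrable_dg z) (h.continuous_dg z) x

theorem _root_.NDNLS.hasDerivAt_osc (z x : ℝ) :
    HasDerivAt (osc z) (2 * Complex.I * z * osc z x) x := by
  have h1 : HasDerivAt (fun x : ℝ => ((2 * z * x : ℝ) : ℂ) * Complex.I) (2 * z * Complex.I) x := by
    have := ((((hasDerivAt_id x).const_mul (2 * z)).ofReal_comp).mul_const Complex.I)
    simpa using this
  have := h1.cexp
  unfold osc
  convert! this using 1
  ring

theorem Good.hasDerivAt_m (h : P.Good M) (z x : ℝ) :
    HasDerivAt (P.m z) (P.u x / (2 * Complex.I) * P.chi z x) x := by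
  convert h.hasDerivAt_m' z x using 1
  simp only [dm, chi, D, U]
  ring

theorem Good.hasDerivAt_chi (h : P.Good M) (z x : ℝ) :
    HasDerivAt (P.chi z) (2 * Complex.I * z * (P.chi z x + P.v x * P.m z x)) x := by
  have := ((hasDerivAt_osc z x).mul (h.hasDerivAt_g z x)).sub
    ((h.niceV.hasDerivAt x).mul (h.hasDerivAt_m z x))
  refine this.congr_deriv ?_
  simp only [dg, chi, D, V]
  have e := osc_mul_osc_neg z x
  have hI : (2 * Complex.I : ℂ) ≠ 0 := by simp
  field_simp
  linear_combination (2 * P.m z x * Complex.I * P.v1 x - P.m z x * P.u x * P.v x ^ 2) * e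

theorem Good.tendsto_m_atBot (h : P.Good M) (z : ℝ) : Tendsto (P.m z) atBot (𝓝 1) := by
  rw [show (P.m z : ℝ → ℂ) = fun x => 1 + ∫ y in Set.Iic x, P.dm z y from funext (h.m_eq z)]
  simpa using tendsto_integral_Iic_atBot.const_add 1

theorem Good.tendsto_g_atBot (h : P.Good M) (z : ℝ) : Tendsto (P.g z) atBot (𝓝 0) := by
  rw [show (P.g z : ℝ → ℂ) = fun x => ∫ y in Set.Iic x, P.dg z y from funext (h.g_eq z)]
  exact tendsto_integral_Iic_atBot

theorem Good.alpha_eq (h : P.Good M) (z : ℝ) : P.alpha z = 1 + ∫ y, P.dm z y := by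
  have hs := h.smallSystem z
  simp only [alpha, dm]
  rw [totalInt_apply hs.intD, totalInt_apply hs.intU, integral_add, integral_neg]
  · ring
  · exact (integrable_mul_bcf hs.intD _).neg
  · exact integrable_mul_bcf hs.intU _

theorem Good.tendsto_m_atTop (h : P.Good M) (z : ℝ) : Tendsto (P.m z) atTop (𝓝 (P.alpha z)) := by
  rw [show (P.m z : ℝ → ℂ) = fun x => 1 + ∫ y in Set.Iic x, P.dm z y from funext (h.m_eq z),
    h.alpha_eq]
  exact (tendsto_integral_Iic_atTop (h.integrable_dm z)).const_add 1

theorem Good.integrable_osc_v (h : P.Good M) (z : ℝ) : Integrable fun y => osc (-z) y * P.v y :=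
  integrable_osc_mul h.niceV.integrable (-z)

theorem Good.beta_eq (h : P.Good M) (z : ℝ) : P.beta z = ∫ y, osc (-z) y * P.v y * P.m z y :=
  totalInt_apply (h.integrable_osc_v z) _

theorem tendsto_osc_mul_zero {f : ℝ → ℂ} {l : Filter ℝ} (z : ℝ) (hf : Tendsto f l (𝓝 0)) :
    Tendsto (fun x => osc z x * f x) l (𝓝 0) := by
  rw [tendsto_zero_iff_norm_tendsto_zero] at hf ⊢
  simpa [norm_osc] using hf

theorem tendsto_mul_bcf_zero {f : ℝ → ℂ} {l : Filter ℝ} (w : ℝ →ᵇ ℂ) (hf : Tendsto f l (𝓝 0)) :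
    Tendsto (fun x => f x * w x) l (𝓝 0) :=
  hf.zero_mul_isBoundedUnder_le
    (isBoundedUnder_of ⟨‖w‖, fun x => w.norm_coe_le_norm x⟩)

theorem osc_neg_mul_chi (z x : ℝ) :
    osc (-z) x * P.chi z x = P.g z x - osc (-z) x * P.v x * P.m z x := by
  simp only [chi]
  linear_combination (P.g z x) * osc_mul_osc_neg z x

/-- The limit of `e^{-2izx}(μ₂ - v μ₁)` at `+∞`. -/
theorem Good.tendsto_g_atTop (h : P.Good M) (z : ℝ) :
    Tendsto (P.g z) atTop (𝓝 (2 * Complex.I * z * P.beta z)) := by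
  have hlim : Tendsto (P.g z) atTop (𝓝 (∫ y, P.dg z y)) := by
    rw [show (P.g z : ℝ → ℂ) = fun x => ∫ y in Set.Iic x, P.dg z y from funext (h.g_eq z)]
    exact tendsto_integral_Iic_atTop (h.integrable_dg z)
  have hd : ∀ x, HasDerivAt (fun x => osc (-z) x * P.chi z x)
      (2 * Complex.I * z * (osc (-z) x * P.v x * P.m z x)) x := by
    intro x
    refine ((hasDerivAt_osc (-z) x).mul (h.hasDerivAt_chi z x)).congr_deriv ?_
    push_cast
    ring
  have hv0 : ∀ {l : Filter ℝ}, Tendsto P.v l (𝓝 0) →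
      Tendsto (fun x => osc (-z) x * P.v x * P.m z x) l (𝓝 0) := fun hl =>
    tendsto_mul_bcf_zero _ (tendsto_osc_mul_zero _ hl)
  have hbot : Tendsto (fun x => osc (-z) x * P.chi z x) atBot (𝓝 0) := by
    simp only [osc_neg_mul_chi]
    simpa using (h.tendsto_g_atBot z).sub (hv0 h.niceV.tendsto_atBot)
  have htop : Tendsto (fun x => osc (-z) x * P.chi z x) atTop (𝓝 (∫ y, P.dg z y)) := by
    simp only [osc_neg_mul_chi]
    simpa using hlim.sub (hv0 h.niceV.tendsto_atTop)
  -- in the variables `(μ₁, χ)` only a multiple of `z v μ₁` is left to integrate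
  have key := integral_of_hasDerivAt_of_tendsto hd
    ((integrable_mul_bcf (h.integrable_osc_v z) _).const_mul _) hbot htop
  rw [integral_const_mul, ← h.beta_eq, sub_zero] at key
  rw [key]
  exact hlim

theorem Good.tendsto_osc_chi_atTop (h : P.Good M) (z : ℝ) :
    Tendsto (fun x => osc (-z) x * P.chi z x) atTop (𝓝 (2 * Complex.I * z * P.beta z)) := by
  simp only [osc_neg_mul_chi]
  simpa using (h.tendsto_g_atTop z).sub
    (tendsto_mul_bcf_zero (P.m z) (tendsto_osc_mul_zero (-z) h.niceV.tendsto_atTop))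

theorem Good.tendsto_chi_atBot (h : P.Good M) (z : ℝ) : Tendsto (P.chi z) atBot (𝓝 0) := by
  have h1 := tendsto_osc_mul_zero z (h.tendsto_g_atBot z)
  have h2 := tendsto_mul_bcf_zero (P.m z) h.niceV.tendsto_atBot
  have h3 := h1.sub h2
  rw [sub_zero] at h3
  exact h3

theorem Good.norm_chi_le (h : P.Good M) (z x : ℝ) : ‖P.chi z x‖ ≤ 3 / 2 + 3 * M := by
  refine (norm_sub_le _ _).trans ?_
  rw [norm_mul, norm_mul, norm_osc, one_mul]
  have h1 := h.norm_g_le z x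
  have h2 := h.norm_m_le z x
  have h3 := h.niceV.norm_le x
  nlinarith [norm_nonneg (P.m z x), norm_nonneg (P.v x), mul_le_mul h3 h2 (norm_nonneg _) (by positivity)]

/-- The smallness condition keeps the limit `α` away from zero. -/
theorem Good.half_le_norm_alpha (h : P.Good M) (z : ℝ) : 1 / 2 ≤ ‖P.alpha z‖ := by
  have hs := h.smallSystem z
  have hD : 0 ≤ ∫ y, ‖P.D y‖ := by positivity
  have hU : 0 ≤ ∫ y, ‖P.U y‖ := by positivity
  have hV : 0 ≤ ∫ y, ‖P.V y‖ := by positivity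
  have h1 : ‖totalInt P.D (P.m z)‖ ≤ (∫ y, ‖P.D y‖) * (3 / 2) :=
    ((totalInt P.D).le_opNorm _).trans (mul_le_mul (norm_totalInt_le hs.intD)
      ((_root_.norm_fst_le _).trans hs.norm_sysSol_le) (norm_nonneg _) hD)
  have h2 : ‖totalInt (fun y => osc z y * P.U y) (P.g z)‖ ≤ (∫ y, ‖P.U y‖) * (3 / 2) := by
    refine ((totalInt _).le_opNorm _).trans (mul_le_mul ((norm_totalInt_le hs.intU).trans
      (le_of_eq ?_)) ((_root_.norm_snd_le _).trans hs.norm_sysSol_le) (norm_nonneg _) hU)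
    simp only [norm_mul, norm_osc, one_mul]
  have h3 : ‖(1 : ℂ)‖ ≤ ‖P.alpha z‖ + ‖totalInt P.D (P.m z)‖
      + ‖totalInt (fun y => osc z y * P.U y) (P.g z)‖ := by
    have : (1 : ℂ) = P.alpha z + totalInt P.D (P.m z)
        - totalInt (fun y => osc z y * P.U y) (P.g z) := by simp only [alpha]; ring
    calc ‖(1 : ℂ)‖ = ‖P.alpha z + totalInt P.D (P.m z)
          - totalInt (fun y => osc z y * P.U y) (P.g z)‖ := by rw [← this]
      _ ≤ _ := (norm_sub_le _ _).trans (by gcongr; exact norm_add_le _ _)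
  rw [norm_one] at h3
  have := h.small
  linarith

theorem Good.alpha_ne_zero (h : P.Good M) (z : ℝ) : P.alpha z ≠ 0 := by
  have := h.half_le_norm_alpha z
  intro h0
  rw [h0, norm_zero] at this
  linarith

theorem Good.continuous_sol (h : P.Good M) : Continuous fun z : ℝ =>
    sysSol P.D (fun y => osc z y * P.U y) (fun y => osc (-z) y * P.V y) :=
  continuous_sysSol h.smallSystem continuous_const (continuous_volterra_osc (integrable_U h.niceU))
    ((continuous_volterra_osc (integrable_V h.niceU h.niceV)).comp continuous_neg)

theorem Good.continuous_m (h : P.Good M) : Continuous P.m := h.continuous_sol.fst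

theorem Good.continuous_g (h : P.Good M) : Continuous P.g := h.continuous_sol.snd

theorem Good.continuous_alpha (h : P.Good M) : Continuous P.alpha :=
  (continuous_const.sub (continuous_const.clm_apply h.continuous_m)).add
    ((continuous_totalInt_osc (integrable_U h.niceU)).clm_apply h.continuous_g)

theorem Good.continuous_beta (h : P.Good M) : Continuous P.beta :=
  ((continuous_totalInt_osc h.niceV.integrable).comp continuous_neg).clm_apply h.continuous_m

theorem Good.continuous_rho (h : P.Good M) : Continuous P.rho :=
  h.continuous_beta.div h.continuous_alpha h.alpha_ne_zero

end Pair

/-! ### Oscillating integrals of gauged Jost solutions -/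

/-- An amplitude of an oscillating integral: jointly continuous, bounded by `2`, and of total
variation at most `1` in the variable `x`, uniformly in the spectral parameter `z`. -/
structure Amplitude (w : ℝ → ℝ → ℂ) : Prop where
  continuous : Continuous fun q : ℝ × ℝ => w q.1 q.2
  norm_le : ∀ z x, ‖w z x‖ ≤ 2
  eq_integral : ∃ (w0 : ℂ) (G : ℝ → ℝ → ℂ) (Γ : ℝ → ℝ), ‖w0‖ ≤ 1 ∧ (∀ z, Integrable (G z)) ∧
    (∀ z y, ‖G z y‖ ≤ Γ y) ∧ Measurable Γ ∧ ∫⁻ y, ‖Γ y‖ₑ ≤ 1 ∧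
    ∀ z x, w z x = w0 + ∫ y in Set.Iic x, G z y

/-- The oscillating integral `∫_s e^{2iεzx} F(x) w(z, x) dx`. -/
def oscPair (ε : ℝ) (F : ℝ → ℂ) (w : ℝ → ℝ → ℂ) (s : Set ℝ) (z : ℝ) : ℂ :=
  ∫ x in s, osc (ε * z) x * (F x * w z x)

theorem enorm_osc (z x : ℝ) : ‖osc z x‖ₑ = 1 := by
  rw [← ofReal_norm, norm_osc, ENNReal.ofReal_one]

theorem norm_osc_sub_one_le (h x : ℝ) : ‖osc h x - 1‖ ≤ 2 * ‖h‖ * ‖x‖ := by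
  have := Real.norm_exp_I_mul_ofReal_sub_one_le (x := 2 * h * x)
  rw [mul_comm] at this
  refine this.trans (le_of_eq ?_)
  rw [norm_mul, norm_mul, Real.norm_ofNat]

section
variable {ε : ℝ} {F : ℝ → ℂ} {w : ℝ → ℝ → ℂ} {s : Set ℝ}

theorem Amplitude.continuous_left (hw : Amplitude w) (x : ℝ) : Continuous fun z => w z x :=
  hw.continuous.comp (continuous_id.prodMk continuous_const)

theorem Amplitude.continuous_right (hw : Amplitude w) (z : ℝ) : Continuous (w z) :=
  hw.continuous.comp (continuous_const.prodMk continuous_id)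

theorem continuous_osc_left (ε x : ℝ) : Continuous fun z => osc (ε * z) x := by
  unfold osc; fun_prop

theorem Amplitude.integrableOn (hw : Amplitude w) (hF : IntegrableOn F s) (z c : ℝ) :
    IntegrableOn (fun x => osc c x * (F x * w z x)) s := by
  refine Integrable.bdd_mul (c := 1) ?_ (continuous_osc_right _).aestronglyMeasurable
    (Eventually.of_forall fun x => (norm_osc _ x).le)
  exact Integrable.mul_bdd hF (c := 2) (hw.continuous_right z).aestronglyMeasurable
    (Eventually.of_forall fun x => hw.norm_le z x)

theorem continuous_oscPair (hw : Amplitude w) (hF : IntegrableOn F s) :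
    Continuous (oscPair ε F w s) := by
  refine continuous_of_dominated (bound := fun x => ‖F x‖ * 2)
    (fun z => (hw.integrableOn hF z _).aestronglyMeasurable) (fun z => ?_)
    (hF.norm.mul_const 2) ?_
  · refine Eventually.of_forall fun x => ?_
    rw [norm_mul, norm_osc, one_mul, norm_mul]
    gcongr
    exact hw.norm_le z x
  · refine Eventually.of_forall fun x => ?_
    exact (continuous_osc_left ε x).mul (continuous_const.mul (hw.continuous_left x))

theorem norm_oscPair_le (hw : Amplitude w) (hF : Integrable F) (z : ℝ) :
    ‖oscPair ε F w Set.univ z‖ ≤ 2 * ∫ x, ‖F x‖ := by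
  rw [oscPair, Measure.restrict_univ, ← integral_const_mul]
  refine norm_integral_le_of_norm_le (hF.norm.const_mul 2) (Eventually.of_forall fun x => ?_)
  rw [norm_mul, norm_osc, one_mul, norm_mul, mul_comm]
  gcongr
  exact hw.norm_le z x

/-- Plancherel's theorem for oscillating integrals with amplitudes. -/
theorem eLpNorm_oscPair_le (hε : ε = 1 ∨ ε = -1) (hw : Amplitude w) (hs : MeasurableSet s)
    (hF : IntegrableOn F s) :
    eLpNorm (oscPair ε F w s) 2 volume ≤ 4 * eLpNorm F 2 volume := by
  by_cases h2 : eLpNorm F 2 volume = ⊤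
  · rw [h2, ENNReal.mul_top (by norm_num)]
    exact le_top
  have hFi : Integrable (s.indicator F) := hF.integrable_indicator hs
  have hle : eLpNorm (s.indicator F) 2 volume ≤ eLpNorm F 2 volume := eLpNorm_indicator_le F
  have hF2 : MemLp (s.indicator F) 2 :=
    ⟨hFi.aestronglyMeasurable, hle.trans_lt (lt_top_iff_ne_top.2 h2)⟩
  obtain ⟨w0, G, Γ, h0, hG, hGΓ, hΓ, hΓ1, heq⟩ := hw.eq_integral
  have key : ∀ δ : ℝ, eLpNorm (fun z => ∫ x, osc z x * (s.indicator F x * w (δ * z) x)) 2 volume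
      ≤ 4 * eLpNorm F 2 volume := by
    intro δ
    refine (eLpNorm_osc_amplitude_le hFi hF2 (g := fun x z => w (δ * z) x)
      (G := fun y z => G (δ * z) y) (g0 := fun _ => w0) (c := 1) (c' := 1) (fun x z => heq _ x)
      (fun z => ?_) (fun z => hG _) (fun y z => hGΓ _ y) hΓ hΓ1).trans ?_
    · rw [← ofReal_norm]; exact ENNReal.ofReal_le_one.2 h0
    · rw [show (2 : ℝ≥0∞) * (1 + 1) = 4 by norm_num]
      gcongr
  have hrw : oscPair ε F w s = fun z => ∫ x, osc (ε * z) x * (s.indicator F x * w z x) := by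
    ext z
    rw [oscPair, ← integral_indicator hs]
    refine integral_congr_ae (Eventually.of_forall fun x => ?_)
    by_cases hx : x ∈ s <;> simp [hx]
  rw [hrw]
  rcases hε with rfl | rfl
  · simpa using key 1
  · have := key (-1)
    rw [← eLpNorm_comp_neg] at this
    simpa using this

/-- The increment in the spectral parameter of an oscillating integral: the increment of the
oscillation costs a weight `x`, the increment of the amplitude is handled by Minkowski's
inequality. -/
theorem eLpNorm_oscPair_sub_le (hε : ε = 1 ∨ ε = -1) (hw : Amplitude w) (hs : MeasurableSet s)
    (hFc : Continuous F) (hF : Integrable F) {K S : ℝ≥0∞}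
    (hK : eLpNorm (fun x : ℝ => (x : ℂ) * F x) 2 volume ≤ K) (h : ℝ)
    (hS : ∀ x, eLpNorm (fun z => w (z + h) x - w z x) 2 volume ≤ S) :
    eLpNorm (fun z => oscPair ε F w s (z + h) - oscPair ε F w s z) 2 volume ≤
      (∫⁻ x, ‖F x‖ₑ) * S + 8 * ‖h‖ₑ * K := by
  set F' : ℝ → ℂ := fun x => (osc (ε * h) x - 1) * F x
  have hF'b : ∀ x, ‖F' x‖ ≤ 2 * ‖F x‖ := fun x => by
    rw [norm_mul]
    gcongr
    refine (norm_sub_le _ _).trans ?_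
    rw [norm_osc, norm_one]
    norm_num
  have hF' : Integrable F' := (hF.norm.const_mul 2).mono'
    (((continuous_osc_right _).sub continuous_const).mul hFc).aestronglyMeasurable
    (Eventually.of_forall hF'b)
  have hF'2 : eLpNorm F' 2 volume ≤ 2 * ‖h‖ₑ * K := by
    have : eLpNorm F' 2 volume ≤ ENNReal.ofReal (2 * ‖h‖) *
        eLpNorm (fun x : ℝ => (x : ℂ) * F x) 2 volume := by
      refine eLpNorm_le_mul_eLpNorm_of_ae_le_mul (Eventually.of_forall fun x => ?_) 2
      rw [norm_mul, norm_mul, ← mul_assoc, Complex.norm_real]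
      gcongr
      have := norm_osc_sub_one_le (ε * h) x
      rwa [norm_mul, show ‖ε‖ = 1 by rcases hε with rfl | rfl <;> simp, one_mul] at this
    refine this.trans ?_
    rw [ENNReal.ofReal_mul (by norm_num), ofReal_norm, ENNReal.ofReal_ofNat]
    gcongr
  set f1 : ℝ → ℂ := fun z => ∫ x in s, osc (ε * (z + h)) x * (F x * (w (z + h) x - w z x))
  have hsplit : ∀ z, oscPair ε F w s (z + h) - oscPair ε F w s z = f1 z + oscPair ε F' w s z := by
    intro z
    rw [oscPair, oscPair, oscPair, ← integral_sub (hw.integrableOn hF.integrableOn _ _)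
      (hw.integrableOn hF.integrableOn _ _), ← integral_add _
      (hw.integrableOn hF'.integrableOn _ _)]
    · refine integral_congr_ae (Eventually.of_forall fun x => ?_)
      simp only [F', mul_add, osc_add]
      ring
    · refine ((hw.integrableOn (s := s) hF.integrableOn (z + h) (ε * (z + h))).sub
        (hw.integrableOn (s := s) hF.integrableOn z (ε * (z + h)))).congr
        (Eventually.of_forall fun x => ?_)
      simp only [Pi.sub_apply]
      ring
  have hc2 : Continuous (oscPair ε F' w s) := continuous_oscPair hw hF'.integrableOn
  have hc1 : Continuous f1 := by
    have : f1 = fun z => oscPair ε F w s (z + h) - oscPair ε F w s z - oscPair ε F' w s z := by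
      ext z
      rw [hsplit]
      ring
    rw [this]
    have hc := continuous_oscPair (ε := ε) hw (hF.integrableOn (s := s))
    exact ((hc.comp (continuous_id.add continuous_const)).sub hc).sub hc2
  rw [funext hsplit]
  refine (eLpNorm_add_le hc1.aestronglyMeasurable hc2.aestronglyMeasurable (by norm_num)).trans ?_
  refine add_le_add ?_ ?_
  · refine (eLpNorm_le_of_le_lintegral (μ := volume) (c := fun y => ‖F y‖ₑ)
      (F := fun y z => w (z + h) y - w z y) hFc.measurable.enorm ?_ fun z => ?_).trans ?_
    · have hc : Continuous fun q : ℝ × ℝ => w (q.2 + h) q.1 - w q.2 q.1 :=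
        (hw.continuous.comp (by fun_prop : Continuous fun q : ℝ × ℝ => (q.2 + h, q.1))).sub
          (hw.continuous.comp (by fun_prop : Continuous fun q : ℝ × ℝ => (q.2, q.1)))
      exact hc.measurable.enorm
    · refine (enorm_integral_le_lintegral_enorm _).trans ((setLIntegral_le_lintegral _ _).trans ?_)
      refine lintegral_mono fun x => ?_
      rw [enorm_mul, enorm_osc, one_mul, enorm_mul]
    · rw [← lintegral_mul_const'' _ hFc.measurable.enorm.aemeasurable]
      gcongr with y
      exact hS y
  · refine (eLpNorm_oscPair_le hε hw hs hF'.integrableOn).trans ?_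
    calc 4 * eLpNorm F' 2 volume ≤ 4 * (2 * ‖h‖ₑ * K) := by gcongr
      _ = 8 * ‖h‖ₑ * K := by ring

end

/-- The gauged Jost system `n' = A e^{2izx} p`, `p' = B e^{-2izx} n` with `n → 1`, `p → 0` at
`-∞`, whose off-diagonal coefficients are small in `L¹`. -/
structure GaugeSystem (K : ℝ≥0) (A B : ℝ → ℂ) (n p : ℝ → ℝ → ℂ) : Prop where
  ampN : Amplitude n
  ampP : Amplitude p
  contA : Continuous A
  contB : Continuous B
  intA : Integrable A
  intB : Integrable B
  smallA : ∫⁻ y, ‖A y‖ₑ ≤ 1 / 2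
  smallB : ∫⁻ y, ‖B y‖ₑ ≤ 1 / 2
  normB : eLpNorm B 2 volume ≤ K
  weightA : eLpNorm (fun x : ℝ => (x : ℂ) * A x) 2 volume ≤ K
  weightB : eLpNorm (fun x : ℝ => (x : ℂ) * B x) 2 volume ≤ K
  n_eq : ∀ z x, n z x = 1 + oscPair 1 A p (Set.Iic x) z
  p_eq : ∀ z x, p z x = oscPair (-1) B n (Set.Iic x) z

theorem eLpNorm_comp_add (f : ℝ → ℂ) (h : ℝ) :
    eLpNorm (fun x => f (x + h)) 2 volume = eLpNorm f 2 volume := by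
  have e := (MeasurableEquiv.addRight h).measurableEmbedding.eLpNorm_map_measure (g := f) (p := 2)
    (μ := volume)
  rw [show Measure.map (MeasurableEquiv.addRight h) volume = volume from
    (measurePreserving_add_right (volume : Measure ℝ) h).map_eq] at e
  exact e.symm

/-- Two quantities, each bounded by half of the other plus `c`, are bounded by `2 * c`. -/
theorem le_two_mul_of_le_half_add {S T c : ℝ≥0∞} (hT : T ≠ ⊤) (hS : S ≤ 1 / 2 * T + c)
    (hT' : T ≤ 1 / 2 * S + c) : S ≤ 2 * c ∧ T ≤ 2 * c := by
  by_cases hc : c = ⊤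
  · simp [hc]
  have hS' : S ≠ ⊤ := ne_top_of_le_ne_top (by finiteness) hS
  lift S to ℝ≥0 using hS'
  lift T to ℝ≥0 using hT
  lift c to ℝ≥0 using hc
  rw [show (1 / 2 : ℝ≥0∞) = ((1 / 2 : ℝ≥0) : ℝ≥0∞) by simp] at hS hT'
  norm_cast at *
  simp only [← NNReal.coe_le_coe, NNReal.coe_add, NNReal.coe_mul, NNReal.coe_div, NNReal.coe_ofNat,
    NNReal.coe_one] at *
  constructor <;> linarith

namespace GaugeSystem
variable {K : ℝ≥0} {A B : ℝ → ℂ} {n p : ℝ → ℝ → ℂ}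

theorem eLpNorm_p_le (h : GaugeSystem K A B n p) (x : ℝ) :
    eLpNorm (fun z => p z x) 2 volume ≤ 4 * K := by
  simp only [h.p_eq]
  refine (eLpNorm_oscPair_le (Or.inr rfl) h.ampN measurableSet_Iic h.intB.integrableOn).trans ?_
  gcongr
  exact h.normB

/-- The Jost solutions are Lipschitz continuous in the spectral parameter, as functions with
values in `L²_z`, uniformly in `x`. -/
theorem eLpNorm_sub_le (hs : GaugeSystem K A B n p) (h x : ℝ) :
    eLpNorm (fun z => n (z + h) x - n z x) 2 volume ≤ 16 * K * ‖h‖ₑ ∧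
    eLpNorm (fun z => p (z + h) x - p z x) 2 volume ≤ 16 * K * ‖h‖ₑ := by
  set S : ℝ≥0∞ := ⨆ x, eLpNorm (fun z => n (z + h) x - n z x) 2 volume
  set T : ℝ≥0∞ := ⨆ x, eLpNorm (fun z => p (z + h) x - p z x) 2 volume
  have hSx := le_iSup fun x => eLpNorm (fun z => n (z + h) x - n z x) 2 volume
  have hTx := le_iSup fun x => eLpNorm (fun z => p (z + h) x - p z x) 2 volume
  -- finiteness of one supremum is needed for absorbing it below
  have hT : T ≠ ⊤ := by
    refine ne_top_of_le_ne_top (b := 4 * K + 4 * K) (by finiteness) (iSup_le fun x => ?_)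
    have hc := hs.ampP.continuous_left x
    refine (_root_.MeasureTheory.eLpNorm_sub_le (f := fun z => p (z + h) x)
      (hc.comp (continuous_id.add continuous_const)).aestronglyMeasurable
      hc.aestronglyMeasurable (by norm_num)).trans ?_
    rw [eLpNorm_comp_add fun z => p z x]
    exact add_le_add (hs.eLpNorm_p_le x) (hs.eLpNorm_p_le x)
  have h1 : S ≤ 1 / 2 * T + 8 * ‖h‖ₑ * K := by
    refine iSup_le fun x => ?_
    simp only [hs.n_eq, add_sub_add_left_eq_sub]
    refine (eLpNorm_oscPair_sub_le (Or.inl rfl) hs.ampP measurableSet_Iic hs.contA hs.intA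
      hs.weightA h hTx).trans ?_
    gcongr
    exact hs.smallA
  have h2 : T ≤ 1 / 2 * S + 8 * ‖h‖ₑ * K := by
    refine iSup_le fun x => ?_
    simp only [hs.p_eq]
    refine (eLpNorm_oscPair_sub_le (Or.inr rfl) hs.ampN measurableSet_Iic hs.contB hs.intB
      hs.weightB h hSx).trans ?_
    gcongr
    exact hs.smallB
  have h3 := le_two_mul_of_le_half_add hT h1 h2
  have e : 2 * (8 * ‖h‖ₑ * K) = 16 * K * ‖h‖ₑ := by ring
  rw [e] at h3
  exact ⟨(hSx x).trans h3.1, (hTx x).trans h3.2⟩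

/-- The limit of `n` at `+∞` is Lipschitz continuous in the spectral parameter, with values in
`L²_z`. -/
theorem eLpNorm_limit_sub_le (hs : GaugeSystem K A B n p) (h : ℝ) :
    eLpNorm (fun z => oscPair 1 A p Set.univ (z + h) - oscPair 1 A p Set.univ z) 2 volume ≤
      16 * K * ‖h‖ₑ := by
  refine (eLpNorm_oscPair_sub_le (Or.inl rfl) hs.ampP MeasurableSet.univ hs.contA hs.intA
      hs.weightA h fun x => (hs.eLpNorm_sub_le h x).2).trans ?_
  calc _ ≤ 1 / 2 * (16 * K * ‖h‖ₑ) + 8 * ‖h‖ₑ * K := by gcongr; exact hs.smallA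
    _ = (1 / 2 * 2) * (8 * K * ‖h‖ₑ) + 8 * ‖h‖ₑ * K := by ring
    _ = 16 * K * ‖h‖ₑ := by
      rw [one_div, ENNReal.inv_mul_cancel (by norm_num) (by norm_num)]
      ring

theorem eLpNorm_oscPair_n_sub_le (hs : GaugeSystem K A B n p) {F : ℝ → ℂ} (hFc : Continuous F)
    (hF : Integrable F) {K' L : ℝ≥0} (hL : ∫⁻ x, ‖F x‖ₑ ≤ L)
    (hK : eLpNorm (fun x : ℝ => (x : ℂ) * F x) 2 volume ≤ K') (h : ℝ) :
    eLpNorm (fun z => oscPair (-1) F n Set.univ (z + h) - oscPair (-1) F n Set.univ z) 2 volume ≤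
      (16 * L * K + 8 * K' : ℝ≥0) * ‖h‖ₑ := by
  refine (eLpNorm_oscPair_sub_le (Or.inr rfl) hs.ampN MeasurableSet.univ hFc hF
      hK h fun x => (hs.eLpNorm_sub_le h x).1).trans ?_
  calc _ ≤ L * (16 * K * ‖h‖ₑ) + 8 * ‖h‖ₑ * K' := by gcongr
    _ = _ := by push_cast; ring

/-- Integration by parts: multiplication by the spectral parameter `z` of an oscillating integral
costs one derivative of its density. The boundary terms vanish in the limit, so that the density
may have a derivative which is only square integrable. -/
theorem eLpNorm_mul_oscPair_le (hs : GaugeSystem K A B n p) {F F' : ℝ → ℂ} (hFc : Continuous F)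
    (hF : Integrable F) (hF' : AEStronglyMeasurable F' volume) {K' L : ℝ≥0}
    (hF'2 : eLpNorm F' 2 volume ≤ K') (hFF' : ∀ a b, F b - F a = ∫ x in a..b, F' x)
    (hb : ∀ x, ‖F x‖ ≤ L) (htop : Tendsto F atTop (𝓝 0)) (hbot : Tendsto F atBot (𝓝 0)) :
    eLpNorm (fun z : ℝ => 2 * Complex.I * z * oscPair (-1) F n Set.univ z) 2 volume ≤
      (4 * K' + 2 * L * K : ℝ≥0) := by
  have hm : MemLp F' 2 volume := ⟨hF', hF'2.trans_lt ENNReal.coe_lt_top⟩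
  have hli : LocallyIntegrable F' volume := hm.locallyIntegrable one_le_two
  have hloc : ∀ a b, IntervalIntegrable F' volume a b := fun a b =>
    (hli.integrableOn_isCompact isCompact_uIcc).intervalIntegrable
  have hn : ∀ z x, HasDerivAt (n z) (osc z x * (A x * p z x)) x := by
    intro z x
    have hc : Continuous fun x => osc z x * (A x * p z x) :=
      (continuous_osc_right z).mul (hs.contA.mul (hs.ampP.continuous_right z))
    have hi : Integrable fun x => osc z x * (A x * p z x) :=
      integrableOn_univ.1 (hs.ampP.integrableOn hs.intA.integrableOn z z)
    have := (hasDerivAt_integral_Iic hi hc x).const_add 1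
    refine this.congr_of_eventuallyEq (Eventually.of_forall fun y => ?_)
    simp only [hs.n_eq, oscPair, one_mul]
  -- the identity on a bounded interval
  have hparts : ∀ (N : ℕ) (z : ℝ), 2 * Complex.I * z * oscPair (-1) F n (Set.Ioc (-N) N) z
      + (osc (-z) N * (F N * n z N) - osc (-z) (-N) * (F (-N) * n z (-N)))
      = oscPair (-1) F' n (Set.Ioc (-N) N) z + ∫ x in Set.Ioc (-N : ℝ) N, F x * A x * p z x := by
    intro N z
    have hN : (-N : ℝ) ≤ N := by linarith [N.cast_nonneg (α := ℝ)]
    have hg : ∀ x, HasDerivAt (fun x => osc (-z) x * n z x)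
        (-(2 * Complex.I * z) * (osc (-z) x * n z x) + A x * p z x) x := by
      intro x
      refine ((hasDerivAt_osc (-z) x).mul (hn z x)).congr_deriv ?_
      push_cast
      linear_combination (A x * p z x) * osc_mul_osc_neg z x
    have hcg : Continuous fun x => osc (-z) x * n z x :=
      (continuous_osc_right _).mul (hs.ampN.continuous_right z)
    have hcA : Continuous fun x => A x * p z x := hs.contA.mul (hs.ampP.continuous_right z)
    have key := integral_primitive_mul_deriv hN (hloc _ _) (fun x => hFF' _ x) hg
      ((continuous_const.mul hcg).add hcA)
    have e1 : ∫ x in (-N : ℝ)..N, F x * (-(2 * Complex.I * z) * (osc (-z) x * n z x) + A x * p z x)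
        = -(2 * Complex.I * z) * oscPair (-1) F n (Set.Ioc (-N) N) z
          + ∫ x in Set.Ioc (-N : ℝ) N, F x * A x * p z x := by
      rw [oscPair, ← intervalIntegral.integral_of_le hN, ← intervalIntegral.integral_of_le hN,
        ← intervalIntegral.integral_const_mul, ← intervalIntegral.integral_add]
      · refine intervalIntegral.integral_congr fun x _ => ?_
        simp only [neg_one_mul]
        ring
      · refine Continuous.intervalIntegrable ?_ _ _
        exact continuous_const.mul ((continuous_osc_right _).mul
          (hFc.mul (hs.ampN.continuous_right z)))
      · exact ((hFc.mul hs.contA).mul (hs.ampP.continuous_right z)).intervalIntegrable _ _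
    have e2 : ∫ x in (-N : ℝ)..N, F' x * (osc (-z) x * n z x)
        = oscPair (-1) F' n (Set.Ioc (-N) N) z := by
      rw [oscPair, ← intervalIntegral.integral_of_le hN]
      refine intervalIntegral.integral_congr fun x _ => ?_
      simp only [neg_one_mul]
      ring
    rw [e1, e2] at key
    linear_combination -key
  have hlim : ∀ z, Tendsto (fun N : ℕ => 2 * Complex.I * z * oscPair (-1) F n (Set.Ioc (-N) N) z
      + (osc (-z) N * (F N * n z N) - osc (-z) (-N) * (F (-N) * n z (-N)))) atTop
      (𝓝 (2 * Complex.I * z * oscPair (-1) F n Set.univ z)) := by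
    intro z
    have hcast : Tendsto (fun N : ℕ => (N : ℝ)) atTop atTop := tendsto_natCast_atTop_atTop
    have hneg : Tendsto (fun N : ℕ => (-N : ℝ)) atTop atBot := tendsto_neg_atTop_atBot.comp hcast
    have hbd : ∀ {l : ℕ → ℝ}, Tendsto (fun N => F (l N)) atTop (𝓝 0) →
        Tendsto (fun N => osc (-z) (l N) * (F (l N) * n z (l N))) atTop (𝓝 0) := by
      intro l hl
      refine squeeze_zero_norm (a := fun N => ‖F (l N)‖ * 2) (fun N => ?_)
        (by simpa using hl.norm.mul_const 2)
      rw [norm_mul, norm_osc, one_mul, norm_mul]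
      gcongr
      exact hs.ampN.norm_le z _
    have h1 : Tendsto (fun N : ℕ => oscPair (-1) F n (Set.Ioc (-N) N) z) atTop
        (𝓝 (oscPair (-1) F n Set.univ z)) := by
      have hi := integrableOn_univ.1 (hs.ampN.integrableOn hF.integrableOn z (-1 * z))
      have := intervalIntegral_tendsto_integral hi hneg hcast
      rw [oscPair, Measure.restrict_univ]
      refine this.congr fun N => ?_
      rw [oscPair, intervalIntegral.integral_of_le (by linarith [N.cast_nonneg (α := ℝ)])]
    have := (h1.const_mul (2 * Complex.I * z)).add
      ((hbd (htop.comp hcast)).sub (hbd (hbot.comp hneg)))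
    simpa using this
  have hcF' : ∀ N : ℕ, Continuous (oscPair (-1) F' n (Set.Ioc (-N : ℝ) N)) := fun N =>
    continuous_oscPair hs.ampN ((hloc _ _).1)
  have hcI : ∀ N : ℕ, Continuous fun z => ∫ x in Set.Ioc (-N : ℝ) N, F x * A x * p z x := by
    intro N
    simp only [← intervalIntegral.integral_of_le
      (show (-N : ℝ) ≤ N by linarith [N.cast_nonneg (α := ℝ)])]
    refine intervalIntegral.continuous_parametric_intervalIntegral_of_continuous' ?_ _ _
    exact ((hFc.mul hs.contA).comp continuous_snd).mul hs.ampP.continuous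
  refine Lp.eLpNorm_le_of_ae_tendsto (u := atTop) (Eventually.of_forall fun N : ℕ => ?_)
    (fun N => ?_) (Eventually.of_forall fun z => hlim z)
  · simp only [hparts]
    refine (eLpNorm_add_le (hcF' N).aestronglyMeasurable (hcI N).aestronglyMeasurable
      (by norm_num)).trans ?_
    push_cast
    refine add_le_add ?_ ?_
    · refine (eLpNorm_oscPair_le (Or.inr rfl) hs.ampN measurableSet_Ioc (hloc _ _).1).trans ?_
      gcongr
    · refine (eLpNorm_le_of_le_lintegral (μ := volume) (c := fun y => ‖F y * A y‖ₑ)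
        (F := fun y z => p z y) (hFc.mul hs.contA).measurable.enorm
        (hs.ampP.continuous.comp continuous_swap).measurable.enorm fun z => ?_).trans ?_
      · refine (enorm_integral_le_lintegral_enorm _).trans
          ((setLIntegral_le_lintegral _ _).trans ?_)
        refine lintegral_mono fun x => ?_
        rw [enorm_mul]
      · calc ∫⁻ y, ‖F y * A y‖ₑ * eLpNorm (fun z => p z y) 2 volume
            ≤ ∫⁻ y, (L * (4 * K)) * ‖A y‖ₑ := by
              refine lintegral_mono fun y => ?_
              have h1 : ‖F y‖ₑ ≤ L := by
                rw [← ofReal_norm, ← ENNReal.ofReal_coe_nnreal]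
                exact ENNReal.ofReal_le_ofReal (hb y)
              rw [enorm_mul]
              calc _ ≤ L * ‖A y‖ₑ * (4 * K) := by gcongr; exact hs.eLpNorm_p_le y
                _ = _ := by ring
          _ = (L * (4 * K)) * ∫⁻ y, ‖A y‖ₑ := by
              rw [lintegral_const_mul _ hs.contA.measurable.enorm]
          _ ≤ (L * (4 * K)) * (1 / 2) := by gcongr; exact hs.smallA
          _ = 2 * L * K * (2 * (1 / 2)) := by ring
          _ = 2 * L * K := by
              rw [one_div, ENNReal.mul_inv_cancel (by norm_num) (by norm_num), mul_one]
  · simp only [hparts]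
    exact ((hcF' N).add (hcI N)).aestronglyMeasurable

end GaugeSystem

/-- Quotients by a function that is bounded below inherit `L²` bounds and `L²` moduli of
continuity. -/
theorem eLpNorm_div_sub_le {a b : ℝ → ℂ} (ha : Continuous a) (hb : Continuous b) {L C₁ C₂ : ℝ≥0}
    (haL : ∀ z, ‖a z‖ ≤ L) (hb4 : ∀ z, 1 / 4 ≤ ‖b z‖) {h : ℝ}
    (h1 : eLpNorm (fun z => a (z + h) - a z) 2 volume ≤ C₁ * ‖h‖ₑ)
    (h2 : eLpNorm (fun z => b (z + h) - b z) 2 volume ≤ C₂ * ‖h‖ₑ) :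
    eLpNorm (fun z => a (z + h) / b (z + h) - a z / b z) 2 volume ≤
      (4 * C₁ + 16 * L * C₂ : ℝ≥0) * ‖h‖ₑ := by
  have hb0 : ∀ z, b z ≠ 0 := fun z hz => by
    have := hb4 z
    rw [hz, norm_zero] at this
    norm_num at this
  have hbinv : ∀ z, ‖(b z)⁻¹‖ ≤ 4 := fun z => by
    rw [norm_inv]
    exact inv_le_of_inv_le₀ (by norm_num) (by simpa using hb4 z)
  have e : ∀ z, a (z + h) / b (z + h) - a z / b z = (a (z + h) - a z) * (b (z + h))⁻¹
      + -(a z * (b z)⁻¹ * (b (z + h))⁻¹ * (b (z + h) - b z)) := by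
    intro z
    field_simp [hb0 z, hb0 (z + h)]
    ring
  have hc : Continuous fun z : ℝ => z + h := by fun_prop
  have hc1 : Continuous fun z => (a (z + h) - a z) * (b (z + h))⁻¹ :=
    ((ha.comp hc).sub ha).mul ((hb.comp hc).inv₀ fun z => hb0 _)
  have hc2 : Continuous fun z => -(a z * (b z)⁻¹ * (b (z + h))⁻¹ * (b (z + h) - b z)) :=
    (((ha.mul (hb.inv₀ hb0)).mul ((hb.comp hc).inv₀ fun z => hb0 _)).mul
      ((hb.comp hc).sub hb)).neg
  rw [funext e]
  refine (eLpNorm_add_le hc1.aestronglyMeasurable hc2.aestronglyMeasurable (by norm_num)).trans ?_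
  have t1 : eLpNorm (fun z => (a (z + h) - a z) * (b (z + h))⁻¹) 2 volume ≤
      ENNReal.ofReal 4 * (C₁ * ‖h‖ₑ) := by
    refine (eLpNorm_le_mul_eLpNorm_of_ae_le_mul (c := 4) (Eventually.of_forall fun z => ?_) 2).trans
      (by gcongr)
    rw [norm_mul, mul_comm]
    gcongr
    exact hbinv _
  have t2 : eLpNorm (fun z => -(a z * (b z)⁻¹ * (b (z + h))⁻¹ * (b (z + h) - b z))) 2 volume ≤
      ENNReal.ofReal (16 * L) * (C₂ * ‖h‖ₑ) := by
    refine (eLpNorm_le_mul_eLpNorm_of_ae_le_mul (c := 16 * L)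
      (Eventually.of_forall fun z => ?_) 2).trans (by gcongr)
    rw [norm_neg, norm_mul, norm_mul, norm_mul]
    have : ‖a z‖ * ‖(b z)⁻¹‖ * ‖(b (z + h))⁻¹‖ ≤ L * 4 * 4 := by
      gcongr
      · exact haL z
      · exact hbinv _
      · exact hbinv _
    refine (mul_le_mul_of_nonneg_right this (norm_nonneg _)).trans (le_of_eq (by ring))
  refine (add_le_add t1 t2).trans (le_of_eq ?_)
  rw [ENNReal.ofReal_mul (by norm_num)]
  simp
  ring

/-! ### The gauge transformation of a pair of potentials -/

/-- The product of the primitive of a locally integrable function and a `C¹` function. -/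
theorem mul_sub_mul_eq_integral {f f' g g' : ℝ → ℂ} (hf' : ∀ a b, IntervalIntegrable f' volume a b)
    (hf : ∀ a b, f b - f a = ∫ y in a..b, f' y) (hfc : Continuous f)
    (hg : ∀ x, HasDerivAt g (g' x) x) (hg' : Continuous g') (a b : ℝ) :
    f b * g b - f a * g a = ∫ x in a..b, (f' x * g x + f x * g' x) := by
  have hgc : Continuous g := continuous_iff_continuousAt.2 fun x => (hg x).continuousAt
  have key : ∀ a b, a ≤ b → f b * g b - f a * g a = ∫ x in a..b, (f' x * g x + f x * g' x) := by
    intro a b hab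
    rw [intervalIntegral.integral_add (g := fun x => f x * g' x)
      ((hf' a b).mul_continuousOn hgc.continuousOn) ((hfc.mul hg').intervalIntegrable _ _),
      integral_primitive_mul_deriv hab (hf' a b) (fun x => hf a x) hg hg']
    ring
  rcases le_total a b with hab | hab
  · exact key a b hab
  · rw [intervalIntegral.integral_symm, ← key b a hab]
    ring

theorem eLpNorm_le_of_norm_le_add {E₁ E₂ E₃ : Type*} [NormedAddCommGroup E₁]
    [NormedAddCommGroup E₂] [NormedAddCommGroup E₃] {F : ℝ → E₁} {f : ℝ → E₂} {g : ℝ → E₃}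
    (hf : AEStronglyMeasurable f volume) (hg : AEStronglyMeasurable g volume) {a b : ℝ≥0}
    {K L : ℝ≥0∞} (h : ∀ x, ‖F x‖ ≤ a * ‖f x‖ + b * ‖g x‖) (hK : eLpNorm f 2 volume ≤ K)
    (hL : eLpNorm g 2 volume ≤ L) :
    eLpNorm F 2 volume ≤ a * K + b * L := by
  refine (eLpNorm_mono_real (g := (fun x => a * ‖f x‖) + fun x => b * ‖g x‖) h).trans ?_
  refine (eLpNorm_add_le (hf.norm.const_mul _) (hg.norm.const_mul _) (by norm_num)).trans ?_
  refine add_le_add ?_ ?_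
  · rw [show (fun x => (a : ℝ) * ‖f x‖) = (a : ℝ) • fun x => ‖f x‖ from rfl, eLpNorm_const_smul,
      eLpNorm_norm]
    gcongr
    simp
  · rw [show (fun x => (b : ℝ) * ‖g x‖) = (b : ℝ) • fun x => ‖g x‖ from rfl, eLpNorm_const_smul,
      eLpNorm_norm]
    gcongr
    simp

/-- A Sobolev bound for the first derivative. -/
theorem NiceFun.norm_deriv_le {M : ℝ≥0} {u u1 u2 : ℝ → ℂ} (h : NiceFun M u u1 u2) (x : ℝ) :
    ‖u1 x‖ ≤ 4 * M := by
  rcases le_or_gt 1 |x| with hx | hx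
  · have h1 := h.sqrt_abs_mul_norm_deriv_le x
    have h2 : 1 ≤ √|x| := Real.one_le_sqrt.2 hx
    have h3 : 1 * ‖u1 x‖ ≤ √|x| * ‖u1 x‖ := by gcongr
    have : (0 : ℝ) ≤ M := M.2
    linarith
  · have h2 := h.sqrt_abs_mul_norm_deriv_le 2
    have h3 : 1 * ‖u1 2‖ ≤ √|(2 : ℝ)| * ‖u1 2‖ := by
      gcongr
      exact Real.one_le_sqrt.2 (by norm_num)
    have h4 : ‖∫ y in x..2, u2 y‖ₑ ≤ M * 2 := by
      rw [intervalIntegral.integral_of_le (by linarith [(abs_lt.1 hx).2])]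
      refine (enorm_integral_le_lintegral_enorm _).trans ?_
      rw [← eLpNorm_one_eq_lintegral_enorm]
      refine (eLpNorm_one_le_sqrt_measure h.aesm).trans ?_
      gcongr
      · exact (eLpNorm_mono_measure _ Measure.restrict_le_self).trans h.norm2
      · rw [Real.volume_Ioc]
        calc ENNReal.ofReal (2 - x) ^ (1 / 2 : ℝ) ≤ (4 : ℝ≥0∞) ^ (1 / 2 : ℝ) := by
              gcongr
              rw [← ENNReal.ofReal_ofNat]
              exact ENNReal.ofReal_le_ofReal (by linarith [(abs_lt.1 hx).1])
          _ = 2 := by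
              rw [show (4 : ℝ≥0∞) = 2 ^ (2 : ℝ) by norm_num, ← ENNReal.rpow_mul]
              norm_num
    have h5 : ‖∫ y in x..2, u2 y‖ ≤ M * 2 := by
      have := ENNReal.toReal_mono (by finiteness) h4
      simpa using this
    have h6 : u1 x = u1 2 - ∫ y in x..2, u2 y := by rw [← h.sub_eq]; ring
    rw [h6]
    refine (norm_sub_le _ _).trans ?_
    linarith

namespace Pair
variable {P : Pair} {M : ℝ≥0}

/-- The gauge factor `exp ∫_{-∞}^x uv/2i` removing the diagonal coefficients. -/
def gauge (P : Pair) (x : ℝ) : ℂ := Complex.exp (∫ y in Set.Iic x, P.D y)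

/-- The limit of the gauge factor at `+∞`. -/
def gaugeTop (P : Pair) : ℂ := Complex.exp (∫ y, P.D y)

theorem gauge_ne_zero (P : Pair) (x : ℝ) : P.gauge x ≠ 0 := Complex.exp_ne_zero _

theorem gaugeTop_ne_zero (P : Pair) : P.gaugeTop ≠ 0 := Complex.exp_ne_zero _

/-- The gauged first Jost component. -/
def gn (P : Pair) (z x : ℝ) : ℂ := P.gauge x * P.m z x

/-- The gauged second Jost component. -/
def gp (P : Pair) (z x : ℝ) : ℂ := (P.gauge x)⁻¹ * P.g z x

/-- The gauged upper right coefficient. -/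
def gA (P : Pair) (x : ℝ) : ℂ := P.U x * P.gauge x ^ 2

/-- The gauged lower left coefficient. -/
def gB (P : Pair) (x : ℝ) : ℂ := P.V x * ((P.gauge x)⁻¹) ^ 2

theorem Good.integral_D_le (h : P.Good M) : ∫ y, ‖P.D y‖ ≤ 3 / 20 := by
  have h1 := h.small
  have h2 : 0 ≤ ∫ y, ‖P.U y‖ := integral_nonneg fun _ => norm_nonneg _
  have h3 : 0 ≤ ∫ y, ‖P.V y‖ := integral_nonneg fun _ => norm_nonneg _
  linarith

theorem norm_exp_le {w : ℂ} (hw : ‖w‖ ≤ 3 / 20) : ‖Complex.exp w‖ ≤ 5 / 4 := by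
  refine (Complex.norm_exp_le_exp_norm w).trans ?_
  refine (Real.exp_le_exp.2 hw).trans ?_
  refine (Real.exp_bound_div_one_sub_of_interval (by norm_num) (by norm_num)).trans ?_
  norm_num

theorem Good.norm_gauge_le (h : P.Good M) (x : ℝ) :
    ‖P.gauge x‖ ≤ 5 / 4 ∧ ‖(P.gauge x)⁻¹‖ ≤ 5 / 4 := by
  have h1 : ‖∫ y in Set.Iic x, P.D y‖ ≤ 3 / 20 :=
    (norm_integral_le_integral_norm _).trans ((setIntegral_le_integral
      (integrable_D h.niceU h.niceV).norm (Eventually.of_forall fun _ => norm_nonneg _)).trans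
      h.integral_D_le)
  refine ⟨norm_exp_le h1, ?_⟩
  rw [gauge, ← Complex.exp_neg]
  exact norm_exp_le (by rwa [norm_neg])

theorem Good.norm_gaugeTop_le (h : P.Good M) :
    ‖P.gaugeTop‖ ≤ 5 / 4 ∧ ‖(P.gaugeTop)⁻¹‖ ≤ 5 / 4 := by
  have h1 : ‖∫ y, P.D y‖ ≤ 3 / 20 := (norm_integral_le_integral_norm _).trans h.integral_D_le
  refine ⟨norm_exp_le h1, ?_⟩
  rw [gaugeTop, ← Complex.exp_neg]
  exact norm_exp_le (by rwa [norm_neg])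

theorem Good.hasDerivAt_gauge (h : P.Good M) (x : ℝ) :
    HasDerivAt P.gauge (P.D x * P.gauge x) x := by
  have := (hasDerivAt_integral_Iic (integrable_D h.niceU h.niceV)
    (continuous_D h.niceU h.niceV) x).cexp
  rw [mul_comm]
  exact this

theorem Good.continuous_gauge (h : P.Good M) : Continuous P.gauge :=
  continuous_iff_continuousAt.2 fun x => (h.hasDerivAt_gauge x).continuousAt

theorem Good.continuous_gauge_inv (h : P.Good M) : Continuous fun x => (P.gauge x)⁻¹ :=
  h.continuous_gauge.inv₀ P.gauge_ne_zero

theorem Good.hasDerivAt_gauge_inv (h : P.Good M) (x : ℝ) :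
    HasDerivAt (fun x => (P.gauge x)⁻¹) (-(P.D x * (P.gauge x)⁻¹)) x := by
  refine ((h.hasDerivAt_gauge x).inv (P.gauge_ne_zero x)).congr_deriv ?_
  field_simp [P.gauge_ne_zero x]

theorem tendsto_gauge_atBot (P : Pair) : Tendsto P.gauge atBot (𝓝 1) := by
  have := (Complex.continuous_exp.tendsto 0).comp (tendsto_integral_Iic_atBot (f := P.D))
  rwa [Complex.exp_zero] at this

theorem Good.tendsto_gauge_atTop (h : P.Good M) : Tendsto P.gauge atTop (𝓝 P.gaugeTop) :=
  (Complex.continuous_exp.tendsto _).comp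
    (tendsto_integral_Iic_atTop (integrable_D h.niceU h.niceV))

theorem Good.norm_gn_le (h : P.Good M) (z x : ℝ) : ‖P.gn z x‖ ≤ 2 := by
  rw [gn, norm_mul]
  have h1 := (h.norm_gauge_le x).1
  have h2 := h.norm_m_le z x
  nlinarith [norm_nonneg (P.gauge x), norm_nonneg (P.m z x)]

theorem Good.norm_gp_le (h : P.Good M) (z x : ℝ) : ‖P.gp z x‖ ≤ 2 := by
  rw [gp, norm_mul]
  have h1 := (h.norm_gauge_le x).2
  have h2 := h.norm_g_le z x
  nlinarith [norm_nonneg (P.gauge x)⁻¹, norm_nonneg (P.g z x)]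

/-- The constant is `(5/4)²`; with the smallness `3/10` it gives an `L¹` norm below `1/2`. -/
theorem Good.norm_gA_le (h : P.Good M) (x : ℝ) : ‖P.gA x‖ ≤ 25 / 16 * ‖P.U x‖ := by
  rw [gA, norm_mul, norm_pow, mul_comm]
  gcongr
  calc ‖P.gauge x‖ ^ 2 ≤ (5 / 4) ^ 2 := by gcongr; exact (h.norm_gauge_le x).1
    _ = 25 / 16 := by norm_num

theorem Good.norm_gB_le (h : P.Good M) (x : ℝ) : ‖P.gB x‖ ≤ 25 / 16 * ‖P.V x‖ := by
  rw [gB, norm_mul, norm_pow, mul_comm]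
  gcongr
  calc ‖(P.gauge x)⁻¹‖ ^ 2 ≤ (5 / 4) ^ 2 := by gcongr; exact (h.norm_gauge_le x).2
    _ = 25 / 16 := by norm_num

theorem Good.continuous_gA (h : P.Good M) : Continuous P.gA :=
  (continuous_U h.niceU).mul (h.continuous_gauge.pow 2)

theorem Good.continuous_gB (h : P.Good M) : Continuous P.gB :=
  (continuous_V h.niceU h.niceV).mul (h.continuous_gauge_inv.pow 2)

theorem Good.integrable_gA (h : P.Good M) : Integrable P.gA :=
  ((integrable_U h.niceU).norm.const_mul _).mono' h.continuous_gA.aestronglyMeasurable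
    (Eventually.of_forall h.norm_gA_le)

theorem Good.integrable_gB (h : P.Good M) : Integrable P.gB :=
  ((integrable_V h.niceU h.niceV).norm.const_mul _).mono' h.continuous_gB.aestronglyMeasurable
    (Eventually.of_forall h.norm_gB_le)

theorem lintegral_le_half {f F : ℝ → ℂ} (hF : Integrable F) (hf : Integrable f)
    (h : ∀ x, ‖F x‖ ≤ 25 / 16 * ‖f x‖) (h1 : ∫ x, ‖f x‖ ≤ 3 / 10) :
    ∫⁻ y, ‖F y‖ₑ ≤ 1 / 2 := by
  rw [← ofReal_integral_norm_eq_lintegral_enorm hF]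
  have h2 : ∫ y, ‖F y‖ ≤ 25 / 16 * ∫ y, ‖f y‖ := by
    rw [← integral_const_mul]
    exact integral_mono hF.norm (hf.norm.const_mul _) h
  calc ENNReal.ofReal (∫ y, ‖F y‖) ≤ ENNReal.ofReal (1 / 2) :=
        ENNReal.ofReal_le_ofReal (by linarith)
    _ = 1 / 2 := by rw [ENNReal.ofReal_div_of_pos (by norm_num)]; simp

theorem Good.lintegral_gA_le (h : P.Good M) : ∫⁻ y, ‖P.gA y‖ₑ ≤ 1 / 2 := by
  refine lintegral_le_half h.integrable_gA (integrable_U h.niceU) h.norm_gA_le ?_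
  have h1 := h.small
  have h2 : 0 ≤ ∫ y, ‖P.D y‖ := integral_nonneg fun _ => norm_nonneg _
  have h3 : 0 ≤ ∫ y, ‖P.V y‖ := integral_nonneg fun _ => norm_nonneg _
  linarith

theorem Good.lintegral_gB_le (h : P.Good M) : ∫⁻ y, ‖P.gB y‖ₑ ≤ 1 / 2 := by
  refine lintegral_le_half h.integrable_gB (integrable_V h.niceU h.niceV) h.norm_gB_le ?_
  have h1 := h.small
  have h2 : 0 ≤ ∫ y, ‖P.D y‖ := integral_nonneg fun _ => norm_nonneg _
  have h3 : 0 ≤ ∫ y, ‖P.U y‖ := integral_nonneg fun _ => norm_nonneg _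
  linarith

/-- Joint continuity, from the continuity of the Jost solution as a function of `z` with values in
the bounded continuous functions. -/
theorem continuous_gn (h : P.Good M) : Continuous fun q : ℝ × ℝ => P.gn q.1 q.2 :=
  (h.continuous_gauge.comp continuous_snd).mul (continuous_eval.comp
    ((h.continuous_m.comp continuous_fst).prodMk continuous_snd))

theorem continuous_gp (h : P.Good M) : Continuous fun q : ℝ × ℝ => P.gp q.1 q.2 :=
  (h.continuous_gauge_inv.comp continuous_snd).mul (continuous_eval.comp
    ((h.continuous_g.comp continuous_fst).prodMk continuous_snd))

theorem integrable_osc_mul_of_norm_le {F w : ℝ → ℂ} (hF : Integrable F) (hw : Continuous w)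
    (hb : ∀ x, ‖w x‖ ≤ 2) (z : ℝ) : Integrable fun x => osc z x * (F x * w x) :=
  integrable_osc_mul (hF.mul_bdd (c := 2) hw.aestronglyMeasurable (Eventually.of_forall hb)) z

theorem Good.integrable_osc_gA (h : P.Good M) (z : ℝ) :
    Integrable fun x => osc z x * (P.gA x * P.gp z x) :=
  integrable_osc_mul_of_norm_le h.integrable_gA
    (h.continuous_gauge_inv.mul (P.g z).continuous) (h.norm_gp_le z) z

theorem Good.integrable_osc_gB (h : P.Good M) (z : ℝ) :
    Integrable fun x => osc (-z) x * (P.gB x * P.gn z x) :=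
  integrable_osc_mul_of_norm_le h.integrable_gB
    (h.continuous_gauge.mul (P.m z).continuous) (h.norm_gn_le z) _

theorem Good.gn_eq (h : P.Good M) (z x : ℝ) :
    P.gn z x = 1 + ∫ y in Set.Iic x, osc z y * (P.gA y * P.gp z y) := by
  have hd : ∀ y, HasDerivAt (P.gn z) (osc z y * (P.gA y * P.gp z y)) y := by
    intro y
    refine ((h.hasDerivAt_gauge y).mul (h.hasDerivAt_m' z y)).congr_deriv ?_
    simp only [gA, gp, dm]
    field_simp [P.gauge_ne_zero y]
    ring
  have hbot : Tendsto (P.gn z) atBot (𝓝 1) := by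
    have := P.tendsto_gauge_atBot.mul (h.tendsto_m_atBot z)
    rwa [mul_one] at this
  rw [integral_Iic_of_hasDerivAt_of_tendsto (hd x).continuousAt.continuousWithinAt
    (fun y _ => hd y) (h.integrable_osc_gA z).integrableOn hbot]
  ring

theorem Good.gp_eq (h : P.Good M) (z x : ℝ) :
    P.gp z x = ∫ y in Set.Iic x, osc (-z) y * (P.gB y * P.gn z y) := by
  have hd : ∀ y, HasDerivAt (P.gp z) (osc (-z) y * (P.gB y * P.gn z y)) y := by
    intro y
    refine ((h.hasDerivAt_gauge_inv y).mul (h.hasDerivAt_g z y)).congr_deriv ?_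
    simp only [gB, gn, dg]
    field_simp [P.gauge_ne_zero y]
    ring
  have hbot : Tendsto (P.gp z) atBot (𝓝 0) := by
    have := (P.tendsto_gauge_atBot.inv₀ one_ne_zero).mul (h.tendsto_g_atBot z)
    rwa [mul_zero] at this
  rw [integral_Iic_of_hasDerivAt_of_tendsto (hd x).continuousAt.continuousWithinAt
    (fun y _ => hd y) (h.integrable_osc_gB z).integrableOn hbot]
  ring

theorem lintegral_two_mul_norm_le {F : ℝ → ℂ} (hFc : Continuous F) (h : ∫⁻ y, ‖F y‖ₑ ≤ 1 / 2) :
    ∫⁻ y, ‖(2 * ‖F y‖ : ℝ)‖ₑ ≤ 1 := by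
  have e : ∀ y, ‖(2 * ‖F y‖ : ℝ)‖ₑ = 2 * ‖F y‖ₑ := fun y => by
    rw [enorm_mul, enorm_norm]
    congr 1
    simp [enorm_eq_nnnorm]
  simp_rw [e]
  rw [lintegral_const_mul _ hFc.measurable.enorm]
  calc 2 * ∫⁻ y, ‖F y‖ₑ ≤ 2 * (1 / 2) := by gcongr
    _ = 1 := by rw [one_div, ENNReal.mul_inv_cancel (by norm_num) (by norm_num)]

theorem Good.amplitude_gn (h : P.Good M) : Amplitude P.gn where
  continuous := continuous_gn h
  norm_le := h.norm_gn_le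
  eq_integral := by
    refine ⟨1, fun z y => osc z y * (P.gA y * P.gp z y), fun y => 2 * ‖P.gA y‖, by simp,
      h.integrable_osc_gA, fun z y => ?_, (h.continuous_gA.norm.const_mul 2).measurable,
      lintegral_two_mul_norm_le h.continuous_gA h.lintegral_gA_le, h.gn_eq⟩
    simp only [norm_mul, norm_osc, one_mul]
    rw [mul_comm]
    gcongr
    exact h.norm_gp_le z y

theorem Good.amplitude_gp (h : P.Good M) : Amplitude P.gp where
  continuous := continuous_gp h
  norm_le := h.norm_gp_le
  eq_integral := by
    refine ⟨0, fun z y => osc (-z) y * (P.gB y * P.gn z y), fun y => 2 * ‖P.gB y‖, by simp,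
      h.integrable_osc_gB, fun z y => ?_, (h.continuous_gB.norm.const_mul 2).measurable,
      lintegral_two_mul_norm_le h.continuous_gB h.lintegral_gB_le, fun z x => ?_⟩
    · simp only [norm_mul, norm_osc, one_mul]
      rw [mul_comm]
      gcongr
      exact h.norm_gn_le z y
    · rw [zero_add, h.gp_eq]

theorem norm_U (P : Pair) (x : ℝ) : ‖P.U x‖ = ‖P.u x‖ / 2 := by simp [U]

theorem Good.norm_V_le (h : P.Good M) (x : ℝ) : ‖P.V x‖ ≤ ‖P.v1 x‖ + 2 * M ^ 2 * ‖P.u x‖ := by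
  have hv := h.niceV.norm_le x
  have e : P.V x = P.v1 x - P.u x * P.v x ^ 2 / (2 * Complex.I) := by
    rw [V]
    field_simp
  rw [e]
  refine (norm_sub_le _ _).trans ?_
  have : ‖P.u x * P.v x ^ 2 / (2 * Complex.I)‖ ≤ ‖P.u x‖ * (2 * M) ^ 2 / 2 := by
    rw [norm_div, norm_mul, norm_pow, norm_mul, Complex.norm_I, mul_one, Complex.norm_ofNat]
    gcongr
  linarith

theorem Good.norm_gA_le' (h : P.Good M) (x : ℝ) : ‖P.gA x‖ ≤ ‖P.u x‖ := by
  have := h.norm_gA_le x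
  rw [norm_U] at this
  linarith [norm_nonneg (P.u x)]

theorem Good.norm_gB_le' (h : P.Good M) (x : ℝ) :
    ‖P.gB x‖ ≤ (2 : ℝ≥0) * ‖P.v1 x‖ + (4 * M ^ 2 : ℝ≥0) * ‖P.u x‖ := by
  have h1 := h.norm_gB_le x
  have h2 := h.norm_V_le x
  push_cast
  nlinarith [norm_nonneg (P.v1 x), norm_nonneg (P.u x), norm_nonneg (P.V x), sq_nonneg (M : ℝ),
    mul_nonneg (sq_nonneg (M : ℝ)) (norm_nonneg (P.u x))]

/-- The bound for the gauged coefficients in terms of the potentials. -/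
def gaugeBound (M : ℝ≥0) : ℝ≥0 := 3 * M + 4 * M ^ 3

theorem Good.gaugeSystem (h : P.Good M) : GaugeSystem (gaugeBound M) P.gA P.gB P.gn P.gp where
  ampN := h.amplitude_gn
  ampP := h.amplitude_gp
  contA := h.continuous_gA
  contB := h.continuous_gB
  intA := h.integrable_gA
  intB := h.integrable_gB
  smallA := h.lintegral_gA_le
  smallB := h.lintegral_gB_le
  normB := by
    refine (eLpNorm_le_of_norm_le_add h.niceV.memLp_deriv.1 h.niceU.memLp.1 h.norm_gB_le'
      ((eLpNorm_le_bracket _).trans h.niceV.norm1)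
      ((eLpNorm_le_bracket _).trans h.niceU.norm0)).trans ?_
    norm_cast
    rw [gaugeBound, ← NNReal.coe_le_coe]
    push_cast
    nlinarith [M.coe_nonneg, pow_nonneg M.coe_nonneg 3]
  weightA := by
    refine (eLpNorm_mono (g := fun x => bracket x • P.u x) fun x => ?_).trans
      (h.niceU.norm0.trans ?_)
    · rw [norm_mul, norm_smul, Complex.norm_real, Real.norm_of_nonneg (bracket_pos x).le]
      exact mul_le_mul (abs_le_bracket x) (h.norm_gA_le' x) (norm_nonneg _) (bracket_pos x).le
    · norm_cast
      rw [gaugeBound, ← NNReal.coe_le_coe]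
      push_cast
      nlinarith [M.coe_nonneg, pow_nonneg M.coe_nonneg 3]
  weightB := by
    refine (eLpNorm_le_of_norm_le_add (a := 2) (b := 4 * M ^ 2)
      (f := fun x => bracket x • P.v1 x) (g := fun x => bracket x • P.u x)
      (continuous_bracket.smul h.niceV.continuous_deriv).aestronglyMeasurable
      (continuous_bracket.smul h.niceU.continuous).aestronglyMeasurable (fun x => ?_)
      h.niceV.norm1 h.niceU.norm0).trans ?_
    · rw [norm_mul, norm_smul, norm_smul, Complex.norm_real,
        Real.norm_of_nonneg (bracket_pos x).le]
      calc _ ≤ bracket x * ((2 : ℝ≥0) * ‖P.v1 x‖ + (4 * M ^ 2 : ℝ≥0) * ‖P.u x‖) := by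
            exact mul_le_mul (abs_le_bracket x) (h.norm_gB_le' x) (norm_nonneg _)
              (bracket_pos x).le
        _ = _ := by ring
    · norm_cast
      rw [gaugeBound, ← NNReal.coe_le_coe]
      push_cast
      nlinarith [M.coe_nonneg, pow_nonneg M.coe_nonneg 3]
  n_eq z x := by simpa only [oscPair, one_mul] using h.gn_eq z x
  p_eq z x := by simpa only [oscPair, neg_one_mul] using h.gp_eq z x

end Pair

/-! ### Bounds for the reflection coefficient -/

/-- `r` is bounded by `C` in `L²` together with `z r` and `z² r`, and the translations act on `r`
and on `z r` with Lipschitz constant `C` in `L²`; hence `r` and `z r` lie in `H¹`. -/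
structure DataBound (C : ℝ≥0) (r : ℝ → ℂ) : Prop where
  norm0 : eLpNorm r 2 volume ≤ C
  norm1 : eLpNorm (fun z : ℝ => (z : ℂ) * r z) 2 volume ≤ C
  norm2 : eLpNorm (fun z : ℝ => (z : ℂ) ^ 2 * r z) 2 volume ≤ C
  diff0 : ∀ h : ℝ, eLpNorm (fun z => r (z + h) - r z) 2 volume ≤ C * ‖h‖ₑ
  diff1 : ∀ h : ℝ,
    eLpNorm (fun z : ℝ => ((z + h : ℝ) : ℂ) * r (z + h) - z * r z) 2 volume ≤ C * ‖h‖ₑ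

namespace Pair
variable {P : Pair} {M : ℝ≥0}

/-- The limit at `+∞` of the first gauged Jost component. -/
def gnTop (P : Pair) (z : ℝ) : ℂ := 1 + oscPair 1 P.gA P.gp Set.univ z

theorem Good.gnTop_eq (h : P.Good M) (z : ℝ) : P.gnTop z = P.gaugeTop * P.alpha z := by
  have h1 : Tendsto (P.gn z) atTop (𝓝 (P.gaugeTop * P.alpha z)) :=
    h.tendsto_gauge_atTop.mul (h.tendsto_m_atTop z)
  have h2 : Tendsto (P.gn z) atTop (𝓝 (P.gnTop z)) := by
    rw [funext (h.gn_eq z), gnTop, oscPair, Measure.restrict_univ]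
    simp only [one_mul]
    exact (tendsto_integral_Iic_atTop (h.integrable_osc_gA z)).const_add 1
  exact tendsto_nhds_unique h2 h1

theorem Good.oscPair_gB_eq (h : P.Good M) (z : ℝ) :
    oscPair (-1) P.gB P.gn Set.univ z = P.gaugeTop⁻¹ * (2 * Complex.I * z * P.beta z) := by
  have h1 : Tendsto (P.gp z) atTop (𝓝 (P.gaugeTop⁻¹ * (2 * Complex.I * z * P.beta z))) :=
    (h.tendsto_gauge_atTop.inv₀ P.gaugeTop_ne_zero).mul (h.tendsto_g_atTop z)
  have h2 : Tendsto (P.gp z) atTop (𝓝 (oscPair (-1) P.gB P.gn Set.univ z)) := by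
    rw [funext (h.gp_eq z), oscPair, Measure.restrict_univ]
    simp only [neg_one_mul]
    exact tendsto_integral_Iic_atTop (h.integrable_osc_gB z)
  exact tendsto_nhds_unique h2 h1

theorem Good.continuous_gnTop (h : P.Good M) : Continuous P.gnTop :=
  continuous_const.add (continuous_oscPair h.amplitude_gp h.integrable_gA.integrableOn)

theorem Good.quarter_le_norm_gnTop (h : P.Good M) (z : ℝ) : 1 / 4 ≤ ‖P.gnTop z‖ := by
  rw [h.gnTop_eq, norm_mul]
  have h1 := h.half_le_norm_alpha z
  have h2 : 4 / 5 ≤ ‖P.gaugeTop‖ := by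
    have := h.norm_gaugeTop_le.2
    rw [norm_inv] at this
    have h3 := inv_le_of_inv_le₀ (norm_pos_iff.2 P.gaugeTop_ne_zero) this
    norm_num at h3
    linarith
  nlinarith

theorem oscPair_const_mul (c : ℂ) (F : ℝ → ℂ) (w : ℝ → ℝ → ℂ) (ε : ℝ) (s : Set ℝ) (z : ℝ) :
    oscPair ε (fun x => c * F x) w s z = c * oscPair ε F w s z := by
  rw [oscPair, oscPair, ← integral_const_mul]
  congr 1 with x
  ring

/-- The density whose oscillating integral is the numerator of the reflection coefficient. -/
def density (P : Pair) (x : ℝ) : ℂ := P.gaugeTop * (P.v x * (P.gauge x)⁻¹)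

/-- The density whose oscillating integral is the numerator of the reflection coefficient,
multiplied by the spectral parameter. -/
def density' (P : Pair) (x : ℝ) : ℂ := P.gaugeTop ^ 2 * P.gB x

/-- The gauge turns `ρ` into a quotient of oscillating integrals. -/
theorem Good.rho_eq (h : P.Good M) (z : ℝ) :
    P.rho z = oscPair (-1) P.density P.gn Set.univ z / P.gnTop z := by
  have e : oscPair (-1) P.density P.gn Set.univ z = P.gaugeTop * P.beta z := by
    unfold density
    rw [oscPair_const_mul, h.beta_eq, oscPair, Measure.restrict_univ]
    congr 2 with x
    rw [gn, neg_one_mul]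
    field_simp [P.gauge_ne_zero x]
  rw [e, h.gnTop_eq, rho, mul_div_mul_left _ _ P.gaugeTop_ne_zero]

/-- One factor `z` is absorbed by the equation for the second component. -/
theorem Good.mul_rho_eq (h : P.Good M) (z : ℝ) :
    2 * Complex.I * z * P.rho z = oscPair (-1) P.density' P.gn Set.univ z / P.gnTop z := by
  have e : oscPair (-1) P.density' P.gn Set.univ z
      = P.gaugeTop * (2 * Complex.I * z * P.beta z) := by
    unfold density'
    rw [oscPair_const_mul, h.oscPair_gB_eq]
    field_simp [P.gaugeTop_ne_zero]
  rw [e, h.gnTop_eq, rho, mul_div_mul_left _ _ P.gaugeTop_ne_zero, mul_div_assoc]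

theorem Good.eLpNorm_div_gnTop_le (h : P.Good M) (f : ℝ → ℂ) :
    eLpNorm (fun z => f z / P.gnTop z) 2 volume ≤ 4 * eLpNorm f 2 volume := by
  have := eLpNorm_le_mul_eLpNorm_of_ae_le_mul (c := 4) (f := fun z => f z / P.gnTop z) (g := f)
    (μ := volume) (Eventually.of_forall fun z => ?_) 2
  · simpa using this
  · have h4 := h.quarter_le_norm_gnTop z
    rw [norm_div, div_le_iff₀ (by linarith)]
    nlinarith [norm_nonneg (f z)]

/-- `L²` bound and modulus of continuity of the quotient of an oscillating integral by the limit of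
the first gauged Jost component. -/
theorem Good.eLpNorm_oscPair_div_le (h : P.Good M) {F : ℝ → ℂ} (hFc : Continuous F)
    (hF : Integrable F) {K L : ℝ≥0} (hL : ∫⁻ x, ‖F x‖ₑ ≤ L) (hK : eLpNorm F 2 volume ≤ K)
    (hxK : eLpNorm (fun x : ℝ => (x : ℂ) * F x) 2 volume ≤ K) :
    eLpNorm (fun z => oscPair (-1) F P.gn Set.univ z / P.gnTop z) 2 volume ≤ (16 * K : ℝ≥0) ∧
    ∀ t : ℝ, eLpNorm (fun z => oscPair (-1) F P.gn Set.univ (z + t) / P.gnTop (z + t)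
      - oscPair (-1) F P.gn Set.univ z / P.gnTop z) 2 volume ≤
      (4 * (16 * L * gaugeBound M + 8 * K) + 16 * (2 * L) * (16 * gaugeBound M) : ℝ≥0) * ‖t‖ₑ := by
  constructor
  · refine (h.eLpNorm_div_gnTop_le _).trans ?_
    refine (mul_le_mul_right (eLpNorm_oscPair_le (Or.inr rfl) h.amplitude_gn MeasurableSet.univ
      hF.integrableOn) 4).trans ?_
    calc 4 * (4 * eLpNorm F 2 volume) ≤ 4 * (4 * K) := by gcongr
      _ = _ := by push_cast; ring
  · intro t
    refine eLpNorm_div_sub_le (continuous_oscPair h.amplitude_gn hF.integrableOn)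
      h.continuous_gnTop (fun z => ?_) h.quarter_le_norm_gnTop
      (h.gaugeSystem.eLpNorm_oscPair_n_sub_le hFc hF hL hxK t) ?_
    · refine (norm_oscPair_le h.amplitude_gn hF z).trans ?_
      push_cast
      gcongr
      rw [integral_norm_eq_lintegral_enorm hF.1]
      simpa using ENNReal.toReal_mono (by finiteness) hL
    · simp only [gnTop, add_sub_add_left_eq_sub]
      exact h.gaugeSystem.eLpNorm_limit_sub_le t

theorem Good.norm_density_le (h : P.Good M) (x : ℝ) : ‖P.density x‖ ≤ 2 * ‖P.v x‖ := by
  rw [density, norm_mul, norm_mul]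
  have h1 := h.norm_gaugeTop_le.1
  have h2 := (h.norm_gauge_le x).2
  calc _ ≤ 5 / 4 * (‖P.v x‖ * (5 / 4)) := by gcongr
    _ ≤ _ := by linarith [norm_nonneg (P.v x)]

theorem Good.norm_density'_le (h : P.Good M) (x : ℝ) : ‖P.density' x‖ ≤ 2 * ‖P.gB x‖ := by
  rw [density', norm_mul, norm_pow]
  have h1 := h.norm_gaugeTop_le.1
  calc _ ≤ (5 / 4) ^ 2 * ‖P.gB x‖ := by gcongr
    _ ≤ _ := by nlinarith [norm_nonneg (P.gB x)]

theorem lintegral_le_two_mul {F f : ℝ → ℂ} (h : ∀ x, ‖F x‖ ≤ 2 * ‖f x‖) (hf : Continuous f) :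
    ∫⁻ x, ‖F x‖ₑ ≤ 2 * ∫⁻ x, ‖f x‖ₑ := by
  rw [← lintegral_const_mul _ hf.measurable.enorm]
  refine lintegral_mono fun x => ?_
  have := ENNReal.ofReal_le_ofReal (h x)
  rwa [ENNReal.ofReal_mul (by norm_num), ofReal_norm, ofReal_norm, ENNReal.ofReal_ofNat] at this

theorem eLpNorm_le_two_mul {F f : ℝ → ℂ} (h : ∀ x, ‖F x‖ ≤ 2 * ‖f x‖) :
    eLpNorm F 2 volume ≤ 2 * eLpNorm f 2 volume := by
  have := eLpNorm_le_mul_eLpNorm_of_ae_le_mul (μ := volume) (Eventually.of_forall h) 2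
  simpa using this

theorem norm_mul_le_two_mul {F f : ℝ → ℂ} (h : ∀ x, ‖F x‖ ≤ 2 * ‖f x‖) (x : ℝ) :
    ‖(x : ℂ) * F x‖ ≤ 2 * ‖(x : ℂ) * f x‖ := by
  rw [norm_mul, norm_mul]
  nlinarith [h x, norm_nonneg (x : ℂ)]

theorem Good.continuous_density (h : P.Good M) : Continuous P.density :=
  continuous_const.mul (h.niceV.continuous.mul h.continuous_gauge_inv)

theorem Good.continuous_density' (h : P.Good M) : Continuous P.density' :=
  continuous_const.mul h.continuous_gB

theorem Good.integrable_density (h : P.Good M) : Integrable P.density :=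
  (h.niceV.integrable.norm.const_mul 2).mono' h.continuous_density.aestronglyMeasurable
    (Eventually.of_forall h.norm_density_le)

theorem Good.integrable_density' (h : P.Good M) : Integrable P.density' :=
  h.integrable_gB.const_mul _

theorem Good.density_bounds (h : P.Good M) : ∫⁻ x, ‖P.density x‖ₑ ≤ (4 * M : ℝ≥0) ∧
    eLpNorm P.density 2 volume ≤ (2 * M : ℝ≥0) ∧
    eLpNorm (fun x : ℝ => (x : ℂ) * P.density x) 2 volume ≤ (2 * M : ℝ≥0) := by
  refine ⟨(lintegral_le_two_mul h.norm_density_le h.niceV.continuous).trans ?_,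
    (eLpNorm_le_two_mul h.norm_density_le).trans ?_,
    (eLpNorm_le_two_mul (norm_mul_le_two_mul h.norm_density_le)).trans ?_⟩
  · calc 2 * ∫⁻ x, ‖P.v x‖ₑ ≤ 2 * (2 * M) := by gcongr; exact h.niceV.lintegral_le
      _ = _ := by push_cast; ring
  · push_cast
    gcongr
    exact (eLpNorm_le_bracket _).trans h.niceV.norm0
  · push_cast
    gcongr
    exact (eLpNorm_mul_le_bracket _).trans h.niceV.norm0

theorem Good.density'_bounds (h : P.Good M) : ∫⁻ x, ‖P.density' x‖ₑ ≤ (1 : ℝ≥0) ∧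
    eLpNorm P.density' 2 volume ≤ (2 * gaugeBound M : ℝ≥0) ∧
    eLpNorm (fun x : ℝ => (x : ℂ) * P.density' x) 2 volume ≤ (2 * gaugeBound M : ℝ≥0) := by
  refine ⟨(lintegral_le_two_mul h.norm_density'_le h.continuous_gB).trans ?_,
    (eLpNorm_le_two_mul h.norm_density'_le).trans ?_,
    (eLpNorm_le_two_mul (norm_mul_le_two_mul h.norm_density'_le)).trans ?_⟩
  · calc 2 * ∫⁻ x, ‖P.gB x‖ₑ ≤ 2 * (1 / 2) := by gcongr; exact h.lintegral_gB_le
      _ = 1 := by rw [one_div, ENNReal.mul_inv_cancel (by norm_num) (by norm_num)]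
  · push_cast
    gcongr
    exact h.gaugeSystem.normB
  · push_cast
    gcongr
    exact h.gaugeSystem.weightB

/-- The weak derivative of `density'`. -/
def densityDeriv (P : Pair) (x : ℝ) : ℂ :=
  P.gaugeTop ^ 2 * (((P.v2 x - (P.u1 x * P.v x ^ 2 + 2 * P.u x * P.v x * P.v1 x) / (2 * Complex.I))
    - 2 * P.D x * P.V x) * ((P.gauge x)⁻¹) ^ 2)

theorem V_eq (P : Pair) (x : ℝ) : P.V x = P.v1 x - P.u x * P.v x ^ 2 / (2 * Complex.I) := by
  rw [V]
  field_simp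

theorem Good.density'_sub_eq (h : P.Good M) (a b : ℝ) :
    P.density' b - P.density' a = ∫ x in a..b, P.densityDeriv x := by
  have hw : ∀ x, HasDerivAt (fun x => P.u x * P.v x ^ 2 / (2 * Complex.I))
      ((P.u1 x * P.v x ^ 2 + 2 * P.u x * P.v x * P.v1 x) / (2 * Complex.I)) x := by
    intro x
    refine (((h.niceU.hasDerivAt x).mul ((h.niceV.hasDerivAt x).pow 2)).div_const _).congr_deriv ?_
    simp
    ring
  have hwc : Continuous fun x =>
      (P.u1 x * P.v x ^ 2 + 2 * P.u x * P.v x * P.v1 x) / (2 * Complex.I) := by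
    have := h.niceU.continuous
    have := h.niceV.continuous
    have := h.niceU.continuous_deriv
    have := h.niceV.continuous_deriv
    fun_prop
  have hg : ∀ x, HasDerivAt (fun x => ((P.gauge x)⁻¹) ^ 2) (-2 * P.D x * ((P.gauge x)⁻¹) ^ 2) x := by
    intro x
    refine ((h.hasDerivAt_gauge_inv x).pow 2).congr_deriv ?_
    simp
    ring
  have hgc : Continuous fun x => -2 * P.D x * ((P.gauge x)⁻¹) ^ 2 :=
    (continuous_const.mul (continuous_D h.niceU h.niceV)).mul (h.continuous_gauge_inv.pow 2)
  have hli : LocallyIntegrable P.v2 volume := h.niceV.memLp_deriv2.locallyIntegrable one_le_two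
  have hiv : ∀ a b, IntervalIntegrable P.v2 volume a b := fun a b =>
    (hli.integrableOn_isCompact isCompact_uIcc).intervalIntegrable
  have hV : ∀ a b, P.V b - P.V a = ∫ y in a..b, (P.v2 y -
      (P.u1 y * P.v y ^ 2 + 2 * P.u y * P.v y * P.v1 y) / (2 * Complex.I)) := by
    intro a b
    rw [intervalIntegral.integral_sub (hiv a b) (hwc.intervalIntegrable _ _),
      intervalIntegral.integral_eq_sub_of_hasDerivAt (fun x _ => hw x) (hwc.intervalIntegrable _ _),
      ← h.niceV.sub_eq, V_eq, V_eq]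
    ring
  have key := mul_sub_mul_eq_integral (fun a b => (hiv a b).sub (hwc.intervalIntegrable a b)) hV
    (continuous_V h.niceU h.niceV) hg hgc a b
  calc _ = P.gaugeTop ^ 2 * (P.V b * ((P.gauge b)⁻¹) ^ 2 - P.V a * ((P.gauge a)⁻¹) ^ 2) := by
        simp only [density', gB]; ring
    _ = _ := by
        rw [key, ← intervalIntegral.integral_const_mul]
        refine intervalIntegral.integral_congr fun x _ => ?_
        simp only [densityDeriv]
        ring

theorem Good.aestronglyMeasurable_densityDeriv (h : P.Good M) :
    AEStronglyMeasurable P.densityDeriv volume := by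
  have h1 := h.niceU.continuous
  have h2 := h.niceV.continuous
  have h3 := h.niceU.continuous_deriv
  have h4 := h.niceV.continuous_deriv
  have h5 := continuous_D h.niceU h.niceV
  have h6 := continuous_V h.niceU h.niceV
  refine AEStronglyMeasurable.const_mul ?_ _
  refine AEStronglyMeasurable.mul ?_ (h.continuous_gauge_inv.pow 2).aestronglyMeasurable
  refine (h.niceV.aesm.sub ?_).sub ?_
  · exact (by fun_prop : Continuous fun x => (P.u1 x * P.v x ^ 2 + 2 * P.u x * P.v x * P.v1 x) /
      (2 * Complex.I)).aestronglyMeasurable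
  · exact ((continuous_const.mul h5).mul h6).aestronglyMeasurable

theorem Good.norm_D_le (h : P.Good M) (x : ℝ) : ‖P.D x‖ ≤ 2 * M ^ 2 := by
  rw [D, norm_div, norm_mul, norm_mul, Complex.norm_I, mul_one, Complex.norm_ofNat]
  have h1 := h.niceU.norm_le x
  have h2 := h.niceV.norm_le x
  calc _ ≤ (2 * (M : ℝ)) * (2 * M) / 2 := by gcongr
    _ = _ := by ring

theorem Good.norm_densityDeriv_le (h : P.Good M) (x : ℝ) :
    ‖P.densityDeriv x‖ ≤ 4 * (‖P.v2 x‖ + 2 * M ^ 2 * ‖P.u1 x‖ + 8 * M ^ 2 * ‖P.v1 x‖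
      + 8 * M ^ 4 * ‖P.u x‖) := by
  have hu := h.niceU.norm_le x
  have hv := h.niceV.norm_le x
  have hM := M.coe_nonneg
  have e1 : ‖(P.u1 x * P.v x ^ 2 + 2 * P.u x * P.v x * P.v1 x) / (2 * Complex.I)‖
      ≤ 2 * M ^ 2 * ‖P.u1 x‖ + 4 * M ^ 2 * ‖P.v1 x‖ := by
    rw [norm_div, norm_mul (2 : ℂ), Complex.norm_I, mul_one, Complex.norm_ofNat,
      div_le_iff₀ (by norm_num)]
    refine (norm_add_le _ _).trans ?_
    rw [norm_mul, norm_pow, norm_mul, norm_mul, norm_mul, Complex.norm_ofNat]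
    calc _ ≤ ‖P.u1 x‖ * (2 * M) ^ 2 + 2 * (2 * M) * (2 * M) * ‖P.v1 x‖ := by gcongr
      _ = _ := by ring
  have e2 : ‖2 * P.D x * P.V x‖ ≤ 4 * M ^ 2 * ‖P.v1 x‖ + 8 * M ^ 4 * ‖P.u x‖ := by
    rw [norm_mul, norm_mul, Complex.norm_ofNat]
    calc _ ≤ 2 * (2 * M ^ 2) * (‖P.v1 x‖ + 2 * M ^ 2 * ‖P.u x‖) := by
          gcongr
          · exact h.norm_D_le x
          · exact h.norm_V_le x
      _ = _ := by ring
  rw [densityDeriv, norm_mul, norm_mul, norm_pow, norm_pow]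
  have h1 := h.norm_gaugeTop_le.1
  have h2 := (h.norm_gauge_le x).2
  calc _ ≤ (5 / 4) ^ 2 * ((‖P.v2 x‖ + (2 * M ^ 2 * ‖P.u1 x‖ + 4 * M ^ 2 * ‖P.v1 x‖) +
          (4 * M ^ 2 * ‖P.v1 x‖ + 8 * M ^ 4 * ‖P.u x‖)) * (5 / 4) ^ 2) := by
        gcongr
        exact (norm_sub_le _ _).trans (add_le_add ((norm_sub_le _ _).trans
          (add_le_add le_rfl e1)) e2)
    _ = 625 / 256 * (‖P.v2 x‖ + 2 * M ^ 2 * ‖P.u1 x‖ + 8 * M ^ 2 * ‖P.v1 x‖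
      + 8 * M ^ 4 * ‖P.u x‖) := by ring
    _ ≤ _ := by gcongr; norm_num

theorem Good.eLpNorm_densityDeriv_le (h : P.Good M) :
    eLpNorm P.densityDeriv 2 volume ≤ (4 * M + 40 * M ^ 3 + 32 * M ^ 5 : ℝ≥0) := by
  have h0 := (eLpNorm_le_bracket _).trans h.niceU.norm0
  have h1 := (eLpNorm_le_bracket _).trans h.niceU.norm1
  have h2 := (eLpNorm_le_bracket _).trans h.niceV.norm1
  have m0 := h.niceU.memLp.1
  have m1 := h.niceU.memLp_deriv.1
  have m2 := h.niceV.memLp_deriv.1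
  have m3 := h.niceV.aesm
  have s1 := eLpNorm_le_of_norm_le_add (F := fun x => ‖P.v2 x‖ + 2 * M ^ 2 * ‖P.u1 x‖) (a := 1)
    (b := 2 * M ^ 2) m3 m1 (fun x => by
      rw [Real.norm_of_nonneg (by positivity)]; push_cast; linarith) h.niceV.norm2 h1
  have s2 := eLpNorm_le_of_norm_le_add (F := fun x => 8 * M ^ 2 * ‖P.v1 x‖ + 8 * M ^ 4 * ‖P.u x‖)
    (a := 8 * M ^ 2) (b := 8 * M ^ 4) m2 m0 (fun x => by
      rw [Real.norm_of_nonneg (by positivity)]; push_cast; linarith) h2 h0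
  have s3 := eLpNorm_le_of_norm_le_add (F := P.densityDeriv) (a := 4) (b := 4)
    (f := fun x => ‖P.v2 x‖ + 2 * M ^ 2 * ‖P.u1 x‖)
    (g := fun x => 8 * M ^ 2 * ‖P.v1 x‖ + 8 * M ^ 4 * ‖P.u x‖)
    (m3.norm.add (m1.norm.const_mul _)) ((m2.norm.const_mul _).add (m0.norm.const_mul _))
    (fun x => by
      rw [Real.norm_of_nonneg (by positivity), Real.norm_of_nonneg (by positivity)]
      refine (h.norm_densityDeriv_le x).trans (le_of_eq ?_)
      push_cast
      ring) s1 s2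
  refine s3.trans (le_of_eq ?_)
  push_cast
  ring

theorem Good.norm_density'_le_const (h : P.Good M) (x : ℝ) :
    ‖P.density' x‖ ≤ (16 * M + 16 * M ^ 3 : ℝ≥0) := by
  have h1 := h.norm_density'_le x
  have h2 := h.norm_gB_le' x
  have h3 := h.niceV.norm_deriv_le x
  have h4 := h.niceU.norm_le x
  push_cast at h2 ⊢
  have h5 : 4 * (M : ℝ) ^ 2 * ‖P.u x‖ ≤ 4 * M ^ 2 * (2 * M) := by gcongr
  nlinarith

theorem _root_.NDNLS.NiceFun.tendsto_deriv {u u1 u2 : ℝ → ℂ} (h : NiceFun M u u1 u2) {l : Filter ℝ}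
    (hl : Tendsto (fun x => |x|) l atTop) : Tendsto u1 l (𝓝 0) := by
  have h1 : Tendsto (fun x => 2 * (M : ℝ) * (√|x|)⁻¹) l (𝓝 0) := by
    simpa using ((Real.tendsto_sqrt_atTop.comp hl).inv_tendsto_atTop).const_mul (2 * (M : ℝ))
  refine squeeze_zero_norm' ?_ h1
  filter_upwards [hl.eventually_gt_atTop 0] with x hx
  rw [← div_eq_mul_inv, le_div_iff₀ (Real.sqrt_pos.2 hx), mul_comm]
  exact h.sqrt_abs_mul_norm_deriv_le x

theorem Good.tendsto_density' (h : P.Good M) {l : Filter ℝ}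
    (hl : Tendsto (fun x => |x|) l atTop) (hu : Tendsto P.u l (𝓝 0)) :
    Tendsto P.density' l (𝓝 0) := by
  have h1 : Tendsto (fun x => 2 * (2 * ‖P.v1 x‖ + 4 * (M : ℝ) ^ 2 * ‖P.u x‖)) l (𝓝 0) := by
    simpa using ((((h.niceV.tendsto_deriv hl).norm.const_mul 2).add
      (hu.norm.const_mul (4 * (M : ℝ) ^ 2))).const_mul 2)
  refine squeeze_zero_norm (fun x => (h.norm_density'_le x).trans ?_) h1
  gcongr
  simpa using h.norm_gB_le' x

/-- The reflection coefficient is bounded in the norms that control `r_±`, uniformly on bounded sets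
of potentials. -/
theorem exists_dataBound (M : ℝ≥0) : ∃ C : ℝ≥0, ∀ P : Pair, P.Good M → DataBound C P.rho := by
  -- `Cⱼ` bounds `zʲ ρ`, and `Dⱼ` the difference quotients of `zʲ ρ`
  set C₀ : ℝ≥0 := 16 * (2 * M)
  set D₀ : ℝ≥0 := 4 * (16 * (4 * M) * gaugeBound M + 8 * (2 * M)) +
    16 * (2 * (4 * M)) * (16 * gaugeBound M)
  set C₁ : ℝ≥0 := 16 * (2 * gaugeBound M)
  set D₁ : ℝ≥0 := 4 * (16 * 1 * gaugeBound M + 8 * (2 * gaugeBound M)) +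
    16 * (2 * 1) * (16 * gaugeBound M)
  set C₂ : ℝ≥0 := 4 * (4 * (4 * M + 40 * M ^ 3 + 32 * M ^ 5) +
    2 * (16 * M + 16 * M ^ 3) * gaugeBound M)
  refine ⟨C₀ + D₀ + C₁ + D₁ + C₂, fun P h => ?_⟩
  have hle : ∀ {f g : ℝ → ℂ} {C : ℝ≥0}, (∀ z, ‖f z‖ ≤ ‖g z‖) → eLpNorm g 2 volume ≤ C →
    C ≤ C₀ + D₀ + C₁ + D₁ + C₂ → eLpNorm f 2 volume ≤ (C₀ + D₀ + C₁ + D₁ + C₂ : ℝ≥0) :=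
    fun hfg hg hC => (eLpNorm_mono hfg).trans (hg.trans (by exact_mod_cast hC))
  have hle' : ∀ {f g : ℝ → ℂ} {C : ℝ≥0} {t : ℝ}, (∀ z, ‖f z‖ ≤ ‖g z‖) →
    eLpNorm g 2 volume ≤ C * ‖t‖ₑ → C ≤ C₀ + D₀ + C₁ + D₁ + C₂ →
      eLpNorm f 2 volume ≤ (C₀ + D₀ + C₁ + D₁ + C₂ : ℝ≥0) * ‖t‖ₑ :=
    fun hfg hg hC => (eLpNorm_mono hfg).trans (hg.trans (mul_le_mul_left (by exact_mod_cast hC) _))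
  have b0 := h.eLpNorm_oscPair_div_le h.continuous_density h.integrable_density
    h.density_bounds.1 h.density_bounds.2.1 h.density_bounds.2.2
  have b1 := h.eLpNorm_oscPair_div_le h.continuous_density' h.integrable_density'
    h.density'_bounds.1 h.density'_bounds.2.1 h.density'_bounds.2.2
  have b2 := (h.eLpNorm_div_gnTop_le _).trans (mul_le_mul_right
    (h.gaugeSystem.eLpNorm_mul_oscPair_le h.continuous_density' h.integrable_density'
    h.aestronglyMeasurable_densityDeriv h.eLpNorm_densityDeriv_le h.density'_sub_eq
    h.norm_density'_le_const (h.tendsto_density' tendsto_abs_atTop_atTop h.niceU.tendsto_atTop)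
    (h.tendsto_density' tendsto_abs_atBot_atTop h.niceU.tendsto_atBot)) 4)
  simp only [← h.rho_eq] at b0
  simp only [← h.mul_rho_eq] at b1
  have e2 : ∀ z : ℝ, 2 * Complex.I * z * oscPair (-1) P.density' P.gn Set.univ z / P.gnTop z
      = 2 * Complex.I * z * (2 * Complex.I * z * P.rho z) := fun z => by
    rw [h.mul_rho_eq, mul_div_assoc]
  simp only [e2] at b2
  have hI : ∀ w : ℂ, ‖w‖ ≤ ‖2 * Complex.I * w‖ := fun w => by
    rw [norm_mul, norm_mul, Complex.norm_I, Complex.norm_ofNat]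
    linarith [norm_nonneg w]
  refine ⟨hle (fun _ => le_rfl) b0.1 ?_, hle (fun z => ?_) b1.1 ?_, hle (fun z => ?_)
    (b2.trans_eq (by push_cast; rfl)) (C := C₂) ?_, fun t => hle' (fun _ => le_rfl) (b0.2 t) ?_,
    fun t => hle' (fun z => ?_) (b1.2 t) ?_⟩
  · calc C₀ ≤ C₀ + (D₀ + C₁ + D₁ + C₂) := le_self_add
      _ = _ := by ring
  · rw [mul_assoc]
    exact hI _
  · calc C₁ ≤ C₁ + (C₀ + D₀ + D₁ + C₂) := le_self_add
      _ = _ := by ring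
  · have e : 2 * Complex.I * z * (2 * Complex.I * z * P.rho z)
        = 2 * Complex.I * (2 * Complex.I * ((z : ℂ) ^ 2 * P.rho z)) := by ring
    rw [e]
    exact (hI _).trans (hI _)
  · exact le_add_self
  · calc D₀ ≤ D₀ + (C₀ + C₁ + D₁ + C₂) := le_self_add
      _ = _ := by ring
  · have e : 2 * Complex.I * ((z + t : ℝ) : ℂ) * P.rho (z + t) - 2 * Complex.I * z * P.rho z
        = 2 * Complex.I * (((z + t : ℝ) : ℂ) * P.rho (z + t) - z * P.rho z) := by ring
    rw [e]
    exact hI _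
  · calc D₁ ≤ D₁ + (C₀ + D₀ + C₁ + C₂) := le_self_add
      _ = _ := by ring

end Pair

/-! ### Lipschitz dependence on the potentials -/

/-- A family of integrable functions depending on a complex parameter as a cubic polynomial. -/
def CubicFamily (q : ℂ → ℝ → ℂ) : Prop :=
  ∃ q0 q1 q2 q3 : ℝ → ℂ, Integrable q0 ∧ Integrable q1 ∧ Integrable q2 ∧ Integrable q3 ∧
    ∀ l, q l = q0 + (l • q1 + (l ^ 2 • q2 + l ^ 3 • q3))

theorem CubicFamily.osc_mul {q : ℂ → ℝ → ℂ} (h : CubicFamily q) (z : ℝ) :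
    CubicFamily fun l y => osc z y * q l y := by
  obtain ⟨q0, q1, q2, q3, h0, h1, h2, h3, hq⟩ := h
  refine ⟨fun y => osc z y * q0 y, fun y => osc z y * q1 y, fun y => osc z y * q2 y,
    fun y => osc z y * q3 y, integrable_osc_mul h0 z, integrable_osc_mul h1 z,
    integrable_osc_mul h2 z, integrable_osc_mul h3 z, fun l => ?_⟩
  ext y
  simp only [hq, Pi.add_apply, Pi.smul_apply, smul_eq_mul]
  ring

theorem differentiable_cubic {E : Type*} [NormedAddCommGroup E] [NormedSpace ℂ E] (a b c d : E) :
    Differentiable ℂ fun l : ℂ => a + (l • b + (l ^ 2 • c + l ^ 3 • d)) := by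
  fun_prop

theorem CubicFamily.differentiable_volterra {q : ℂ → ℝ → ℂ} (h : CubicFamily q) :
    Differentiable ℂ fun l => volterra (q l) := by
  obtain ⟨q0, q1, q2, q3, h0, h1, h2, h3, hq⟩ := h
  have e : ∀ l, volterra (q l) = volterra q0 + (l • volterra q1 + (l ^ 2 • volterra q2
      + l ^ 3 • volterra q3)) := by
    intro l
    rw [hq, volterra_add h0 ((h1.smul l).add ((h2.smul _).add (h3.smul _))),
      volterra_add (h1.smul l) ((h2.smul _).add (h3.smul _)),
      volterra_add (h2.smul _) (h3.smul _), volterra_smul h1, volterra_smul h2, volterra_smul h3]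
  rw [funext e]
  exact differentiable_cubic (volterra q0) (volterra q1) (volterra q2) (volterra q3)

theorem CubicFamily.differentiable_totalInt {q : ℂ → ℝ → ℂ} (h : CubicFamily q) :
    Differentiable ℂ fun l => totalInt (q l) := by
  obtain ⟨q0, q1, q2, q3, h0, h1, h2, h3, hq⟩ := h
  have e : ∀ l, totalInt (q l) = totalInt q0 + (l • totalInt q1 + (l ^ 2 • totalInt q2
      + l ^ 3 • totalInt q3)) := by
    intro l
    rw [hq, totalInt_add h0 ((h1.smul l).add ((h2.smul _).add (h3.smul _))),
      totalInt_add (h1.smul l) ((h2.smul _).add (h3.smul _)),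
      totalInt_add (h2.smul _) (h3.smul _), totalInt_smul h1, totalInt_smul h2, totalInt_smul h3]
  rw [funext e]
  exact differentiable_cubic (totalInt q0) (totalInt q1) (totalInt q2) (totalInt q3)

namespace Pair

/-- The pair `P + l Q`. -/
def line (P Q : Pair) (l : ℂ) : Pair where
  u x := P.u x + l * Q.u x
  u1 x := P.u1 x + l * Q.u1 x
  u2 x := P.u2 x + l * Q.u2 x
  v x := P.v x + l * Q.v x
  v1 x := P.v1 x + l * Q.v1 x
  v2 x := P.v2 x + l * Q.v2 x

/-- Both potentials lie in `H² ∩ H^{1,1}` with norms at most `M`. -/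
structure Nice (M : ℝ≥0) (P : Pair) : Prop where
  niceU : NiceFun M P.u P.u1 P.u2
  niceV : NiceFun M P.v P.v1 P.v2

variable {P Q : Pair} {M N : ℝ≥0}

theorem integrable_mul_mul {u u1 u2 v v1 v2 w w1 w2 : ℝ → ℂ} {M M' M'' : ℝ≥0}
    (hu : NiceFun M u u1 u2) (hv : NiceFun M' v v1 v2) (hw : NiceFun M'' w w1 w2) :
    Integrable fun x => u x * v x * w x :=
  (integrable_mul hu hv).mul_bdd hw.continuous.aestronglyMeasurable
    (Eventually.of_forall hw.norm_le)

theorem cubicFamily_D (hP : P.Nice M) (hQ : Q.Nice N) : CubicFamily fun l => (P.line Q l).D := by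
  refine ⟨fun x => P.u x * P.v x / (2 * Complex.I),
    fun x => (P.u x * Q.v x + Q.u x * P.v x) / (2 * Complex.I),
    fun x => Q.u x * Q.v x / (2 * Complex.I), 0, (integrable_mul hP.niceU hP.niceV).div_const _,
    ((integrable_mul hP.niceU hQ.niceV).add (integrable_mul hQ.niceU hP.niceV)).div_const _,
    (integrable_mul hQ.niceU hQ.niceV).div_const _, integrable_zero _ _ _, fun l => ?_⟩
  ext x
  simp only [D, line, Pi.add_apply, Pi.smul_apply, smul_eq_mul, Pi.zero_apply]
  ring

theorem cubicFamily_U (hP : P.Nice M) (hQ : Q.Nice N) : CubicFamily fun l => (P.line Q l).U := by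
  refine ⟨fun x => P.u x / (2 * Complex.I), fun x => Q.u x / (2 * Complex.I), 0, 0,
    hP.niceU.integrable.div_const _, hQ.niceU.integrable.div_const _,
    integrable_zero _ _ _, integrable_zero _ _ _, fun l => ?_⟩
  ext x
  simp only [U, line, Pi.add_apply, Pi.smul_apply, smul_eq_mul, Pi.zero_apply]
  ring

theorem cubicFamily_v (hP : P.Nice M) (hQ : Q.Nice N) : CubicFamily fun l => (P.line Q l).v := by
  refine ⟨P.v, Q.v, 0, 0, hP.niceV.integrable, hQ.niceV.integrable,
    integrable_zero _ _ _, integrable_zero _ _ _, fun l => ?_⟩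
  ext x
  simp only [line, Pi.add_apply, Pi.smul_apply, smul_eq_mul, Pi.zero_apply]
  ring

theorem cubicFamily_V (hP : P.Nice M) (hQ : Q.Nice N) : CubicFamily fun l => (P.line Q l).V := by
  refine ⟨fun x => (2 * Complex.I * P.v1 x - P.u x * P.v x * P.v x) / (2 * Complex.I),
    fun x => (2 * Complex.I * Q.v1 x - (Q.u x * P.v x * P.v x + 2 * (P.u x * P.v x * Q.v x)))
      / (2 * Complex.I),
    fun x => -(2 * (Q.u x * P.v x * Q.v x) + P.u x * Q.v x * Q.v x) / (2 * Complex.I),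
    fun x => -(Q.u x * Q.v x * Q.v x) / (2 * Complex.I), ?_, ?_, ?_, ?_, fun l => ?_⟩
  · exact ((hP.niceV.integrable_deriv.const_mul _).sub
      (integrable_mul_mul hP.niceU hP.niceV hP.niceV)).div_const _
  · exact ((hQ.niceV.integrable_deriv.const_mul _).sub
      ((integrable_mul_mul hQ.niceU hP.niceV hP.niceV).add
        ((integrable_mul_mul hP.niceU hP.niceV hQ.niceV).const_mul 2))).div_const _
  · exact (((integrable_mul_mul hQ.niceU hP.niceV hQ.niceV).const_mul 2).add
      (integrable_mul_mul hP.niceU hQ.niceV hQ.niceV)).neg.div_const _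
  · exact (integrable_mul_mul hQ.niceU hQ.niceV hQ.niceV).neg.div_const _
  · ext x
    simp only [V, line, Pi.add_apply, Pi.smul_apply, smul_eq_mul]
    ring

/-- The reflection coefficient depends holomorphically on the potentials. -/
theorem differentiableOn_rho (hP : P.Nice M) (hQ : Q.Nice N) {s : Set ℂ} {M' : ℝ≥0}
    (h : ∀ l ∈ s, (P.line Q l).Good M') (z : ℝ) :
    DifferentiableOn ℂ (fun l => (P.line Q l).rho z) s := by
  have hD := cubicFamily_D hP hQ
  have hU := (cubicFamily_U hP hQ).osc_mul z
  have hV := (cubicFamily_V hP hQ).osc_mul (-z)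
  have hv := (cubicFamily_v hP hQ).osc_mul (-z)
  have hsol := differentiableOn_sysSol (fun l hl => (h l hl).smallSystem z)
    hD.differentiable_volterra.differentiableOn hU.differentiable_volterra.differentiableOn
    hV.differentiable_volterra.differentiableOn
  have hm : DifferentiableOn ℂ (fun l => (P.line Q l).m z) s := hsol.fst
  have hg : DifferentiableOn ℂ (fun l => (P.line Q l).g z) s := hsol.snd
  have hα : DifferentiableOn ℂ (fun l => (P.line Q l).alpha z) s :=
    ((differentiableOn_const 1).sub (hD.differentiable_totalInt.differentiableOn.clm_apply hm)).add
      (hU.differentiable_totalInt.differentiableOn.clm_apply hg)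
  have hβ : DifferentiableOn ℂ (fun l => (P.line Q l).beta z) s :=
    hv.differentiable_totalInt.differentiableOn.clm_apply hm
  exact hβ.div hα fun l hl => (h l hl).alpha_ne_zero z

theorem integral_norm_le_two_mul {f : ℝ → ℂ} (hf : Integrable f) (h : ∫⁻ x, ‖f x‖ₑ ≤ 2 * N) :
    ∫ x, ‖f x‖ ≤ 2 * N := by
  rw [integral_norm_eq_lintegral_enorm hf.1]
  simpa using ENNReal.toReal_mono (by finiteness) h

/-- Potentials near a pair satisfying the small norm condition strictly still satisfy it. -/
theorem good_line (hP : P.Nice M)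
    (hsmall : 2 * (∫ y, ‖P.D y‖) + (∫ y, ‖P.U y‖) + (∫ y, ‖P.V y‖) ≤ 0.295) (hQ : Q.Nice N)
    {l : ℂ} (hl : ‖l‖ * N * (20000 * (M + 1) ^ 2) ≤ 1) : (P.line Q l).Good (M + 1) := by
  have hM := M.coe_nonneg
  have hN := N.coe_nonneg
  have hlN : ‖l‖ * N ≤ 1 := by
    have : 1 ≤ 20000 * ((M : ℝ) + 1) ^ 2 := by nlinarith
    have h0 : 0 ≤ ‖l‖ * N := by positivity
    nlinarith
  have hMN : M + ‖l‖₊ * N ≤ M + 1 := by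
    rw [← NNReal.coe_le_coe]
    push_cast
    linarith
  have hu := (hP.niceU.add_smul hQ.niceU l).mono hMN
  have hv := (hP.niceV.add_smul hQ.niceV l).mono hMN
  refine ⟨hu, hv, ?_⟩
  have hu' : NiceFun (M + 1) (P.line Q l).u (P.line Q l).u1 (P.line Q l).u2 := hu
  have hv' : NiceFun (M + 1) (P.line Q l).v (P.line Q l).v1 (P.line Q l).v2 := hv
  set K : ℝ := (M : ℝ) + 1
  have hK : 1 ≤ K := by simp only [K]; linarith
  have hK2 : K ≤ K ^ 2 := by nlinarith
  have bu : ∀ x, ‖P.u x‖ ≤ 2 * K := fun x => (hP.niceU.norm_le x).trans (by simp only [K]; linarith)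
  have bv : ∀ x, ‖P.v x‖ ≤ 2 * K := fun x => (hP.niceV.norm_le x).trans (by simp only [K]; linarith)
  have bvl : ∀ x, ‖P.v x + l * Q.v x‖ ≤ 2 * K := fun x => by simpa [K] using hv.norm_le x
  -- the increment of each coefficient is at most `4 K² ‖l‖ E`
  set E : ℝ → ℝ := fun x => ‖Q.u x‖ + ‖Q.v x‖ + ‖Q.v1 x‖
  have iu := hQ.niceU.integrable.norm
  have iv := hQ.niceV.integrable.norm
  have iv1 := hQ.niceV.integrable_deriv.norm
  have hE : Integrable E := (iu.add iv).add iv1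
  have hEint : ∫ x, E x ≤ 6 * N := by
    have e : ∫ x, E x = (∫ x, ‖Q.u x‖) + (∫ x, ‖Q.v x‖) + ∫ x, ‖Q.v1 x‖ := by
      rw [← integral_add iu iv, ← integral_add (f := fun x => ‖Q.u x‖ + ‖Q.v x‖) (iu.add iv) iv1]
    rw [e]
    have h1 := integral_norm_le_two_mul hQ.niceU.integrable hQ.niceU.lintegral_le
    have h2 := integral_norm_le_two_mul hQ.niceV.integrable hQ.niceV.lintegral_le
    have h3 := integral_norm_le_two_mul hQ.niceV.integrable_deriv hQ.niceV.lintegral_deriv_le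
    linarith
  set c : ℝ := 4 * K ^ 2 * ‖l‖
  have hint : ∀ {f g : ℝ → ℂ}, Integrable f → Integrable g → (∀ x, ‖g x - f x‖ ≤ c * E x) →
      ∫ x, ‖g x‖ ≤ (∫ x, ‖f x‖) + c * (6 * N) := by
    intro f g hf hg hfg
    calc ∫ x, ‖g x‖ ≤ ∫ x, (‖f x‖ + c * E x) := by
          refine integral_mono hg.norm (hf.norm.add (hE.const_mul c)) fun x => ?_
          have := norm_add_le (f x) (g x - f x)
          rw [add_sub_cancel] at this
          exact this.trans (add_le_add le_rfl (hfg x))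
      _ = (∫ x, ‖f x‖) + c * ∫ x, E x := by
          rw [integral_add hf.norm (hE.const_mul c), integral_const_mul]
      _ ≤ _ := by gcongr
  have nI : ∀ w : ℂ, ‖w / (2 * Complex.I)‖ = ‖w‖ / 2 := fun w => by
    rw [norm_div, norm_mul, Complex.norm_I, mul_one, Complex.norm_ofNat]
  have h1 : ∫ x, ‖(P.line Q l).D x‖ ≤ (∫ x, ‖P.D x‖) + c * (6 * N) := by
    refine hint (integrable_D hP.niceU hP.niceV) (integrable_D hu' hv') fun x => ?_
    have e : (P.line Q l).D x - P.D x
        = l * (P.u x * Q.v x + Q.u x * (P.v x + l * Q.v x)) / (2 * Complex.I) := by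
      simp only [D, line]; ring
    rw [e, nI, norm_mul]
    have : ‖P.u x * Q.v x + Q.u x * (P.v x + l * Q.v x)‖ ≤ 2 * K * ‖Q.v x‖ + ‖Q.u x‖ * (2 * K) := by
      refine (norm_add_le _ _).trans ?_
      rw [norm_mul, norm_mul]
      gcongr
      · exact bu x
      · exact bvl x
    calc _ ≤ ‖l‖ * (2 * K * ‖Q.v x‖ + ‖Q.u x‖ * (2 * K)) / 2 := by gcongr
      _ = 1 * K * ‖l‖ * (‖Q.u x‖ + ‖Q.v x‖) := by ring
      _ ≤ 4 * K ^ 2 * ‖l‖ * E x := by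
        gcongr
        · norm_num
        · simp only [E]; linarith [norm_nonneg (Q.v1 x)]
  have h2 : ∫ x, ‖(P.line Q l).U x‖ ≤ (∫ x, ‖P.U x‖) + c * (6 * N) := by
    refine hint (integrable_U hP.niceU) (integrable_U hu') fun x => ?_
    have e : (P.line Q l).U x - P.U x = l * Q.u x / (2 * Complex.I) := by
      simp only [U, line]; ring
    rw [e, nI, norm_mul]
    calc _ = 1 / 2 * 1 * ‖l‖ * ‖Q.u x‖ := by ring
      _ ≤ 4 * K ^ 2 * ‖l‖ * E x := by
        gcongr
        · norm_num
        · nlinarith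
        · simp only [E]; linarith [norm_nonneg (Q.v1 x), norm_nonneg (Q.v x)]
  have h3 : ∫ x, ‖(P.line Q l).V x‖ ≤ (∫ x, ‖P.V x‖) + c * (6 * N) := by
    refine hint (integrable_V hP.niceU hP.niceV) (integrable_V hu' hv') fun x => ?_
    have e : (P.line Q l).V x - P.V x
        = l * (2 * Complex.I * Q.v1 x - (Q.u x * (P.v x + l * Q.v x) ^ 2
          + P.u x * Q.v x * (P.v x + l * Q.v x) + P.u x * Q.v x * P.v x)) / (2 * Complex.I) := by
      simp only [V, line]; ring
    rw [e, nI, norm_mul]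
    have : ‖2 * Complex.I * Q.v1 x - (Q.u x * (P.v x + l * Q.v x) ^ 2
          + P.u x * Q.v x * (P.v x + l * Q.v x) + P.u x * Q.v x * P.v x)‖
        ≤ 2 * ‖Q.v1 x‖ + (‖Q.u x‖ * (2 * K) ^ 2 + 2 * K * ‖Q.v x‖ * (2 * K)
          + 2 * K * ‖Q.v x‖ * (2 * K)) := by
      refine (norm_sub_le _ _).trans (add_le_add ?_ ((norm_add_le _ _).trans
        (add_le_add ((norm_add_le _ _).trans (add_le_add ?_ ?_)) ?_)))
      · rw [norm_mul, norm_mul, Complex.norm_I, mul_one, Complex.norm_ofNat]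
      · rw [norm_mul, norm_pow]
        gcongr
        exact bvl x
      · rw [norm_mul, norm_mul]
        gcongr
        · exact bu x
        · exact bvl x
      · rw [norm_mul, norm_mul]
        gcongr
        · exact bu x
        · exact bv x
    calc _ ≤ ‖l‖ * (2 * ‖Q.v1 x‖ + (‖Q.u x‖ * (2 * K) ^ 2 + 2 * K * ‖Q.v x‖ * (2 * K)
          + 2 * K * ‖Q.v x‖ * (2 * K))) / 2 := by gcongr
      _ = ‖l‖ * (1 * ‖Q.v1 x‖ + 2 * K ^ 2 * ‖Q.u x‖ + 4 * K ^ 2 * ‖Q.v x‖) := by ring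
      _ ≤ ‖l‖ * (4 * K ^ 2 * ‖Q.v1 x‖ + 4 * K ^ 2 * ‖Q.u x‖ + 4 * K ^ 2 * ‖Q.v x‖) := by
        gcongr
        · nlinarith
        · norm_num
      _ = 4 * K ^ 2 * ‖l‖ * E x := by simp only [E]; ring
  -- the increments add up to at most `4 * 24 / 20000 < 0.3 - 0.295`
  have hc : c * (6 * N) ≤ 24 / 20000 := by
    have : c * (6 * N) = 24 / 20000 * (‖l‖ * N * (20000 * K ^ 2)) := by simp only [c]; ring
    rw [this]
    linarith
  norm_num at hsmall
  linarith

end Pair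

theorem DataBound.mono {C C' : ℝ≥0} {r : ℝ → ℂ} (h : DataBound C r) (hC : C ≤ C') :
    DataBound C' r := by
  have hC' : (C : ℝ≥0∞) ≤ C' := by exact_mod_cast hC
  exact ⟨h.norm0.trans hC', h.norm1.trans hC', h.norm2.trans hC',
    fun t => (h.diff0 t).trans (by gcongr), fun t => (h.diff1 t).trans (by gcongr)⟩

theorem DataBound.sub {C C' : ℝ≥0} {r r' : ℝ → ℂ} (h : DataBound C r) (h' : DataBound C' r')
    (hr : Continuous r) (hr' : Continuous r') : DataBound (C + C') fun z => r z - r' z := by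
  have hz : Continuous fun z : ℝ => (z : ℂ) * r z := by fun_prop
  have hz' : Continuous fun z : ℝ => (z : ℂ) * r' z := by fun_prop
  have key : ∀ {f g F : ℝ → ℂ} {a b c : ℝ≥0∞}, (∀ z, F z = f z - g z) → Continuous f →
      Continuous g → eLpNorm f 2 volume ≤ a → eLpNorm g 2 volume ≤ b → a + b = c →
      eLpNorm F 2 volume ≤ c := by
    intro f g F a b c hF hf hg hfa hgb hc
    rw [funext hF, ← hc]
    exact (eLpNorm_sub_le hf.aestronglyMeasurable hg.aestronglyMeasurable (by norm_num)).trans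
      (add_le_add hfa hgb)
  refine ⟨key (fun _ => rfl) hr hr' h.norm0 h'.norm0 (by push_cast; rfl),
    key (fun _ => by ring) hz hz' h.norm1 h'.norm1 (by push_cast; rfl),
    key (fun _ => by ring) (by fun_prop) (by fun_prop) h.norm2 h'.norm2 (by push_cast; rfl),
    fun t => key (fun _ => by ring) (by fun_prop) (by fun_prop) (h.diff0 t) (h'.diff0 t)
      (by push_cast; ring),
    fun t => key (fun _ => by ring) (by fun_prop) (by fun_prop) (h.diff1 t) (h'.diff1 t)
      (by push_cast; ring)⟩

namespace Pair

/-- The difference of two pairs. -/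
def diff (P' P : Pair) : Pair where
  u x := P'.u x - P.u x
  u1 x := P'.u1 x - P.u1 x
  u2 x := P'.u2 x - P.u2 x
  v x := P'.v x - P.v x
  v1 x := P'.v1 x - P.v1 x
  v2 x := P'.v2 x - P.v2 x

theorem line_diff_one (P P' : Pair) : P.line (P'.diff P) 1 = P' := by
  cases P'
  simp [line, diff]

theorem line_diff_zero (P P' : Pair) : P.line (P'.diff P) 0 = P := by
  cases P
  simp [line]

/-- The reflection coefficient is Lipschitz continuous: along the complex line through two nearby
pairs it is holomorphic and bounded, so that Cauchy's estimate applies; for pairs that are far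
apart the bounds of the two reflection coefficients suffice. -/
theorem exists_dataBound_sub (M : ℝ≥0) : ∃ C : ℝ≥0, ∀ (P P' : Pair) (N : ℝ≥0), 0 < N →
    P.Good M → P'.Good M →
    2 * (∫ y, ‖P.D y‖) + (∫ y, ‖P.U y‖) + (∫ y, ‖P.V y‖) ≤ 0.295 →
    (P'.diff P).Nice N → DataBound (C * N) fun z => P'.rho z - P.rho z := by
  obtain ⟨C, hC⟩ := exists_dataBound (M + 1)
  set A : ℝ≥0 := 20000 * (M + 1) ^ 2
  have hA0 : 0 < A := by positivity
  refine ⟨8 * A * C, fun P P' N hN hP hP' hs hQ => ?_⟩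
  have up : ∀ {P : Pair}, P.Good M → P.Good (M + 1) := fun h =>
    ⟨h.niceU.mono le_self_add, h.niceV.mono le_self_add, h.small⟩
  -- pairs at distance at least `1 / (4A)`: the two bounds suffice
  by_cases hfar : 1 ≤ 4 * A * N
  · refine ((hC P' (up hP')).sub (hC P (up hP)) (up hP').continuous_rho
      (up hP).continuous_rho).mono ?_
    calc C + C = 2 * C * 1 := by ring
      _ ≤ 2 * C * (4 * A * N) := by gcongr
      _ = _ := by ring
  push Not at hfar
  -- radius of the disc in which the perturbed pair satisfies the bounds
  set R : ℝ := (((A * N)⁻¹ : ℝ≥0) : ℝ)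
  have hAN : 0 < (A * N : ℝ≥0) := by positivity
  have hR : 4 ≤ R := by
    have : (4 : ℝ≥0) ≤ (A * N)⁻¹ := by
      rw [le_inv_comm₀ (by norm_num) hAN, ← one_div, le_div_iff₀ (by norm_num)]
      calc A * N * 4 = 4 * A * N := by ring
        _ ≤ 1 := hfar.le
    exact_mod_cast this
  have hgood : ∀ l : ℂ, ‖l‖ < R → (P.line (P'.diff P) l).Good (M + 1) := by
    intro l hl
    refine good_line ⟨hP.niceU, hP.niceV⟩ hs hQ ?_
    have h1 : ‖l‖ * (A * N : ℝ≥0) ≤ 1 := by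
      have : ‖l‖ * (A * N : ℝ≥0) ≤ R * (A * N : ℝ≥0) := by gcongr
      refine this.trans (le_of_eq ?_)
      simp only [R]
      rw [← NNReal.coe_mul, inv_mul_cancel₀ hAN.ne', NNReal.coe_one]
    refine (le_of_eq ?_).trans h1
    simp only [A]
    push_cast
    ring
  have hd : ∀ z, DifferentiableOn ℂ (fun l => (P.line (P'.diff P) l).rho z) (Metric.ball 0 R) :=
    fun z => differentiableOn_rho ⟨hP.niceU, hP.niceV⟩ hQ
      (fun l hl => hgood l (mem_ball_zero_iff.1 hl)) z
  have hcont : ∀ l : ℂ, ‖l‖ < R → Continuous (P.line (P'.diff P) l).rho :=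
    fun l hl => (hgood l hl).continuous_rho
  have hb : ∀ l : ℂ, ‖l‖ < R → DataBound C (P.line (P'.diff P) l).rho :=
    fun l hl => hC _ (hgood l hl)
  have hconst : ∀ t : ℝ≥0∞, ENNReal.ofReal (4 / R) * (C * t) ≤ (8 * A * C * N : ℝ≥0) * t := by
    intro t
    have : ENNReal.ofReal (4 / R) = (4 * (A * N) : ℝ≥0) := by
      rw [← ENNReal.ofReal_coe_nnreal]
      congr 1
      simp only [R]
      push_cast
      rw [div_inv_eq_mul]
    rw [this, ← mul_assoc, ← ENNReal.coe_mul]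
    refine mul_le_mul_left (ENNReal.coe_le_coe.2 ?_) t
    calc 4 * (A * N) * C = 4 * A * C * N := by ring
      _ ≤ 8 * A * C * N := by gcongr; norm_num
  have hconst' := hconst 1
  rw [mul_one, mul_one] at hconst'
  -- Cauchy's estimate for each of the five quantities
  have e := fun (f : ℂ → ℝ → ℂ) hd hm (a : ℝ≥0∞) hC =>
    eLpNorm_sub_le_of_holomorphic (ν := volume) (f := f) (C := a) hR hd hm hC
  have e0 := e (fun l z => (P.line (P'.diff P) l).rho z) hd (fun l hl => (hcont l hl).measurable) C
    fun l hl => (hb l hl).norm0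
  have e1 := e (fun l z => (z : ℂ) * (P.line (P'.diff P) l).rho z)
    (fun z => (hd z).const_mul _)
    (fun l hl => (Complex.continuous_ofReal.mul (hcont l hl)).measurable) C
    fun l hl => (hb l hl).norm1
  have e2 := e (fun l z => (z : ℂ) ^ 2 * (P.line (P'.diff P) l).rho z)
    (fun z => (hd z).const_mul _)
    (fun l hl => ((Complex.continuous_ofReal.pow 2).mul (hcont l hl)).measurable) C
    fun l hl => (hb l hl).norm2
  have e3 := fun t : ℝ => e (fun l z => (P.line (P'.diff P) l).rho (z + t)
      - (P.line (P'.diff P) l).rho z) (fun z => (hd _).sub (hd _))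
    (fun l hl => (((hcont l hl).comp (continuous_add_const t)).sub (hcont l hl)).measurable)
    (C * ‖t‖ₑ) fun l hl => (hb l hl).diff0 t
  have e4 := fun t : ℝ => e (fun l z => ((z + t : ℝ) : ℂ) * (P.line (P'.diff P) l).rho (z + t)
      - z * (P.line (P'.diff P) l).rho z) (fun z => ((hd _).const_mul _).sub ((hd _).const_mul _))
    (fun l hl => (((Complex.continuous_ofReal.mul (hcont l hl)).comp
      (continuous_add_const t)).sub (Complex.continuous_ofReal.mul (hcont l hl))).measurable)
    (C * ‖t‖ₑ) fun l hl => (hb l hl).diff1 t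
  simp only [line_diff_one, line_diff_zero] at e0 e1 e2 e3 e4
  refine ⟨e0.trans hconst', ?_, ?_, fun t => ?_, fun t => ?_⟩
  · simp only [mul_sub]
    exact e1.trans hconst'
  · simp only [mul_sub]
    exact e2.trans hconst'
  · refine (le_of_eq ?_).trans ((e3 t).trans (hconst _))
    congr 1 with z
    ring
  · refine (le_of_eq ?_).trans ((e4 t).trans (hconst _))
    congr 1 with z
    ring

end Pair

/-! ### Membership in the target space -/

/-- `f` and `z f` are bounded by `C` in `L²`, and translations act on `f` with Lipschitz constant
`C` in `L²`. This is a bound for `f` in `H¹ ∩ L^{2,1}`. -/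
structure H1Bound (C : ℝ≥0) (f : ℝ → ℂ) : Prop where
  aesm : AEStronglyMeasurable f volume
  norm0 : eLpNorm f 2 volume ≤ C
  norm1 : eLpNorm (fun z : ℝ => (z : ℂ) * f z) 2 volume ≤ C
  diff : ∀ h : ℝ, eLpNorm (fun z => f (z + h) - f z) 2 volume ≤ C * ‖h‖ₑ

namespace H1Bound
variable {C : ℝ≥0} {f g : ℝ → ℂ}

theorem memLp (h : H1Bound C f) : MemLp f 2 := ⟨h.aesm, h.norm0.trans_lt (by simp)⟩

theorem congr (h : H1Bound C f) (hfg : f =ᵐ[volume] g) : H1Bound C g := by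
  refine ⟨h.aesm.congr hfg, (eLpNorm_congr_ae hfg.symm).le.trans h.norm0,
    (eLpNorm_congr_ae ?_).le.trans h.norm1, fun t => (eLpNorm_congr_ae ?_).le.trans (h.diff t)⟩
  · filter_upwards [hfg] with z hz
    rw [hz]
  · have := (measurePreserving_add_right (volume : Measure ℝ) t).quasiMeasurePreserving.ae hfg
    filter_upwards [hfg, this] with z hz hz'
    rw [hz, hz']

theorem const_mul (h : H1Bound C f) (c : ℂ) : H1Bound (‖c‖₊ * C) fun z => c * f z := by
  have key : ∀ {φ : ℝ → ℂ} {a : ℝ≥0∞}, eLpNorm φ 2 volume ≤ a →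
      eLpNorm (fun z => c * φ z) 2 volume ≤ ‖c‖₊ * a := by
    intro φ a hφ
    rw [show (fun z => c * φ z) = c • φ from rfl, eLpNorm_const_smul]
    gcongr
    exact le_rfl
  refine ⟨h.aesm.const_mul c, ?_, ?_, fun t => ?_⟩
  · push_cast
    exact key h.norm0
  · push_cast
    simp only [mul_left_comm _ c]
    exact key h.norm1
  · push_cast
    simp only [← mul_sub, mul_assoc]
    exact key (h.diff t)

theorem comp_neg (h : H1Bound C f) : H1Bound C fun z => f (-z) := by
  refine ⟨h.aesm.comp_measurePreserving (Measure.measurePreserving_neg (volume : Measure ℝ)),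
    ?_, ?_, fun t => ?_⟩
  · rw [eLpNorm_comp_neg]
    exact h.norm0
  · rw [← eLpNorm_comp_neg]
    simp only [neg_neg, Complex.ofReal_neg, neg_mul]
    rw [show (fun z : ℝ => -((z : ℂ) * f z)) = -fun z : ℝ => (z : ℂ) * f z from rfl, eLpNorm_neg]
    exact h.norm1
  · rw [← eLpNorm_comp_neg]
    have := h.diff (-t)
    rw [enorm_neg] at this
    simpa [neg_add_rev, add_comm] using this

theorem exists_weakDeriv (h : H1Bound C f) :
    ∃ g, HasWeakDeriv 1 f g ∧ MemLp g 2 ∧ eLpNorm g 2 volume ≤ C :=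
  exists_weakDeriv_of_translation_le h.memLp h.diff

theorem eLpNorm_bracket_le (h : H1Bound C f) :
    eLpNorm (fun z => bracket z • f z) 2 volume ≤ (2 * C : ℝ≥0) := by
  refine (eLpNorm_le_of_norm_le_add (a := 1) (b := 1) h.aesm
    (Complex.continuous_ofReal.aestronglyMeasurable.mul h.aesm)
    (fun x => ?_) h.norm0 h.norm1).trans (le_of_eq (by push_cast; ring))
  rw [norm_smul, Real.norm_of_nonneg (bracket_pos x).le, Pi.mul_apply, norm_mul,
    Complex.norm_real, NNReal.coe_one, one_mul, one_mul, ← one_add_mul]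
  gcongr
  exact bracket_le x

theorem memData (h : H1Bound C f) : MemData f := by
  obtain ⟨g, hg, hg2, -⟩ := h.exists_weakDeriv
  refine ⟨⟨h.memLp, fun j hj => ?_⟩, h.memLp, ?_⟩
  · interval_cases j
    · exact ⟨f, HasWeakDeriv.zero hg.1, by simpa using h.memLp⟩
    · exact ⟨g, hg, by simpa using hg2⟩
  · simp only [pow_one]
    exact ⟨continuous_bracket.aestronglyMeasurable.smul h.aesm,
      h.eLpNorm_bracket_le.trans_lt ENNReal.coe_lt_top⟩

theorem dataNorm_le (h : H1Bound C f) : dataNorm f ≤ (4 * C : ℝ≥0) := by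
  obtain ⟨g, hg, -, hgC⟩ := h.exists_weakDeriv
  have h0 : eLpNorm (weakDeriv 0 f) 2 volume ≤ C :=
    (eLpNorm_congr_ae (weakDeriv_ae_eq (HasWeakDeriv.zero hg.1))).le.trans h.norm0
  have h1 : eLpNorm (weakDeriv 1 f) 2 volume ≤ C :=
    (eLpNorm_congr_ae (weakDeriv_ae_eq hg)).le.trans hgC
  simp only [dataNorm, sobolevNorm, weightedLpNorm, Finset.sum_range_succ, Finset.sum_range_zero,
    pow_zero, pow_one, one_smul, zero_add]
  calc _ ≤ (C : ℝ≥0∞) + C + (2 * C : ℝ≥0) := by gcongr; exact h.eLpNorm_bracket_le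
    _ = _ := by push_cast; ring

theorem sqrt_abs_mul_norm_le (h : H1Bound C f) (hf : Continuous f) (z : ℝ) :
    √|z| * ‖f z‖ ≤ 2 * C := by
  obtain ⟨g, hg, hg2, hgC⟩ := h.exists_weakDeriv
  exact NDNLS.sqrt_abs_mul_norm_le hf hg2.1 (hg.sub_eq_integral hf) h.norm1 hgC z

end H1Bound

theorem DataBound.h1Bound {C : ℝ≥0} {r : ℝ → ℂ} (h : DataBound C r) (hr : Continuous r) :
    H1Bound C r := ⟨hr.aestronglyMeasurable, h.norm0, h.norm1, h.diff0⟩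

theorem DataBound.h1Bound_mul {C : ℝ≥0} {r : ℝ → ℂ} (h : DataBound C r) (hr : Continuous r) :
    H1Bound C fun z : ℝ => (z : ℂ) * r z :=
  ⟨(Complex.continuous_ofReal.mul hr).aestronglyMeasurable, h.norm1,
    by simpa only [← mul_assoc, ← pow_two] using h.norm2, h.diff1⟩

/-! ### Regular representatives of the potentials -/

theorem HasWeakDeriv.of_hasDerivAt {f f' : ℝ → ℂ} (h : ∀ x, HasDerivAt f (f' x) x)
    (hf' : Continuous f') : HasWeakDeriv 1 f f' := by
  have hf : Continuous f := continuous_iff_continuousAt.2 fun x => (h x).continuousAt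
  refine ⟨hf.locallyIntegrable, hf'.locallyIntegrable, fun φ hφ hc => ?_⟩
  have hd : Continuous (deriv φ) := hφ.continuous_deriv (by simp)
  have hder : ∀ x, HasDerivAt (fun x => φ x • f x) (φ x • f' x + deriv φ x • f x) x := fun x =>
    ((hφ.differentiable (by simp)) x).hasDerivAt.smul (h x)
  have i1 : Integrable fun x => φ x • f' x :=
    (hφ.continuous.smul hf').integrable_of_hasCompactSupport hc.smul_right
  have i2 : Integrable fun x => deriv φ x • f x :=
    (hd.smul hf).integrable_of_hasCompactSupport hc.deriv.smul_right
  have i3 : Integrable fun x => φ x • f x :=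
    (hφ.continuous.smul hf).integrable_of_hasCompactSupport hc.smul_right
  have key := integral_eq_zero_of_hasDerivAt_of_integrable hder (i1.add i2) i3
  rw [integral_add i1 i2] at key
  rw [iteratedDeriv_one, pow_one, neg_one_mul]
  exact eq_neg_of_add_eq_zero_right key

section
variable {u u1 : ℝ → ℂ}

theorem IsPotential.hasWeakDeriv (hu : IsPotential u) {j : ℕ} (hj : j ≤ 2) :
    HasWeakDeriv j u (weakDeriv j u) := by
  obtain ⟨g, hg, -⟩ := hu.memH2.2 j hj
  exact Classical.epsilon_spec (p := HasWeakDeriv j u) ⟨g, hg⟩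

theorem sobolevNorm_lt_top {m s : ℕ} (hu : MemSobolev m s u) : sobolevNorm m s u < ⊤ := by
  refine ENNReal.sum_lt_top.2 fun j hj => ?_
  obtain ⟨g, hg, hg2⟩ := hu.2 j (Finset.mem_range_succ_iff.1 hj)
  refine (eLpNorm_congr_ae ?_).trans_lt hg2.2
  filter_upwards [weakDeriv_ae_eq hg] with x hx
  rw [hx]

theorem IsPotential.potentialNorm_lt_top (hu : IsPotential u) : potentialNorm u < ⊤ :=
  ENNReal.add_lt_top.2 ⟨sobolevNorm_lt_top hu.memH2, sobolevNorm_lt_top hu.memH11⟩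

/-- The norm of `H² ∩ H^{1,1}` controls the bounds in `NiceFun`. -/
theorem NiceFun.of_potentialNorm_le {f f1 f2 : ℝ → ℂ} {M : ℝ≥0} (hf : Continuous f)
    (hf1 : Continuous f1) (h1 : HasWeakDeriv 1 f f1) (h2 : HasWeakDeriv 1 f1 f2)
    (h2' : HasWeakDeriv 2 f f2) (hM : potentialNorm f ≤ M) : NiceFun M f f1 f2 := by
  have e0 : weakDeriv 0 f =ᵐ[volume] f := weakDeriv_ae_eq (HasWeakDeriv.zero h1.1)
  have e1 := weakDeriv_ae_eq h1
  have e2 := weakDeriv_ae_eq h2'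
  simp only [potentialNorm, sobolevNorm, Finset.sum_range_succ, Finset.sum_range_zero,
    pow_zero, pow_one, one_smul, zero_add] at hM
  have hfd : ∀ x, HasDerivAt f (f1 x) x := by
    intro x
    have e : f = fun x => f 0 + ∫ y in (0 : ℝ)..x, f1 y := by
      ext x
      rw [← h1.sub_eq_integral hf]
      ring
    rw [e]
    exact (intervalIntegral.integral_hasDerivAt_right (hf1.intervalIntegrable _ _)
      (hf1.stronglyMeasurableAtFilter _ _) hf1.continuousAt).const_add _
  refine ⟨hfd, hf1, h2.sub_eq_integral hf1, h2.2.1.aestronglyMeasurable, ?_, ?_, ?_⟩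
  · refine (eLpNorm_congr_ae ?_).le.trans ((le_self_add.trans le_add_self).trans hM)
    filter_upwards [e0] with x hx
    rw [hx]
  · refine (eLpNorm_congr_ae ?_).le.trans ((le_add_self.trans le_add_self).trans hM)
    filter_upwards [e1] with x hx
    rw [hx]
  · exact (eLpNorm_congr_ae e2.symm).le.trans ((le_add_self.trans le_self_add).trans hM)

/-- The continuous representative of the derivative of a potential. -/
theorem IsPotential.exists_deriv (hu : IsPotential u) : ∃ u1 : ℝ → ℂ, Continuous u1 ∧
    HasWeakDeriv 1 u u1 ∧ HasWeakDeriv 1 u1 (weakDeriv 2 u) := by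
  have h1 := hu.hasWeakDeriv (j := 1) (by norm_num)
  have h2 := h1.of_second (hu.hasWeakDeriv le_rfl)
  obtain ⟨F, hF, hae, -⟩ := exists_primitive_ae h2
  exact ⟨F, hF, h1.congr (ae_eq_refl _) hae, h2.congr hae (ae_eq_refl _)⟩

/-- The continuous derivative of a potential. -/
def IsPotential.deriv1 (hu : IsPotential u) : ℝ → ℂ := hu.exists_deriv.choose

theorem IsPotential.niceFun (hu : IsPotential u) {M : ℝ≥0} (hM : potentialNorm u ≤ M) :
    NiceFun M u hu.deriv1 (weakDeriv 2 u) := by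
  obtain ⟨h1, h2, h3⟩ := hu.exists_deriv.choose_spec
  exact NiceFun.of_potentialNorm_le hu.continuous h1 h2 h3 (hu.hasWeakDeriv le_rfl) hM

theorem IsPotential.niceFun_sub {w : ℝ → ℂ} (hu : IsPotential u) (hw : IsPotential w) {N : ℝ≥0}
    (hN : potentialNorm (u - w) ≤ N) :
    NiceFun N (fun x => u x - w x) (fun x => hu.deriv1 x - hw.deriv1 x)
      (fun x => weakDeriv 2 u x - weakDeriv 2 w x) := by
  obtain ⟨h1, h2, h3⟩ := hu.exists_deriv.choose_spec
  obtain ⟨k1, k2, k3⟩ := hw.exists_deriv.choose_spec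
  exact NiceFun.of_potentialNorm_le (hu.continuous.sub hw.continuous) (h1.sub k1) (h2.sub k2)
    (h3.sub k3) ((hu.hasWeakDeriv le_rfl).sub (hw.hasWeakDeriv le_rfl)) hN

/-- The nonlocal reduction preserves the bounds for potentials. -/
theorem NiceFun.nonlocalConj {σ : ℝ} (hσ : σ = 1 ∨ σ = -1) {M : ℝ≥0} {u u1 u2 : ℝ → ℂ}
    (h : NiceFun M u u1 u2) :
    NiceFun M (nonlocalConj σ u) (fun x => -NDNLS.nonlocalConj σ u1 x)
      (NDNLS.nonlocalConj σ u2) := by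
  have hc : ‖Complex.I * σ‖ = 1 := by rcases hσ with rfl | rfl <;> simp
  have := h.comp_neg.star.const_mul hc
  simp only [map_neg, mul_neg] at this
  exact this

end

/-! ### The Jost integral equations in scalar form -/

/-- The scalar version of `integralFrom`. -/
def scalarFrom : LineEnd → ℝ → (ℝ → ℂ) → ℂ
  | .minus, x, f => ∫ y in Set.Iic x, f y
  | .plus, x, f => -∫ y in Set.Ioi x, f y

theorem integralFrom_apply (s : LineEnd) (x : ℝ) {f : ℝ → Fin 2 → ℂ}
    (hf : ∀ i, Integrable fun y => f y i) (i : Fin 2) :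
    integralFrom s x f i = scalarFrom s x fun y => f y i := by
  cases s
  · exact eval_integral (fun i => (hf i).integrableOn) i
  · simp only [integralFrom, scalarFrom, Pi.neg_apply]
    rw [eval_integral fun i => (hf i).integrableOn]

theorem scalarFrom_congr_ae (s : LineEnd) (x : ℝ) {f g : ℝ → ℂ} (h : f =ᵐ[volume] g) :
    scalarFrom s x f = scalarFrom s x g := by
  cases s <;> simp only [scalarFrom] <;> rw [integral_congr_ae (ae_restrict_of_ae h)]

theorem scalarFrom_plus_neg (x : ℝ) (f : ℝ → ℂ) :
    scalarFrom .plus (-x) f = scalarFrom .minus x fun y => -f (-y) := by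
  simp only [scalarFrom]
  rw [integral_neg, integral_comp_neg_Iic x f]

/-- Scalar form of the integral equations for a normalized Jost solution with coefficient matrix
`[[-D, U], [V, D]]`; the first component is the one normalized to `1`. -/
def IsJostSol (s : LineEnd) (z : ℝ) (D U V f g : ℝ → ℂ) : Prop :=
  MemLp f ⊤ volume ∧ MemLp g ⊤ volume ∧
    (∀ x, f x = 1 + scalarFrom s x fun y => -(D y * f y) + U y * g y) ∧
    ∀ x, g x = scalarFrom s x fun y => osc z (x - y) * (V y * f y + D y * g y)

theorem memLp_comp_neg {f : ℝ → ℂ} (hf : MemLp f ⊤ volume) : MemLp (fun x => f (-x)) ⊤ volume :=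
  hf.comp_measurePreserving (Measure.measurePreserving_neg (volume : Measure ℝ))

theorem osc_neg_arg (z x : ℝ) : osc z (-x) = osc (-z) x := by
  unfold osc
  congr 3
  ring

theorem osc_sub (z x y : ℝ) : osc z (x - y) = osc z x * osc (-z) y := by
  unfold osc
  rw [← Complex.exp_add]
  congr 1
  push_cast
  ring

/-- Reflection of the line interchanges the two normalizations and changes the signs of `z` and of
the coefficients. -/
theorem IsJostSol.reflect {z : ℝ} {D U V f g : ℝ → ℂ} (h : IsJostSol .plus z D U V f g) :
    IsJostSol .minus (-z) (fun x => -D (-x)) (fun x => -U (-x)) (fun x => -V (-x))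
      (fun x => f (-x)) fun x => g (-x) := by
  obtain ⟨h1, h2, h3, h4⟩ := h
  refine ⟨memLp_comp_neg h1, memLp_comp_neg h2, fun x => ?_, fun x => ?_⟩
  · beta_reduce
    rw [h3, scalarFrom_plus_neg]
    congr 2 with y
    ring
  · beta_reduce
    rw [h4, scalarFrom_plus_neg]
    congr 1 with y
    rw [show -x - -y = -(x - y) by ring, osc_neg_arg]
    ring

theorem IsJostSol.of_reflect {z : ℝ} {D U V f g : ℝ → ℂ} (h : IsJostSol .minus (-z)
    (fun x => -D (-x)) (fun x => -U (-x)) (fun x => -V (-x)) f g) :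
    IsJostSol .plus z D U V (fun x => f (-x)) fun x => g (-x) := by
  obtain ⟨h1, h2, h3, h4⟩ := h
  refine ⟨memLp_comp_neg h1, memLp_comp_neg h2, fun x => ?_, fun x => ?_⟩
  · beta_reduce
    rw [h3]
    have := scalarFrom_plus_neg (-x) fun y => -(D y * f (-y)) + U y * g (-y)
    rw [neg_neg] at this
    rw [this]
    congr 2 with y
    rw [neg_neg]
    ring
  · beta_reduce
    rw [h4]
    have := scalarFrom_plus_neg (-x) fun y => osc z (x - y) * (V y * f (-y) + D y * g (-y))
    rw [neg_neg] at this
    rw [this]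
    congr 1 with y
    rw [neg_neg, show x - -y = -(-x - y) by ring, osc_neg_arg]
    ring

namespace Pair
variable {P : Pair} {M : ℝ≥0}

/-- The constructed Jost solution is the only solution of the integral equations normalized at
`-∞`; the two formulations differ by the factor `e^{2izx}` in the second component. -/
theorem Good.isJostSol_iff (h : P.Good M) (z : ℝ) (f g : ℝ → ℂ) :
    IsJostSol .minus z P.D P.U P.V f g ↔
      f = P.m z ∧ g = fun x => osc z x * P.g z x := by
  have hs := h.smallSystem z
  constructor
  · rintro ⟨h1, h2, h3, h4⟩
    set g' : ℝ → ℂ := fun x => osc (-z) x * g x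
    have hg : ∀ x, g x = osc z x * g' x := fun x => by
      simp only [g']
      rw [← mul_assoc, osc_mul_osc_neg, one_mul]
    have hg' : MemLp g' ⊤ volume :=
      h2.of_le ((continuous_osc_right (-z)).aestronglyMeasurable.mul h2.1)
        (Eventually.of_forall fun x => by simp only [g']; rw [norm_mul, norm_osc, one_mul])
    have k1 : ∀ x, f x = 1 + ∫ y in Set.Iic x, (-(P.D y * f y) + osc z y * P.U y * g' y) := by
      intro x
      rw [h3]
      simp only [scalarFrom]
      congr 2 with y
      rw [hg]
      ring
    have k2 : ∀ x, g' x = ∫ y in Set.Iic x, (osc (-z) y * P.V y * f y + P.D y * g' y) := by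
      intro x
      simp only [g']
      rw [h4]
      simp only [scalarFrom]
      rw [← integral_const_mul]
      congr 1 with y
      rw [osc_sub]
      linear_combination (osc (-z) y * (P.V y * f y + P.D y * g y)) * osc_mul_osc_neg z x
    obtain ⟨e1, e2⟩ := hs.unique h1 hg' k1 k2
    refine ⟨e1, funext fun x => ?_⟩
    rw [hg, e2]
    rfl
  · rintro ⟨rfl, rfl⟩
    have hb : ∀ w : ℝ →ᵇ ℂ, MemLp w ⊤ volume := fun w =>
      memLp_top_of_bound w.continuous.aestronglyMeasurable ‖w‖
        (Eventually.of_forall w.norm_coe_le_norm)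
    refine ⟨hb _, ?_, fun x => ?_, fun x => ?_⟩
    · exact (hb (P.g z)).of_le
        ((continuous_osc_right z).mul (P.g z).continuous).aestronglyMeasurable
        (Eventually.of_forall fun x => by rw [norm_mul, norm_osc, one_mul])
    · rw [h.m_eq]
      simp only [scalarFrom]
      congr 2 with y
      rw [dm]
      ring
    · simp only [h.g_eq z x, scalarFrom]
      rw [← integral_const_mul]
      congr 1 with y
      rw [osc_sub, dg]
      linear_combination -(osc z x * P.D y * P.g z y) * osc_mul_osc_neg z y

/-- The pair with the roles of the potentials interchanged, so that the Jost solutions `ν` become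
Jost solutions `μ`. -/
def swap (P : Pair) : Pair where
  u := P.v
  u1 := P.v1
  u2 := P.v2
  v x := -P.u x
  v1 x := -P.u1 x
  v2 x := -P.u2 x

/-- The reflected pair, which interchanges the two ends of the line. -/
def refl (P : Pair) : Pair where
  u x := -P.u (-x)
  u1 x := P.u1 (-x)
  u2 x := -P.u2 (-x)
  v x := P.v (-x)
  v1 x := -P.v1 (-x)
  v2 x := P.v2 (-x)

theorem refl_D (P : Pair) : P.refl.D = fun x => -P.D (-x) := by
  ext x
  simp only [D, refl]
  ring

theorem refl_U (P : Pair) : P.refl.U = fun x => -P.U (-x) := by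
  ext x
  simp only [U, refl]
  ring

theorem refl_V (P : Pair) : P.refl.V = fun x => -P.V (-x) := by
  ext x
  simp only [V, refl]
  ring

theorem _root_.NDNLS.NiceFun.neg {u u1 u2 : ℝ → ℂ} (h : NiceFun M u u1 u2) :
    NiceFun M (fun x => -u x) (fun x => -u1 x) (fun x => -u2 x) := by
  simpa using h.const_mul (c := -1) (by simp)

theorem Good.refl (h : P.Good M) : P.refl.Good M := by
  refine ⟨?_, h.niceV.comp_neg, ?_⟩
  · have := h.niceU.comp_neg.neg
    simp only [neg_neg] at this
    exact this
  · rw [refl_D, refl_U, refl_V]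
    simp only [norm_neg]
    rw [integral_neg_eq_self fun x => ‖P.D x‖, integral_neg_eq_self fun x => ‖P.U x‖,
      integral_neg_eq_self fun x => ‖P.V x‖]
    exact h.small

/-- The Jost solution normalized at `+∞` in terms of the reflected pair. -/
theorem Good.isJostSol_plus_iff (h : P.Good M) (z : ℝ) (f g : ℝ → ℂ) :
    IsJostSol .plus z P.D P.U P.V f g ↔
      f = (fun x => P.refl.m (-z) (-x)) ∧ g = fun x => osc z x * P.refl.g (-z) (-x) := by
  have key := h.refl.isJostSol_iff (-z)
  rw [refl_D, refl_U, refl_V] at key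
  constructor
  · intro hs
    obtain ⟨e1, e2⟩ := (key _ _).1 hs.reflect
    refine ⟨funext fun x => ?_, funext fun x => ?_⟩
    · have := congrFun e1 (-x)
      rwa [neg_neg] at this
    · have := congrFun e2 (-x)
      simp only [neg_neg] at this
      rw [this, osc_neg_arg, neg_neg]
  · rintro ⟨rfl, rfl⟩
    have := ((key (P.refl.m (-z)) _).2 ⟨rfl, rfl⟩).of_reflect
    simp only [osc_neg_arg, neg_neg] at this
    exact this

/-- The first component of the Jost solution normalized at a given end of the line. -/
def jm (P : Pair) : LineEnd → ℝ → ℝ → ℂ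
  | .minus, z, x => P.m z x
  | .plus, z, x => P.refl.m (-z) (-x)

/-- The second component of the Jost solution normalized at a given end of the line. -/
def jg (P : Pair) : LineEnd → ℝ → ℝ → ℂ
  | .minus, z, x => osc z x * P.g z x
  | .plus, z, x => osc z x * P.refl.g (-z) (-x)

/-- The Jost solution normalized at either end is the only solution of its integral equations. -/
theorem Good.isJostSol_iff' (h : P.Good M) (s : LineEnd) (z : ℝ) (f g : ℝ → ℂ) :
    IsJostSol s z P.D P.U P.V f g ↔ f = P.jm s z ∧ g = P.jg s z := by
  cases s
  · exact h.isJostSol_iff z f g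
  · exact h.isJostSol_plus_iff z f g

/-! ### Wronskians -/

theorem hasDerivAt_comp_neg {f : ℝ → ℂ} {f' : ℂ} {x : ℝ} (h : HasDerivAt f f' (-x)) :
    HasDerivAt (fun x => f (-x)) (-f') x := by
  simpa [Function.comp_def] using h.scomp x (hasDerivAt_neg x)

/-- `(m, χ)` solves the spectral problem in the variables `(μ₁, μ₂ - v μ₁)`, in which the
coefficients contain no derivative of the potentials. -/
structure IsLax (P : Pair) (z : ℝ) (m χ : ℝ → ℂ) : Prop where
  hasDerivAt_fst : ∀ x, HasDerivAt m (P.u x / (2 * Complex.I) * χ x) x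
  hasDerivAt_snd : ∀ x, HasDerivAt χ (2 * Complex.I * z * (χ x + P.v x * m x)) x

/-- The combination `χ = μ₂ - v μ₁` for the Jost solution normalized at a given end of the line. -/
def jchi (P : Pair) (s : LineEnd) (z x : ℝ) : ℂ := P.jg s z x - P.v x * P.jm s z x

theorem jchi_plus (P : Pair) (z x : ℝ) : P.jchi .plus z x = P.refl.chi (-z) (-x) := by
  simp only [jchi, jg, jm, chi, refl, neg_neg, osc_neg_arg]

/-- The Jost solutions satisfy a linear system without derivatives of the potentials. -/
theorem Good.isLax (h : P.Good M) (s : LineEnd) (z : ℝ) : P.IsLax z (P.jm s z) (P.jchi s z) := by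
  cases s
  · exact ⟨h.hasDerivAt_m z, h.hasDerivAt_chi z⟩
  · refine ⟨fun x => ?_, fun x => ?_⟩
    · refine (hasDerivAt_comp_neg (h.refl.hasDerivAt_m (-z) (-x))).congr_deriv ?_
      rw [← jchi_plus]
      simp only [Pair.refl, neg_neg]
      ring
    · have e : P.jchi .plus z = fun x => P.refl.chi (-z) (-x) := funext (P.jchi_plus z)
      rw [e]
      refine (hasDerivAt_comp_neg (h.refl.hasDerivAt_chi (-z) (-x))).congr_deriv ?_
      simp only [Pair.refl, neg_neg, jm]
      push_cast
      ring

theorem eq_of_hasDerivAt_zero {f : ℝ → ℂ} (h : ∀ x, HasDerivAt f 0 x) {l : ℂ}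
    (hl : Tendsto f atTop (𝓝 l)) (x : ℝ) : f x = l := by
  have hc : ∀ y, f y = f x := fun y => is_const_of_deriv_eq_zero
    (fun x => (h x).differentiableAt) (fun x => (h x).deriv) y x
  rw [funext hc] at hl
  exact tendsto_nhds_unique tendsto_const_nhds hl

/-- Constancy of the Wronskian of two solutions for the same pair. -/
theorem IsLax.wronskian_self {z : ℝ} {m χ m' χ' : ℝ → ℂ} (h : P.IsLax z m χ)
    (h' : P.IsLax z m' χ') {l : ℂ}
    (hl : Tendsto (fun x => osc (-z) x * (m x * χ' x - χ x * m' x)) atTop (𝓝 l)) (x : ℝ) :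
    osc (-z) x * (m x * χ' x - χ x * m' x) = l := by
  refine eq_of_hasDerivAt_zero (fun x => ?_) hl x
  refine ((hasDerivAt_osc (-z) x).mul (((h.1 x).mul (h'.2 x)).sub ((h.2 x).mul
    (h'.1 x)))).congr_deriv ?_
  simp only [Pi.sub_apply, Pi.mul_apply]
  push_cast
  ring

/-- Constancy of the Wronskian of a solution for a pair at `z` and a solution for the interchanged
pair at `-z`; the factor `4z` is `-(2ik)²`. -/
theorem IsLax.wronskian_swap {z : ℝ} (hz : z ≠ 0) {m χ n w : ℝ → ℂ} (h : P.IsLax z m χ)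
    (h' : P.swap.IsLax (-z) n w) {l : ℂ}
    (hl : Tendsto (fun x => m x * n x + χ x * w x / (4 * z)) atTop (𝓝 l)) (x : ℝ) :
    m x * n x + χ x * w x / (4 * z) = l := by
  have hz' : (z : ℂ) ≠ 0 := by exact_mod_cast hz
  refine eq_of_hasDerivAt_zero (fun x => ?_) hl x
  refine (((h.1 x).mul (h'.1 x)).add (((h.2 x).mul (h'.2 x)).div_const (4 * z))).congr_deriv ?_
  simp only [swap]
  push_cast
  field_simp
  linear_combination (P.u x * χ x * n x + P.v x * m x * w x) * (4 : ℂ) * Complex.I_sq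

end Pair

namespace Pair
variable {P : Pair} {M : ℝ≥0}

theorem Good.norm_jm_le (h : P.Good M) (s : LineEnd) (z x : ℝ) : ‖P.jm s z x‖ ≤ 3 / 2 := by
  cases s
  · exact h.norm_m_le z x
  · exact h.refl.norm_m_le _ _

theorem Good.norm_jchi_le (h : P.Good M) (s : LineEnd) (z x : ℝ) :
    ‖P.jchi s z x‖ ≤ 3 / 2 + 3 * M := by
  cases s
  · exact h.norm_chi_le z x
  · rw [jchi_plus]
    exact h.refl.norm_chi_le _ _

theorem Good.tendsto_jm_plus (h : P.Good M) (z : ℝ) : Tendsto (P.jm .plus z) atTop (𝓝 1) :=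
  (h.refl.tendsto_m_atBot (-z)).comp tendsto_neg_atTop_atBot

theorem Good.tendsto_jchi_plus (h : P.Good M) (z : ℝ) : Tendsto (P.jchi .plus z) atTop (𝓝 0) := by
  rw [funext (P.jchi_plus z)]
  exact (h.refl.tendsto_chi_atBot (-z)).comp tendsto_neg_atTop_atBot

theorem tendsto_mul_zero_of_norm_le {f g : ℝ → ℂ} {c : ℝ} (hf : Tendsto f atTop (𝓝 0))
    (hg : ∀ x, ‖g x‖ ≤ c) : Tendsto (fun x => f x * g x) atTop (𝓝 0) := by
  refine squeeze_zero_norm (a := fun x => ‖f x‖ * c) (fun x => ?_) (by simpa using hf.norm.mul_const c)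
  rw [norm_mul]
  gcongr
  exact hg x

/-- The Wronskian of the solutions `μ` normalized at the two ends. -/
theorem Good.wronskian_plus_minus (h : P.Good M) (z x : ℝ) :
    osc (-z) x * (P.jm .plus z x * P.jchi .minus z x - P.jchi .plus z x * P.jm .minus z x)
      = 2 * Complex.I * z * P.beta z := by
  refine (h.isLax .plus z).wronskian_self (h.isLax .minus z) ?_ x
  have h1 := (h.tendsto_jm_plus z).mul (h.tendsto_osc_chi_atTop z)
  have h2 : Tendsto (fun x => P.jchi .plus z x * (osc (-z) x * P.jm .minus z x)) atTop (𝓝 0) :=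
    tendsto_mul_zero_of_norm_le (h.tendsto_jchi_plus z) (c := 3 / 2) fun x => by
      rw [norm_mul, norm_osc, one_mul]
      exact h.norm_jm_le _ _ _
  have h3 := h1.sub h2
  rw [one_mul, sub_zero] at h3
  refine h3.congr fun x => ?_
  simp only [jchi, jm, jg, chi]
  ring

variable (h : P.Good M) (hS : P.swap.Good M) {z : ℝ} (hz : z ≠ 0)
include h hS hz

theorem Good.wronskian_minus_plus (x : ℝ) :
    P.jm .minus z x * P.swap.jm .plus (-z) x + P.jchi .minus z x * P.swap.jchi .plus (-z) x / (4 * z)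
      = P.alpha z := by
  refine (h.isLax .minus z).wronskian_swap hz (hS.isLax .plus (-z)) ?_ x
  have h1 := (h.tendsto_m_atTop z).mul (hS.tendsto_jm_plus (-z))
  have h2 := (tendsto_mul_zero_of_norm_le (hS.tendsto_jchi_plus (-z))
    (h.norm_jchi_le .minus z)).div_const (4 * (z : ℂ))
  have h3 := h1.add h2
  rw [zero_div, add_zero, mul_one] at h3
  refine h3.congr fun x => ?_
  rw [mul_comm (P.swap.jchi _ _ _)]
  rfl

theorem Good.wronskian_plus_minus_swap (x : ℝ) :
    P.jm .plus z x * P.swap.jm .minus (-z) x + P.jchi .plus z x * P.swap.jchi .minus (-z) x / (4 * z)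
      = P.swap.alpha (-z) := by
  refine (h.isLax .plus z).wronskian_swap hz (hS.isLax .minus (-z)) ?_ x
  have h1 := (h.tendsto_jm_plus z).mul (hS.tendsto_m_atTop (-z))
  have h2 := (tendsto_mul_zero_of_norm_le (h.tendsto_jchi_plus z)
    (hS.norm_jchi_le .minus (-z))).div_const (4 * (z : ℂ))
  have h3 := h1.add h2
  rw [zero_div, add_zero, one_mul] at h3
  exact h3

theorem Good.wronskian_plus_plus (x : ℝ) :
    P.jm .plus z x * P.swap.jm .plus (-z) x + P.jchi .plus z x * P.swap.jchi .plus (-z) x / (4 * z)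
      = 1 := by
  refine (h.isLax .plus z).wronskian_swap hz (hS.isLax .plus (-z)) ?_ x
  have h1 := (h.tendsto_jm_plus z).mul (hS.tendsto_jm_plus (-z))
  have h2 := (tendsto_mul_zero_of_norm_le (h.tendsto_jchi_plus z)
    (hS.norm_jchi_le .plus (-z))).div_const (4 * (z : ℂ))
  have h3 := h1.add h2
  rw [zero_div, add_zero, one_mul] at h3
  exact h3

end Pair

/-! ### The pair of a potential -/

section
variable {σ : ℝ} {u : ℝ → ℂ} {M : ℝ≥0}

/-- The pair `(u, v)` with `v(x) = iσ conj (u(-x))`. -/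
def IsPotential.pair (hu : IsPotential u) (σ : ℝ) : Pair where
  u := u
  u1 := hu.deriv1
  u2 := weakDeriv 2 u
  v := nonlocalConj σ u
  v1 x := -nonlocalConj σ hu.deriv1 x
  v2 := nonlocalConj σ (weakDeriv 2 u)

variable (hσ : σ = 1 ∨ σ = -1) (hu : IsPotential u)

theorem IsPotential.weakDeriv_ae : weakDeriv 1 u =ᵐ[volume] hu.deriv1 :=
  weakDeriv_ae_eq hu.exists_deriv.choose_spec.2.1

include hσ in
theorem IsPotential.nice_pair (hM : potentialNorm u ≤ M) : (hu.pair σ).Nice M :=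
  ⟨hu.niceFun hM, (hu.niceFun hM).nonlocalConj hσ⟩

include hσ in
theorem IsPotential.exists_nice : ∃ M, (hu.pair σ).Nice M :=
  ⟨_, hu.nice_pair hσ (ENNReal.coe_toNNReal hu.potentialNorm_lt_top.ne).ge⟩

include hσ in
theorem IsPotential.weakDeriv_nonlocalConj_ae :
    weakDeriv 1 (nonlocalConj σ u) =ᵐ[volume] (hu.pair σ).v1 := by
  obtain ⟨M, hM⟩ := hu.exists_nice hσ
  exact weakDeriv_ae_eq (HasWeakDeriv.of_hasDerivAt hM.niceV.hasDerivAt hM.niceV.continuous_deriv)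

theorem Q1_apply (x : ℝ) : Q1 σ u x 0 0 = -(hu.pair σ).D x ∧ Q1 σ u x 0 1 = (hu.pair σ).U x ∧
    Q1 σ u x 1 1 = (hu.pair σ).D x := by
  simp only [Q1, Pair.D, Pair.U, IsPotential.pair, Matrix.smul_apply, Matrix.of_apply,
    Matrix.cons_val', Matrix.cons_val_zero, Matrix.cons_val_one, Matrix.cons_val_fin_one,
    smul_eq_mul]
  refine ⟨?_, ?_, ?_⟩ <;> ring

include hσ in
theorem Q1_apply_ae : (fun x => Q1 σ u x 1 0) =ᵐ[volume] (hu.pair σ).V := by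
  filter_upwards [hu.weakDeriv_nonlocalConj_ae hσ] with x hx
  simp only [Q1, Pair.V, Matrix.smul_apply, Matrix.of_apply, hx,
    Matrix.cons_val', Matrix.cons_val_zero, Matrix.cons_val_one, Matrix.cons_val_fin_one,
    smul_eq_mul]
  simp only [IsPotential.pair]
  ring

theorem Q2_apply (x : ℝ) : Q2 σ u x 0 0 = (hu.pair σ).swap.D x ∧
    Q2 σ u x 1 0 = (hu.pair σ).swap.U x ∧ Q2 σ u x 1 1 = -(hu.pair σ).swap.D x := by
  simp only [Q2, Pair.D, Pair.U, Pair.swap, IsPotential.pair, Matrix.smul_apply, Matrix.of_apply,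
    Matrix.cons_val', Matrix.cons_val_zero, Matrix.cons_val_one, Matrix.cons_val_fin_one,
    smul_eq_mul]
  refine ⟨?_, ?_, ?_⟩ <;> ring

theorem Q2_apply_ae : (fun x => Q2 σ u x 0 1) =ᵐ[volume] (hu.pair σ).swap.V := by
  filter_upwards [hu.weakDeriv_ae] with x hx
  simp only [Q2, Pair.V, Matrix.smul_apply, Matrix.of_apply, hx,
    Matrix.cons_val', Matrix.cons_val_zero, Matrix.cons_val_one, Matrix.cons_val_fin_one,
    smul_eq_mul]
  simp only [Pair.swap, IsPotential.pair]
  ring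

include hσ in
/-- The small norm condition in terms of the coefficients of the pair. -/
theorem IsPotential.small (hs : SmallNorm σ u) :
    2 * (∫ y, ‖(hu.pair σ).D y‖) + (∫ y, ‖(hu.pair σ).U y‖) + (∫ y, ‖(hu.pair σ).V y‖) ≤ 0.295 := by
  obtain ⟨M, hM⟩ := hu.exists_nice hσ
  have iD := Pair.integrable_D hM.niceU hM.niceV
  have iU := Pair.integrable_U hM.niceU
  have iV := Pair.integrable_V hM.niceU hM.niceV
  have e1 : ∀ {f : ℝ → ℂ}, Integrable f → eLpNorm f 1 volume = ENNReal.ofReal (∫ y, ‖f y‖) :=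
    fun hf => by rw [eLpNorm_one_eq_lintegral_enorm, ofReal_integral_norm_eq_lintegral_enorm hf]
  have h0 : ∀ f : ℝ → ℂ, 0 ≤ ∫ y, ‖f y‖ := fun f => integral_nonneg fun _ => norm_nonneg _
  have e00 : (fun x => Q1 σ u x 0 0) = -(hu.pair σ).D := funext fun x => (Q1_apply hu x).1
  have e01 : (fun x => Q1 σ u x 0 1) = (hu.pair σ).U := funext fun x => (Q1_apply hu x).2.1
  have e11 : (fun x => Q1 σ u x 1 1) = (hu.pair σ).D := funext fun x => (Q1_apply hu x).2.2
  rw [SmallNorm, matrixL1Norm, Fin.sum_univ_two, Fin.sum_univ_two, Fin.sum_univ_two, e00, e01, e11,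
    eLpNorm_congr_ae (Q1_apply_ae hσ hu), eLpNorm_neg, e1 iD, e1 iU, e1 iV,
    ← ENNReal.ofReal_add (h0 _) (h0 _), ← ENNReal.ofReal_add (h0 _) (h0 _),
    ← ENNReal.ofReal_add (add_nonneg (h0 _) (h0 _)) (add_nonneg (h0 _) (h0 _)),
    ENNReal.ofReal_le_ofReal_iff (by norm_num)] at hs
  linarith

include hσ in
/-- By the symmetry of the nonlocal reduction the coefficients of the interchanged pair have the
same `L¹` norms. -/
theorem IsPotential.small_swap (hs : SmallNorm σ u) :
    2 * (∫ y, ‖(hu.pair σ).swap.D y‖) + (∫ y, ‖(hu.pair σ).swap.U y‖)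
      + (∫ y, ‖(hu.pair σ).swap.V y‖) ≤ 0.295 := by
  have hσ2 : (σ : ℂ) ^ 2 = 1 := by rcases hσ with rfl | rfl <;> simp
  have hc : ‖Complex.I * σ‖ = 1 := by rcases hσ with rfl | rfl <;> simp
  have eD : ∀ x, ‖(hu.pair σ).swap.D x‖ = ‖(hu.pair σ).D x‖ := fun x => by
    rw [← norm_neg]
    congr 1
    simp only [Pair.D, Pair.swap]
    ring
  have eU : ∀ x, ‖(hu.pair σ).swap.U x‖ = ‖(hu.pair σ).U (-x)‖ := fun x => by
    simp only [Pair.U, Pair.swap, IsPotential.pair, nonlocalConj, norm_div, norm_mul _ (starRingEnd ℂ _),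
      hc, one_mul, RCLike.norm_conj]
  have eV : ∀ x, ‖(hu.pair σ).swap.V x‖ = ‖(hu.pair σ).V (-x)‖ := fun x => by
    have : (hu.pair σ).V (-x) = Complex.I * σ * starRingEnd ℂ ((hu.pair σ).swap.V x) := by
      simp only [Pair.V_eq, Pair.swap, IsPotential.pair, nonlocalConj, neg_neg, map_sub, map_neg,
        map_mul, map_div₀, map_pow, Complex.conj_I, Complex.conj_ofReal, Complex.conj_conj,
        map_ofNat]
      field_simp
    rw [this, norm_mul, hc, one_mul, RCLike.norm_conj]
  simp only [eD, eU, eV]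
  rw [integral_neg_eq_self fun x => ‖(hu.pair σ).U x‖,
    integral_neg_eq_self fun x => ‖(hu.pair σ).V x‖]
  exact hu.small hσ hs

theorem Pair.Nice.swap {P : Pair} (h : P.Nice M) : P.swap.Nice M := ⟨h.niceV, h.niceU.neg⟩

include hσ in
theorem IsPotential.good (hM : potentialNorm u ≤ M) (hs : SmallNorm σ u) :
    (hu.pair σ).Good M := by
  have h := hu.nice_pair hσ hM
  refine ⟨h.niceU, h.niceV, (hu.small hσ hs).trans (by norm_num)⟩

include hσ in
theorem IsPotential.good_swap (hM : potentialNorm u ≤ M) (hs : SmallNorm σ u) :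
    (hu.pair σ).swap.Good M := by
  have h := (hu.nice_pair hσ hM).swap
  refine ⟨h.niceU, h.niceV, (hu.small_swap hσ hs).trans (by norm_num)⟩

theorem exp_eq_osc (z x y : ℝ) : Complex.exp (2 * Complex.I * z * (x - y)) = osc z (x - y) := by
  unfold osc
  congr 1
  push_cast
  ring

theorem exp_neg_eq_osc (z x y : ℝ) :
    Complex.exp (-(2 * Complex.I * z * (x - y))) = osc (-z) (x - y) := by
  rw [← exp_eq_osc]
  congr 1
  push_cast
  ring

theorem memLp_fin_two_iff {f : ℝ → Fin 2 → ℂ} :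
    MemLp f ⊤ volume ↔ MemLp (fun x => f x 0) ⊤ volume ∧ MemLp (fun x => f x 1) ⊤ volume := by
  rw [memLp_pi_iff, Fin.forall_fin_two]

theorem integrable_mul_memLp_top {q w : ℝ → ℂ} (hq : Integrable q) (hw : MemLp w ⊤ volume) :
    Integrable fun y => q y * w y :=
  memLp_one_iff_integrable.1 (hw.mul (memLp_one_iff_integrable.2 hq))

theorem integrable_osc_sub {q : ℝ → ℂ} (hq : Integrable q) (z x : ℝ) :
    Integrable fun y => osc z (x - y) * q y := by
  simp only [osc_sub, mul_assoc]
  exact (integrable_osc_mul hq _).const_mul _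

include hσ in
/-- The integral equations for `μ` in scalar form. -/
theorem isJostMu_iff (s : LineEnd) (z : ℝ) (f : ℝ → Fin 2 → ℂ) : IsJostMu σ u s z f ↔
    IsJostSol s z (hu.pair σ).D (hu.pair σ).U (hu.pair σ).V (fun x => f x 0) fun x => f x 1 := by
  obtain ⟨M, hM⟩ := hu.exists_nice hσ
  have iD := Pair.integrable_D hM.niceU hM.niceV
  have iU := Pair.integrable_U hM.niceU
  have iV := Pair.integrable_V hM.niceU hM.niceV
  rw [IsJostMu, IsJostSol, memLp_fin_two_iff, and_assoc]
  refine and_congr_right fun h0 => and_congr_right fun h1 => ?_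
  rw [← forall_and]
  refine forall_congr' fun x => ?_
  have c0 : ∀ y : ℝ, (Matrix.diagonal ![1, Complex.exp (2 * Complex.I * z * (x - y))]
      * Q1 σ u y).mulVec (f y) 0 = -((hu.pair σ).D y * f y 0) + (hu.pair σ).U y * f y 1 := by
    intro y
    obtain ⟨q1, q2, -⟩ := Q1_apply (σ := σ) hu y
    simp [Matrix.mulVec, dotProduct, Fin.sum_univ_two, Matrix.diagonal_mul, q1, q2]
  have c1 : (fun y : ℝ => (Matrix.diagonal ![1, Complex.exp (2 * Complex.I * z * (x - y))]
      * Q1 σ u y).mulVec (f y) 1) =ᵐ[volume] fun y : ℝ =>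
        osc z (x - y) * ((hu.pair σ).V y * f y 0 + (hu.pair σ).D y * f y 1) := by
    filter_upwards [Q1_apply_ae hσ hu] with y hy
    obtain ⟨-, -, q3⟩ := Q1_apply (σ := σ) hu y
    simp only [Matrix.mulVec, dotProduct, Fin.sum_univ_two, Matrix.diagonal_mul, q3, hy,
      Matrix.cons_val_one, Matrix.cons_val_fin_one, exp_eq_osc]
    ring
  have hint : ∀ i, Integrable fun y : ℝ => (Matrix.diagonal ![1, Complex.exp
      (2 * Complex.I * z * (x - y))] * Q1 σ u y).mulVec (f y) i := by
    rw [Fin.forall_fin_two]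
    constructor
    · simp only [c0]
      exact (integrable_mul_memLp_top iD h0).neg.add (integrable_mul_memLp_top iU h1)
    · refine Integrable.congr ?_ c1.symm
      exact integrable_osc_sub ((integrable_mul_memLp_top iV h0).add
        (integrable_mul_memLp_top iD h1)) z x
  rw [funext_iff, Fin.forall_fin_two, Pi.add_apply, Pi.add_apply, integralFrom_apply s x hint,
    integralFrom_apply s x hint, scalarFrom_congr_ae s x c1]
  simp only [c0]
  simp [NDNLS.e1]

include hσ in
/-- The integral equations for `ν` are those for `μ`, for the interchanged pair and `-z`. -/
theorem isJostNu_iff (s : LineEnd) (z : ℝ) (f : ℝ → Fin 2 → ℂ) : IsJostNu σ u s z f ↔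
    IsJostSol s (-z) (hu.pair σ).swap.D (hu.pair σ).swap.U (hu.pair σ).swap.V
      (fun x => f x 1) fun x => f x 0 := by
  obtain ⟨M, hM⟩ := hu.exists_nice hσ
  have iD := Pair.integrable_D hM.swap.niceU hM.swap.niceV
  have iU := Pair.integrable_U hM.swap.niceU
  have iV := Pair.integrable_V hM.swap.niceU hM.swap.niceV
  rw [IsJostNu, IsJostSol, memLp_fin_two_iff, and_comm (a := MemLp (fun x => f x 0) ⊤ volume),
    and_assoc]
  refine and_congr_right fun h1 => and_congr_right fun h0 => ?_
  rw [← forall_and]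
  refine forall_congr' fun x => ?_
  have c0 : ∀ y : ℝ, (Matrix.diagonal ![Complex.exp (-(2 * Complex.I * z * (x - y))), 1]
      * Q2 σ u y).mulVec (f y) 1
        = -((hu.pair σ).swap.D y * f y 1) + (hu.pair σ).swap.U y * f y 0 := by
    intro y
    obtain ⟨-, q2, q3⟩ := Q2_apply (σ := σ) hu y
    simp [Matrix.mulVec, dotProduct, Fin.sum_univ_two, Matrix.diagonal_mul, q2, q3]
    ring
  have c1 : (fun y : ℝ => (Matrix.diagonal ![Complex.exp (-(2 * Complex.I * z * (x - y))), 1]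
      * Q2 σ u y).mulVec (f y) 0) =ᵐ[volume] fun y : ℝ =>
        osc (-z) (x - y) * ((hu.pair σ).swap.V y * f y 1 + (hu.pair σ).swap.D y * f y 0) := by
    filter_upwards [Q2_apply_ae (σ := σ) hu] with y hy
    obtain ⟨q1, -, -⟩ := Q2_apply (σ := σ) hu y
    simp only [Matrix.mulVec, dotProduct, Fin.sum_univ_two, Matrix.diagonal_mul, q1, hy,
      Matrix.cons_val_zero, exp_neg_eq_osc]
    ring
  have hint : ∀ i, Integrable fun y : ℝ => (Matrix.diagonal ![Complex.exp
      (-(2 * Complex.I * z * (x - y))), 1] * Q2 σ u y).mulVec (f y) i := by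
    rw [Fin.forall_fin_two]
    constructor
    · refine Integrable.congr ?_ c1.symm
      exact integrable_osc_sub ((integrable_mul_memLp_top iV h1).add
        (integrable_mul_memLp_top iD h0)) (-z) x
    · simp only [c0]
      exact (integrable_mul_memLp_top iD h1).neg.add (integrable_mul_memLp_top iU h0)
  rw [funext_iff, Fin.forall_fin_two, Pi.add_apply, Pi.add_apply, integralFrom_apply s x hint,
    integralFrom_apply s x hint, scalarFrom_congr_ae s x c1, and_comm]
  simp only [c0]
  simp [NDNLS.e2]

end

/-! ### The scattering relation -/

section
variable {σ : ℝ} {u : ℝ → ℂ} (hσ : σ = 1 ∨ σ = -1) (hu : IsPotential u) (hs : SmallNorm σ u)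

include hσ hs in
theorem IsPotential.exists_good : ∃ M, (hu.pair σ).Good M ∧ (hu.pair σ).swap.Good M :=
  ⟨_, hu.good hσ (ENNReal.coe_toNNReal hu.potentialNorm_lt_top.ne).ge hs,
    hu.good_swap hσ (ENNReal.coe_toNNReal hu.potentialNorm_lt_top.ne).ge hs⟩

include hσ hs in
theorem isJostMu_iff_eq (s : LineEnd) (z : ℝ) (f : ℝ → Fin 2 → ℂ) : IsJostMu σ u s z f ↔
    f = fun x => ![(hu.pair σ).jm s z x, (hu.pair σ).jg s z x] := by
  obtain ⟨M, h, -⟩ := hu.exists_good hσ hs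
  rw [isJostMu_iff hσ hu, h.isJostSol_iff']
  simp only [funext_iff, Fin.forall_fin_two, ← forall_and]
  exact Iff.rfl

include hσ hs in
theorem isJostNu_iff_eq (s : LineEnd) (z : ℝ) (f : ℝ → Fin 2 → ℂ) : IsJostNu σ u s z f ↔
    f = fun x => ![(hu.pair σ).swap.jg s (-z) x, (hu.pair σ).swap.jm s (-z) x] := by
  obtain ⟨M, -, h⟩ := hu.exists_good hσ hs
  rw [isJostNu_iff hσ hu, h.isJostSol_iff', and_comm]
  simp only [funext_iff, Fin.forall_fin_two, ← forall_and]
  exact Iff.rfl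

include hσ hs in
theorem jostMu_eq (s : LineEnd) (z : ℝ) : jostMu σ u s z =
    fun x => ![(hu.pair σ).jm s z x, (hu.pair σ).jg s z x] :=
  (isJostMu_iff_eq hσ hu hs s z _).1
    (Classical.epsilon_spec ⟨_, (isJostMu_iff_eq hσ hu hs s z _).2 rfl⟩)

include hσ hs in
theorem jostNu_eq (s : LineEnd) (z : ℝ) : jostNu σ u s z =
    fun x => ![(hu.pair σ).swap.jg s (-z) x, (hu.pair σ).swap.jm s (-z) x] :=
  (isJostNu_iff_eq hσ hu hs s z _).1
    (Classical.epsilon_spec ⟨_, (isJostNu_iff_eq hσ hu hs s z _).2 rfl⟩)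

variable {k : ℂ} {z : ℝ} (hk : k ≠ 0) (hkz : k ^ 2 = z)

include hσ hs hk hkz in
/-- `φ = T₁⁻¹ μ` in the variables `(μ₁, μ₂ - v μ₁)`. -/
theorem jostPhi_eq (s : LineEnd) (x : ℝ) : jostPhi σ u s x k =
    ![(hu.pair σ).jm s z x, (hu.pair σ).jchi s z x / (2 * Complex.I * k)] := by
  have hdet : IsUnit (T1 σ u x k).det := by
    simp [T1, hk]
  have : jostMu σ u s (k ^ 2) x = (T1 σ u x k).mulVec
      ![(hu.pair σ).jm s z x, (hu.pair σ).jchi s z x / (2 * Complex.I * k)] := by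
    rw [hkz, jostMu_eq hσ hu hs]
    have hI := Complex.I_ne_zero
    ext i
    fin_cases i
    · simp [T1, Matrix.mulVec, dotProduct, Fin.sum_univ_two]
    · simp [T1, Matrix.mulVec, dotProduct, Fin.sum_univ_two, Pair.jchi]
      field_simp
      simp only [IsPotential.pair]
      ring
  rw [jostPhi, if_neg hk, this, Matrix.mulVec_mulVec, Matrix.nonsing_inv_mul _ hdet,
    Matrix.one_mulVec]

include hσ hs hk hkz in
/-- `ψ = T₂⁻¹ ν` in terms of the interchanged pair. -/
theorem jostPsi_eq (s : LineEnd) (x : ℝ) : jostPsi σ u s x k =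
    ![(hu.pair σ).swap.jchi s (-z) x / (2 * Complex.I * k), (hu.pair σ).swap.jm s (-z) x] := by
  have hdet : IsUnit (T2 u x k).det := by
    simp [T2, hk]
  have : jostNu σ u s (k ^ 2) x = (T2 u x k).mulVec
      ![(hu.pair σ).swap.jchi s (-z) x / (2 * Complex.I * k), (hu.pair σ).swap.jm s (-z) x] := by
    rw [hkz, jostNu_eq hσ hu hs]
    have hI := Complex.I_ne_zero
    ext i
    fin_cases i
    · simp [T2, Matrix.mulVec, dotProduct, Fin.sum_univ_two, Pair.jchi]
      field_simp
      simp only [IsPotential.pair, Pair.swap]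
      ring
    · simp [T2, Matrix.mulVec, dotProduct, Fin.sum_univ_two]
  rw [jostPsi, if_neg hk, this, Matrix.mulVec_mulVec, Matrix.nonsing_inv_mul _ hdet,
    Matrix.one_mulVec]

include hk hkz in
theorem ofReal_ne_zero_of_sq_eq : z ≠ 0 := by
  rintro rfl
  exact hk (by simpa using hkz)

include hσ hu hs hk hkz

theorem wronskian_phi_psi (s s' : LineEnd) (x : ℝ) :
    wronskian (jostPhi σ u s x k) (jostPsi σ u s' x k) =
      (hu.pair σ).jm s z x * (hu.pair σ).swap.jm s' (-z) x +
        (hu.pair σ).jchi s z x * (hu.pair σ).swap.jchi s' (-z) x / (4 * z) := by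
  rw [jostPhi_eq hσ hu hs hk hkz, jostPsi_eq hσ hu hs hk hkz, ← hkz, wronskian]
  have hI := Complex.I_ne_zero
  simp only [Matrix.cons_val_zero, Matrix.cons_val_one, Matrix.cons_val_fin_one]
  field_simp
  linear_combination (-4 * (hu.pair σ).jchi s z x * (hu.pair σ).swap.jchi s' (-z) x) * Complex.I_sq

theorem wronskian_phi_plus_minus (x : ℝ) :
    wronskian (jostPhi σ u .plus x k) (jostPhi σ u .minus x k) =
      osc z x * (2 * Complex.I * z * (hu.pair σ).beta z / (2 * Complex.I * k)) := by
  obtain ⟨M, h, -⟩ := hu.exists_good hσ hs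
  rw [jostPhi_eq hσ hu hs hk hkz, jostPhi_eq hσ hu hs hk hkz, ← h.wronskian_plus_minus z x,
    mul_div_assoc, ← mul_assoc, osc_mul_osc_neg, wronskian]
  simp only [Matrix.cons_val_zero, Matrix.cons_val_one, Matrix.cons_val_fin_one]
  ring

theorem wronskian_psi_minus_plus (x : ℝ) :
    wronskian (jostPsi σ u .minus x k) (jostPsi σ u .plus x k) =
      osc (-z) x * -(2 * Complex.I * z * (hu.pair σ).swap.beta (-z) / (2 * Complex.I * k)) := by
  obtain ⟨M, -, h⟩ := hu.exists_good hσ hs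
  have := h.wronskian_plus_minus (-z) x
  rw [neg_neg] at this
  rw [show 2 * Complex.I * z * (hu.pair σ).swap.beta (-z) =
    -(2 * Complex.I * (-z : ℝ) * (hu.pair σ).swap.beta (-z)) by push_cast; ring, ← this,
    jostPsi_eq hσ hu hs hk hkz, jostPsi_eq hσ hu hs hk hkz, neg_div, neg_neg,
    mul_div_assoc, ← mul_assoc, mul_comm (osc (-z) x), osc_mul_osc_neg, wronskian]
  simp only [Matrix.cons_val_zero, Matrix.cons_val_one, Matrix.cons_val_fin_one]
  ring

theorem wronskian_phi_psi_plus (x : ℝ) :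
    wronskian (jostPhi σ u .plus x k) (jostPsi σ u .plus x k) = 1 := by
  obtain ⟨M, h, hS⟩ := hu.exists_good hσ hs
  rw [wronskian_phi_psi hσ hu hs hk hkz]
  exact h.wronskian_plus_plus hS (ofReal_ne_zero_of_sq_eq hk hkz) x

theorem wronskian_phi_minus_psi_plus (x : ℝ) :
    wronskian (jostPhi σ u .minus x k) (jostPsi σ u .plus x k) = (hu.pair σ).alpha z := by
  obtain ⟨M, h, hS⟩ := hu.exists_good hσ hs
  rw [wronskian_phi_psi hσ hu hs hk hkz]
  exact h.wronskian_minus_plus hS (ofReal_ne_zero_of_sq_eq hk hkz) x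

theorem wronskian_phi_plus_psi_minus (x : ℝ) :
    wronskian (jostPhi σ u .plus x k) (jostPsi σ u .minus x k) = (hu.pair σ).swap.alpha (-z) := by
  obtain ⟨M, h, hS⟩ := hu.exists_good hσ hs
  rw [wronskian_phi_psi hσ hu hs hk hkz]
  exact h.wronskian_plus_minus_swap hS (ofReal_ne_zero_of_sq_eq hk hkz) x

theorem scatA_eq : scatA σ u k = (hu.pair σ).alpha z :=
  wronskian_phi_minus_psi_plus hσ hu hs hk hkz 0

theorem scatD_eq : scatD σ u k = (hu.pair σ).swap.alpha (-z) :=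
  wronskian_phi_plus_psi_minus hσ hu hs hk hkz 0

theorem scatB_eq : scatB σ u k = 2 * Complex.I * z * (hu.pair σ).beta z / (2 * Complex.I * k) := by
  rw [scatB, wronskian_phi_plus_minus hσ hu hs hk hkz]
  simp [osc]

theorem scatC_eq :
    scatC σ u k = -(2 * Complex.I * z * (hu.pair σ).swap.beta (-z) / (2 * Complex.I * k)) := by
  rw [scatC, wronskian_psi_minus_plus hσ hu hs hk hkz]
  simp [osc]

end

theorem exp_eq_osc_sq {k : ℂ} {z : ℝ} (hkz : k ^ 2 = z) (x : ℝ) : Complex.exp (Complex.I * k ^ 2 * x) *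
    Complex.exp (Complex.I * k ^ 2 * x) = osc z x := by
  rw [hkz, osc, ← Complex.exp_add]
  congr 1
  push_cast
  ring

/-- Cramer's rule in a basis with Wronskian `1`. -/
theorem eq_wronskian_smul_add {p q : Fin 2 → ℂ} (h : wronskian p q = 1) (f : Fin 2 → ℂ) :
    f = wronskian f q • p + wronskian p f • q := by
  ext i
  fin_cases i <;> simp only [wronskian] at h ⊢ <;>
    simp only [Fin.zero_eta, Fin.mk_one, Pi.add_apply, Pi.smul_apply, smul_eq_mul]
  · linear_combination -(f 0) * h
  · linear_combination -(f 1) * h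

/-- At `k = 0` the Jost functions are constant by definition. -/
theorem scat_zero (σ : ℝ) (u : ℝ → ℂ) :
    scatA σ u 0 = 1 ∧ scatB σ u 0 = 0 ∧ scatC σ u 0 = 0 ∧ scatD σ u 0 = 1 := by
  simp [scatA, scatB, scatC, scatD, jostPhi, jostPsi, wronskian, e1, e2]

section
variable {σ : ℝ} {u : ℝ → ℂ} (hσ : σ = 1 ∨ σ = -1) (hu : IsPotential u) (hs : SmallNorm σ u)
  {k : ℂ} {z : ℝ} (hkz : k ^ 2 = z)
include hσ hu hs hkz

theorem scattering_phi (x : ℝ) :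
    Complex.exp (-(Complex.I * k ^ 2 * x)) • jostPhi σ u .minus x k =
      scatA σ u k • Complex.exp (-(Complex.I * k ^ 2 * x)) • jostPhi σ u .plus x k +
      scatB σ u k • Complex.exp (Complex.I * k ^ 2 * x) • jostPsi σ u .plus x k := by
  rcases eq_or_ne k 0 with rfl | hk
  · obtain ⟨ha, hb, -, -⟩ := scat_zero σ u
    rw [ha, hb]
    simp [jostPhi]
  have := eq_wronskian_smul_add (wronskian_phi_psi_plus hσ hu hs hk hkz x) (jostPhi σ u .minus x k)
  rw [wronskian_phi_minus_psi_plus hσ hu hs hk hkz, wronskian_phi_plus_minus hσ hu hs hk hkz,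
    ← scatA_eq hσ hu hs hk hkz, ← scatB_eq hσ hu hs hk hkz, ← exp_eq_osc_sq hkz] at this
  have hE : Complex.exp (-(Complex.I * k ^ 2 * x)) * Complex.exp (Complex.I * k ^ 2 * x) = 1 := by
    rw [← Complex.exp_add, neg_add_cancel, Complex.exp_zero]
  nth_rewrite 1 [this]
  simp only [smul_add, smul_smul]
  congr 2
  · ring
  · linear_combination (scatB σ u k * Complex.exp (Complex.I * k ^ 2 * x)) * hE

theorem scattering_psi (x : ℝ) :
    Complex.exp (Complex.I * k ^ 2 * x) • jostPsi σ u .minus x k =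
      scatC σ u k • Complex.exp (-(Complex.I * k ^ 2 * x)) • jostPhi σ u .plus x k +
      scatD σ u k • Complex.exp (Complex.I * k ^ 2 * x) • jostPsi σ u .plus x k := by
  rcases eq_or_ne k 0 with rfl | hk
  · obtain ⟨-, -, hc, hd⟩ := scat_zero σ u
    rw [hc, hd]
    simp [jostPsi]
  have := eq_wronskian_smul_add (wronskian_phi_psi_plus hσ hu hs hk hkz x) (jostPsi σ u .minus x k)
  rw [wronskian_phi_plus_psi_minus hσ hu hs hk hkz, wronskian_psi_minus_plus hσ hu hs hk hkz,
    ← scatD_eq hσ hu hs hk hkz, ← scatC_eq hσ hu hs hk hkz] at this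
  have hE : Complex.exp (Complex.I * k ^ 2 * x) * osc (-z) x
      = Complex.exp (-(Complex.I * k ^ 2 * x)) := by
    rw [hkz, osc, ← Complex.exp_add]
    congr 1
    push_cast
    ring
  nth_rewrite 1 [this]
  simp only [smul_add, smul_smul]
  congr 2
  · linear_combination scatC σ u k * hE
  · ring

/-- `2ik r₁(k)` depends on `z = k²` only. -/
theorem two_I_mul_r1 : 2 * Complex.I * k * r1 σ u k = 2 * Complex.I * (z * (hu.pair σ).rho z) := by
  rcases eq_or_ne k 0 with rfl | hk
  · have : (z : ℂ) = 0 := by simpa using hkz.symm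
    simp [this]
  rw [r1, scatA_eq hσ hu hs hk hkz, scatB_eq hσ hu hs hk hkz, Pair.rho]
  field_simp

/-- `-r₂(k) / (2ik)` depends on `z = k²` only. At `z = 0` the quotient is a division by zero, with
value `0`. -/
theorem neg_r2_div : -r2 σ u k / (2 * Complex.I * k) =
    if z = 0 then 0 else 1 / (2 * Complex.I) * (hu.pair σ).swap.rho (-z) := by
  rcases eq_or_ne k 0 with rfl | hk
  · have : z = 0 := by simpa using hkz.symm
    simp [this]
  have hz := ofReal_ne_zero_of_sq_eq hk hkz
  rw [r2, scatD_eq hσ hu hs hk hkz, scatC_eq hσ hu hs hk hkz, Pair.rho, if_neg hz, ← hkz]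
  have hI := Complex.I_ne_zero
  obtain ⟨M, -, hS⟩ := hu.exists_good hσ hs
  have := hS.alpha_ne_zero (-z)
  field_simp

end

theorem specRoot_sq (z : ℝ) : specRoot z ^ 2 = z := by
  rw [specRoot, one_div]
  exact_mod_cast Complex.cpow_nat_inv_pow (z : ℂ) two_ne_zero

theorem norm_specRoot (z : ℝ) : ‖specRoot z‖ = √|z| := by
  rw [← Real.sqrt_sq (norm_nonneg (specRoot z)), ← norm_pow, specRoot_sq, Complex.norm_real,
    Real.norm_eq_abs]

theorem measurable_specRoot : Measurable specRoot := by
  unfold specRoot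
  fun_prop

section
variable {σ : ℝ} {u : ℝ → ℂ} (hσ : σ = 1 ∨ σ = -1) (hu : IsPotential u) (hs : SmallNorm σ u)
include hσ hu hs

theorem rMinus_eq (z : ℝ) : rMinus σ u z = 2 * Complex.I * (z * (hu.pair σ).rho z) :=
  two_I_mul_r1 hσ hu hs (specRoot_sq z)

theorem rPlus_eq (z : ℝ) : rPlus σ u z =
    if z = 0 then 0 else 1 / (2 * Complex.I) * (hu.pair σ).swap.rho (-z) :=
  neg_r2_div hσ hu hs (specRoot_sq z)

theorem rPlus_ae : rPlus σ u =ᵐ[volume] fun z => 1 / (2 * Complex.I) * (hu.pair σ).swap.rho (-z) := by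
  filter_upwards [compl_mem_ae_iff.2 (measure_singleton (0 : ℝ))] with z hz
  rw [rPlus_eq hσ hu hs, if_neg (show z ≠ 0 from hz)]

/-- The direct scattering objects are well defined. -/
theorem directScatteringWellDefined : DirectScatteringWellDefined σ u where
  existsUnique_mu s z := ⟨_, (isJostMu_iff_eq hσ hu hs s z _).2 rfl,
    fun _ hf => (isJostMu_iff_eq hσ hu hs s z _).1 hf⟩
  existsUnique_nu s z := ⟨_, (isJostNu_iff_eq hσ hu hs s z _).2 rfl,
    fun _ hf => (isJostNu_iff_eq hσ hu hs s z _).1 hf⟩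
  scattering_phi _ _ hkz x := scattering_phi hσ hu hs hkz x
  scattering_psi _ _ hkz x := scattering_psi hσ hu hs hkz x
  a_ne_zero k z hkz := by
    rcases eq_or_ne k 0 with rfl | hk
    · simp [scat_zero σ u]
    obtain ⟨M, h, -⟩ := hu.exists_good hσ hs
    rw [scatA_eq hσ hu hs hk hkz]
    exact h.alpha_ne_zero z
  d_ne_zero k z hkz := by
    rcases eq_or_ne k 0 with rfl | hk
    · simp [scat_zero σ u]
    obtain ⟨M, -, h⟩ := hu.exists_good hσ hs
    rw [scatD_eq hσ hu hs hk hkz]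
    exact h.alpha_ne_zero (-z)
  root_independent k z hkz := by
    rw [rMinus_eq hσ hu hs, rPlus_eq hσ hu hs, two_I_mul_r1 hσ hu hs hkz,
      neg_r2_div hσ hu hs hkz]
    exact ⟨rfl, rfl⟩

end

/-! ### The reflection coefficients in `H¹ ∩ L^{2,1}` -/

section
variable {σ : ℝ} (hσ : σ = 1 ∨ σ = -1)
include hσ

theorem exists_h1Bound {u : ℝ → ℂ} (hu : IsPotential u) (hs : SmallNorm σ u) :
    ∃ C, H1Bound C (fun z : ℝ => (z : ℂ) * (hu.pair σ).rho z) ∧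
      H1Bound C (hu.pair σ).swap.rho ∧
      H1Bound C (hu.pair σ).rho ∧
      H1Bound C (fun z : ℝ => (z : ℂ) * (hu.pair σ).swap.rho z) ∧
      Continuous (hu.pair σ).rho ∧ Continuous (hu.pair σ).swap.rho := by
  obtain ⟨M, h, hS⟩ := hu.exists_good hσ hs
  obtain ⟨C, hC⟩ := Pair.exists_dataBound M
  exact ⟨C, (hC _ h).h1Bound_mul h.continuous_rho, (hC _ hS).h1Bound hS.continuous_rho,
    (hC _ h).h1Bound h.continuous_rho, (hC _ hS).h1Bound_mul hS.continuous_rho,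
    h.continuous_rho, hS.continuous_rho⟩

theorem memData_rMinus {u : ℝ → ℂ} (hu : IsPotential u) (hs : SmallNorm σ u) :
    MemData (rMinus σ u) := by
  obtain ⟨C, h, -⟩ := exists_h1Bound hσ hu hs
  rw [funext (rMinus_eq hσ hu hs)]
  exact (h.const_mul _).memData

theorem memData_rPlus {u : ℝ → ℂ} (hu : IsPotential u) (hs : SmallNorm σ u) :
    MemData (rPlus σ u) := by
  obtain ⟨C, -, h, -⟩ := exists_h1Bound hσ hu hs
  exact ((h.comp_neg.const_mul _).congr (rPlus_ae hσ hu hs).symm).memData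

omit hσ in
/-- A continuous function in `H¹ ∩ L^{2,1}` decays at least like `|z|^{-1/2}`. -/
theorem memLp_top_specRoot_mul {C : ℝ≥0} {f : ℝ → ℂ} (h : H1Bound C f) (hf : Continuous f) :
    MemLp (fun z => specRoot z * f z) ⊤ volume := by
  refine memLp_top_of_bound (measurable_specRoot.mul hf.measurable).aestronglyMeasurable (2 * C)
    (Eventually.of_forall fun z => ?_)
  rw [norm_mul, norm_specRoot]
  exact h.sqrt_abs_mul_norm_le hf z

theorem memLp_specRoot_mul_rMinus {u : ℝ → ℂ} (hu : IsPotential u) (hs : SmallNorm σ u) :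
    MemLp (fun z => specRoot z * rMinus σ u z) ⊤ volume := by
  obtain ⟨C, h, -, -, -, hc, -⟩ := exists_h1Bound hσ hu hs
  rw [funext (rMinus_eq hσ hu hs)]
  exact memLp_top_specRoot_mul (h.const_mul _) (by fun_prop)

theorem memLp_specRoot_mul_rPlus {u : ℝ → ℂ} (hu : IsPotential u) (hs : SmallNorm σ u) :
    MemLp (fun z => specRoot z * rPlus σ u z) ⊤ volume := by
  obtain ⟨C, -, h, -, -, -, hc⟩ := exists_h1Bound hσ hu hs
  refine (memLp_congr_ae ?_).2
    (memLp_top_specRoot_mul (h.comp_neg.const_mul (1 / (2 * Complex.I))) (by fun_prop))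
  filter_upwards [rPlus_ae hσ hu hs] with z hz
  rw [hz]

theorem memLp_specRoot_mul_mul_rPlus {u : ℝ → ℂ} (hu : IsPotential u) (hs : SmallNorm σ u) :
    MemLp (fun z : ℝ => 2 * Complex.I * specRoot z * z * rPlus σ u z) ⊤ volume := by
  obtain ⟨C, -, -, -, h, -, hc⟩ := exists_h1Bound hσ hu hs
  refine (memLp_congr_ae ?_).2 (memLp_top_specRoot_mul (h.comp_neg.const_mul (-1)) (by fun_prop))
  filter_upwards [rPlus_ae hσ hu hs] with z hz
  rw [hz]
  have hI := Complex.I_ne_zero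
  push_cast
  field_simp

theorem nice_diff {u w : ℝ → ℂ} (hu : IsPotential u) (hw : IsPotential w) {N : ℝ≥0}
    (hN : potentialNorm (u - w) ≤ N) : ((hu.pair σ).diff (hw.pair σ)).Nice N := by
  have h := hu.niceFun_sub hw hN
  refine ⟨h, ?_⟩
  convert h.nonlocalConj hσ using 1 <;> funext x <;>
    simp only [Pair.diff, IsPotential.pair, nonlocalConj, map_sub] <;> ring

theorem nice_diff_swap {u w : ℝ → ℂ} (hu : IsPotential u) (hw : IsPotential w) {N : ℝ≥0}
    (hN : potentialNorm (u - w) ≤ N) : ((hu.pair σ).swap.diff (hw.pair σ).swap).Nice N := by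
  have h := nice_diff hσ hu hw hN
  refine ⟨h.niceV, ?_⟩
  convert h.niceU.neg using 1 <;> funext x <;> simp only [Pair.diff, Pair.swap] <;> ring

/-- The difference of the reflection coefficients is controlled by every positive bound `N` for
the difference of the potentials. -/
theorem exists_dataNorm_sub_le (γ : ℝ≥0) : ∃ C : ℝ≥0, ∀ u w : ℝ → ℂ,
    IsPotential u → SmallNorm σ u → potentialNorm u ≤ γ →
    IsPotential w → SmallNorm σ w → potentialNorm w ≤ γ →
    ∀ N : ℝ≥0, 0 < N → potentialNorm (u - w) ≤ N →
      dataNorm (rMinus σ u - rMinus σ w) + dataNorm (rPlus σ u - rPlus σ w) ≤ (C * N : ℝ≥0) := by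
  obtain ⟨C, hC⟩ := Pair.exists_dataBound_sub γ
  refine ⟨4 * (‖2 * Complex.I‖₊ * C) + 4 * (‖1 / (2 * Complex.I)‖₊ * C),
    fun u w hu hsu hγu hw hsw hγw N hN hNd => ?_⟩
  have gu := hu.good hσ hγu hsu
  have gw := hw.good hσ hγw hsw
  have gu' := hu.good_swap hσ hγu hsu
  have gw' := hw.good_swap hσ hγw hsw
  have b1 := ((hC _ _ N hN gw gu (hw.small hσ hsw) (nice_diff hσ hu hw hNd)).h1Bound_mul
    (gu.continuous_rho.sub gw.continuous_rho)).const_mul (2 * Complex.I)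
  have b2 := (((hC _ _ N hN gw' gu' (hw.small_swap hσ hsw) (nice_diff_swap hσ hu hw hNd)).h1Bound
    (gu'.continuous_rho.sub gw'.continuous_rho)).comp_neg).const_mul (1 / (2 * Complex.I))
  have c1 := b1.congr (g := rMinus σ u - rMinus σ w) (Eventually.of_forall fun z => by
    simp only [Pi.sub_apply, rMinus_eq hσ hu hsu, rMinus_eq hσ hw hsw]
    ring)
  have c2 := b2.congr (g := rPlus σ u - rPlus σ w) (by
    filter_upwards [rPlus_ae hσ hu hsu, rPlus_ae hσ hw hsw] with z h1 h2
    rw [Pi.sub_apply, h1, h2]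
    ring)
  refine (add_le_add c1.dataNorm_le c2.dataNorm_le).trans_eq ?_
  rw [← ENNReal.coe_add]
  congr 1
  ring

/-- The reflection coefficients are Lipschitz continuous on bounded sets of potentials. -/
theorem exists_dataNorm_sub_le_mul (γ : ℝ≥0) : ∃ C : ℝ≥0, ∀ u w : ℝ → ℂ,
    IsPotential u → SmallNorm σ u → potentialNorm u ≤ γ →
    IsPotential w → SmallNorm σ w → potentialNorm w ≤ γ →
      dataNorm (rMinus σ u - rMinus σ w) + dataNorm (rPlus σ u - rPlus σ w) ≤
        C * potentialNorm (u - w) := by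
  obtain ⟨C, hC⟩ := exists_dataNorm_sub_le hσ γ
  refine ⟨C + 1, fun u w hu hsu hγu hw hsw hγw => ?_⟩
  rcases eq_or_ne (potentialNorm (u - w)) ⊤ with htop | htop
  · rw [htop, ENNReal.mul_top (by simp)]
    exact le_top
  lift potentialNorm (u - w) to ℝ≥0 using htop with p hp
  -- the bound needs `N > 0`, whereas `u - w` may vanish
  refine ENNReal.le_of_forall_pos_le_add fun ε hε _ => ?_
  have hN : potentialNorm (u - w) ≤ (p + ε / (C + 1) : ℝ≥0) := by
    rw [← hp]
    exact_mod_cast le_self_add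
  refine (hC u w hu hsu hγu hw hsw hγw _ (by positivity) hN).trans ?_
  norm_cast
  calc C * (p + ε / (C + 1)) ≤ (C + 1) * (p + ε / (C + 1)) := by
        gcongr
        exact le_self_add
    _ = (C + 1) * p + ε := by
        field_simp

end

end NDNLS

end

theorem mainTheorem3 (σ : ℝ) (hσ : σ = 1 ∨ σ = -1) :
    (∀ u : ℝ → ℂ, NDNLS.IsPotential u → NDNLS.SmallNorm σ u →
      NDNLS.DirectScatteringWellDefined σ u ∧
      NDNLS.MemData (NDNLS.rMinus σ u) ∧
      NDNLS.MemData (NDNLS.rPlus σ u) ∧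
      MemLp (fun z : ℝ => NDNLS.specRoot z * NDNLS.rMinus σ u z) ∞ volume ∧
      MemLp (fun z : ℝ => NDNLS.specRoot z * NDNLS.rPlus σ u z) ∞ volume ∧
      MemLp (fun z : ℝ => 2 * Complex.I * NDNLS.specRoot z * z * NDNLS.rPlus σ u z) ∞ volume) ∧
    (∀ γ : ℝ≥0, ∃ C : ℝ≥0, ∀ u w : ℝ → ℂ,
      NDNLS.IsPotential u → NDNLS.SmallNorm σ u → NDNLS.potentialNorm u ≤ γ →
      NDNLS.IsPotential w → NDNLS.SmallNorm σ w → NDNLS.potentialNorm w ≤ γ →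
      NDNLS.dataNorm (NDNLS.rMinus σ u - NDNLS.rMinus σ w) +
          NDNLS.dataNorm (NDNLS.rPlus σ u - NDNLS.rPlus σ w) ≤
        C * NDNLS.potentialNorm (u - w)) := by
  refine ⟨fun u hu hs => ?_, NDNLS.exists_dataNorm_sub_le_mul hσ⟩
  exact ⟨NDNLS.directScatteringWellDefined hσ hu hs, NDNLS.memData_rMinus hσ hu hs,
    NDNLS.memData_rPlus hσ hu hs, NDNLS.memLp_specRoot_mul_rMinus hσ hu hs,
    NDNLS.memLp_specRoot_mul_rPlus hσ hu hs, NDNLS.memLp_specRoot_mul_mul_rPlus hσ hu hs⟩
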